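/- All rings are commutative with unit, and $\mathbb{R}^+$ is the multiplicative group of positive reals. A *Banach ring* is a ring $A$ that is separated and complete for a nonarchimedean submultiplicative norm $|\cdot|$. For $r>0$ let $A^{\circ,r}$ (resp. $A^{\circ\circ,r}$) be the group of $a\in A$ for which the sequence $r^{-n}|a^n|$ is bounded (resp. tends to $0$), and let $\mathrm{Gr}\,A=\bigoplus_{r>0}A^{\circ,r}/A^{\circ\circ,r}$, a graded ring. An *affinoid Banach ring* is a pair $(A^{\rhd},A^{\mathrm{Gr}})$ of a Banach ring $A^{\rhd}$ and a graded subring $A^{\mathrm{Gr}}$ of $\mathrm{Gr}\,A^{\rhd}$ that is integrally closed in $\mathrm{Gr}\,A^{\rhd}$; let $A^{+,r}\subseteq A^{\rhd,\circ,r}$ be the set of elements whose class in degree $r$ lies in $A^{\mathrm{Gr}}$. A *reified semivaluation* on $A^{\rhd}$ is a map $v:A^{\rhd}\to\Gamma\cup\{0\}$, with $\Gamma$ a totally ordered abelian group containing $\mathbb{R}^+$ through a given strictly increasing homomorphism, such that $v(0)=0$, $v(1)=1$, $v(xy)=v(x)v(y)$ and $v(x+y)\le\max\{v(x),v(y)\}$.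 Let $\Gamma_v$ be the subgroup of $\Gamma$ generated by $\mathbb{R}^+$ and the nonzero values of $v$; two reified semivaluations $v,w$ are equivalent if they correspond under an order isomorphism $\Gamma_v\cong\Gamma_w$ compatible with $\mathbb{R}^+$. The space $X=\mathrm{Spra}(A^{\rhd},A^{\mathrm{Gr}})$ is the set of equivalence classes of those $v$ such that $v(a)\le r$ for all $r>0$ and all $a\in A^{\rhd,\circ\circ,r}\cup A^{+,r}$, and such that every $\gamma\in\Gamma_v$ satisfies $\gamma\ge r$ for some $r\in\mathbb{R}^+$. Its topology is generated by the sets $\{v: v(a)\le q\,v(b)\ne0\}$ for $a,b\in A^{\rhd}$, $q>0$. A *rational subspace* of $X$ is a set $\{v\in X: v(f_i)\le q_i v(f_0)\neq 0\ (i=1,\dots,n)\}$ with $f_0,\dots,f_n\in A^{\rhd}$, where $f_1,\dots,f_n$ generate the unit ideal, and $q_1,\dots,q_n>0$. The ring of the corresponding *rational localization* is the quotient $B^{\rhd}$ of $A^{\rhd}\{T_1/q_1,\dots,T_n/q_n\}$, the completion of $A^{\rhd}[T_1,\dots,T_n]$ for the Gauss norm $\sum_I a_I T^I\mapsto\max_I|a_I|\,q^I$,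 by the closure of the ideal $(f_0T_1-f_1,\dots,f_0T_n-f_n)$, with the quotient norm. The *structure presheaf* $\mathcal{O}$ on $X$ assigns to an open set $U$ the inverse limit of the rings $B^{\rhd}$ over the rational subspaces contained in $U$; the transition maps are the bounded $A^{\rhd}$-algebra homomorphisms associated with inclusions of rational subspaces. The pair $(A^{\rhd},A^{\mathrm{Gr}})$ is *sheafy* if $\mathcal{O}$ is a sheaf of rings. A Banach ring $B$ is *uniform* if its norm is equivalent to its spectral seminorm $\lim_n|b^n|^{1/n}$. The affinoid Banach ring $(A^{\rhd},A^{\mathrm{Gr}})$ is *really stably uniform* if $B^{\rhd}$ is uniform for every rational localization as above. **Theorem.** If an affinoid Banach ring $(A^{\rhd},A^{\mathrm{Gr}})$ is really stably uniform, then it is sheafy. -/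

import Mathlib

open CategoryTheory TopologicalSpace Opposite Filter Topology
open scoped NNReal

universe u

namespace Readic

noncomputable section

/-- The multiplicative group of positive real numbers. -/
abbrev PosReal : Type := {x : ℝ // 0 < x}

/-! ### Reified semivaluations and the reified valuative spectrum -/

/-- A reified semivaluation on `A`: a totally ordered abelian group `Γ` (written multiplicatively),
a semivaluation `A → Γ ∪ {0}`, and an order-preserving embedding of the positive reals in `Γ`. -/
structure ReifiedSemivaluation (A : Type u) [CommRing A] where
  Γ : Type u
  [commGroup : CommGroup Γ]
  [linearOrder : LinearOrder Γ]
  [isOrderedMonoid : IsOrderedMonoid Γ]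
  val : Valuation A (WithZero Γ)
  reif : PosReal →* Γ
  reif_strictMono : StrictMono reif

attribute [instance] ReifiedSemivaluation.commGroup ReifiedSemivaluation.linearOrder
  ReifiedSemivaluation.isOrderedMonoid

namespace ReifiedSemivaluation

variable {A : Type u} [CommRing A]

/-- The subgroup of `Γ` generated by the positive reals and the nonzero values of `v`. -/
def valueGroup (v : ReifiedSemivaluation A) : Subgroup v.Γ :=
  Subgroup.closure (Set.range v.reif ∪ {γ | ∃ a, v.val a = (γ : WithZero v.Γ)})

theorem reif_mem (v : ReifiedSemivaluation A) (q : PosReal) : v.reif q ∈ v.valueGroup :=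
  Subgroup.subset_closure (Or.inl ⟨q, rfl⟩)

theorem mem_of_val_eq (v : ReifiedSemivaluation A) {a : A} {γ : v.Γ}
    (h : v.val a = (γ : WithZero v.Γ)) : γ ∈ v.valueGroup :=
  Subgroup.subset_closure (Or.inr ⟨a, h⟩)

/-- Equivalence of reified semivaluations: an isomorphism of the reified value groups generated
by the values and the positive reals, carrying one semivaluation to the other. (Since all nonzero
values lie in the value groups, the last condition also says that the kernels agree.) -/
def Equivalent (v w : ReifiedSemivaluation A) : Prop :=
  ∃ i : v.valueGroup ≃*o w.valueGroup,
    (∀ q, (i ⟨v.reif q, v.reif_mem q⟩ : w.Γ) = w.reif q) ∧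
    ∀ (a : A) (γ : v.valueGroup),
      v.val a = ((γ : v.Γ) : WithZero v.Γ) ↔ w.val a = ((i γ : w.Γ) : WithZero w.Γ)

theorem Equivalent.refl (v : ReifiedSemivaluation A) : Equivalent v v :=
  ⟨OrderMonoidIso.refl _, fun _ => rfl, fun _ _ => Iff.rfl⟩

theorem Equivalent.symm {v w : ReifiedSemivaluation A} (h : Equivalent v w) : Equivalent w v := by
  obtain ⟨i, hq, ha⟩ := h
  refine ⟨i.symm, fun q => ?_, fun a γ => ?_⟩
  · have : i ⟨v.reif q, v.reif_mem q⟩ = ⟨w.reif q, w.reif_mem q⟩ := Subtype.ext (hq q)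
    rw [← this, OrderMonoidIso.symm_apply_apply]
  · rw [ha a (i.symm γ), OrderMonoidIso.apply_symm_apply]

theorem Equivalent.trans {u v w : ReifiedSemivaluation A} (h : Equivalent u v)
    (h' : Equivalent v w) : Equivalent u w := by
  obtain ⟨i, hq, ha⟩ := h
  obtain ⟨j, hq', ha'⟩ := h'
  refine ⟨i.trans j, fun q => ?_, fun a γ => ?_⟩
  · have : i ⟨u.reif q, u.reif_mem q⟩ = ⟨v.reif q, v.reif_mem q⟩ := Subtype.ext (hq q)
    rw [OrderMonoidIso.trans_apply, this, hq']
  · rw [ha, ha', OrderMonoidIso.trans_apply]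

instance setoid (A : Type u) [CommRing A] : Setoid (ReifiedSemivaluation A) where
  r := Equivalent
  iseqv := ⟨Equivalent.refl, Equivalent.symm, Equivalent.trans⟩

/-- The condition `v(a) ≤ q v(b)`. -/
def LE (v : ReifiedSemivaluation A) (a b : A) (q : PosReal) : Prop :=
  v.val a ≤ (v.reif q : WithZero v.Γ) * v.val b

/-- Every element of the value group is bounded below by a positive real. -/
def IsCofinal (v : ReifiedSemivaluation A) : Prop :=
  ∀ γ ∈ v.valueGroup, ∃ r : PosReal, v.reif r ≤ γ

theorem Equivalent.val_eq_zero {v w : ReifiedSemivaluation A} (h : Equivalent v w) {a : A}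
    (hv : v.val a = 0) : w.val a = 0 := by
  obtain ⟨i, -, ha⟩ := h
  by_contra hw
  obtain ⟨δ, hδ⟩ := WithZero.ne_zero_iff_exists.mp hw
  have := (ha a (i.symm ⟨δ, w.mem_of_val_eq hδ.symm⟩)).mpr (by simp [← hδ])
  rw [hv] at this
  exact WithZero.zero_ne_coe this

theorem Equivalent.le {v w : ReifiedSemivaluation A} (h : Equivalent v w) {a b : A} {q : PosReal}
    (hv : v.LE a b q) : w.LE a b q := by
  unfold LE at *
  by_cases hva : v.val a = 0
  · simp [h.val_eq_zero hva]
  by_cases hvb : v.val b = 0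
  · rw [hvb, mul_zero] at hv
    exact absurd (le_zero_iff.mp hv) hva
  obtain ⟨i, hq, ha⟩ := h
  obtain ⟨γ, hγ⟩ := WithZero.ne_zero_iff_exists.mp hva
  obtain ⟨δ, hδ⟩ := WithZero.ne_zero_iff_exists.mp hvb
  rw [(ha a ⟨γ, v.mem_of_val_eq hγ.symm⟩).mp hγ.symm,
    (ha b ⟨δ, v.mem_of_val_eq hδ.symm⟩).mp hδ.symm, ← hq, ← WithZero.coe_mul,
    WithZero.coe_le_coe, ← Subgroup.coe_mul, ← map_mul, Subtype.coe_le_coe]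
  refine (map_le_map_iff i).mpr ?_
  rw [← hγ, ← hδ, ← WithZero.coe_mul, WithZero.coe_le_coe] at hv
  exact hv

theorem Equivalent.isCofinal {v w : ReifiedSemivaluation A} (h : Equivalent v w)
    (hv : v.IsCofinal) : w.IsCofinal := by
  obtain ⟨i, hq, -⟩ := h
  intro γ hγ
  obtain ⟨r, hr⟩ := hv (i.symm ⟨γ, hγ⟩ : v.valueGroup) (Subtype.coe_prop _)
  refine ⟨r, ?_⟩
  have : (⟨v.reif r, v.reif_mem r⟩ : v.valueGroup) ≤ i.symm ⟨γ, hγ⟩ := hr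
  have h2 := (map_le_map_iff i).mpr this
  rw [OrderMonoidIso.apply_symm_apply] at h2
  rw [← hq]
  exact h2

end ReifiedSemivaluation

/-- The reified valuative spectrum: equivalence classes of reified semivaluations. -/
def Sprv (A : Type u) [CommRing A] : Type (u + 1) :=
  Quotient (ReifiedSemivaluation.setoid A)

namespace Sprv

variable {A : Type u} [CommRing A]

/-- The condition `v(a) ≤ q v(b)` on points of the reified valuative spectrum. -/
def LE (x : Sprv A) (a b : A) (q : PosReal) : Prop :=
  Quotient.lift (fun v : ReifiedSemivaluation A => v.LE a b q)
    (fun _ _ h => propext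
      ⟨fun k => ReifiedSemivaluation.Equivalent.le h k,
        fun k => ReifiedSemivaluation.Equivalent.le (ReifiedSemivaluation.Equivalent.symm h) k⟩) x

/-- The condition `v(a) = 0` on points of the reified valuative spectrum. -/
def Vanishes (x : Sprv A) (a : A) : Prop :=
  Quotient.lift (fun v : ReifiedSemivaluation A => v.val a = 0)
    (fun _ _ h => propext
      ⟨fun k => ReifiedSemivaluation.Equivalent.val_eq_zero h k,
        fun k => ReifiedSemivaluation.Equivalent.val_eq_zero
          (ReifiedSemivaluation.Equivalent.symm h) k⟩) x

/-- The condition that every element of the value group is bounded below by a positive real. -/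
def IsCofinal (x : Sprv A) : Prop :=
  Quotient.lift (fun v : ReifiedSemivaluation A => v.IsCofinal)
    (fun _ _ h => propext
      ⟨fun k => ReifiedSemivaluation.Equivalent.isCofinal h k,
        fun k => ReifiedSemivaluation.Equivalent.isCofinal
          (ReifiedSemivaluation.Equivalent.symm h) k⟩) x

/-- The topology generated by the sets `{v | v(a) ≤ q v(b) ≠ 0}`. -/
instance : TopologicalSpace (Sprv A) :=
  generateFrom {U | ∃ (a b : A) (q : PosReal), U = {x | x.LE a b q ∧ ¬ x.Vanishes b}}

end Sprv

/-! ### Power-bounded elements and the graded ring of a nonarchimedean seminormed ring -/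

section Graded

variable {A : Type u} [SeminormedCommRing A]

theorem norm_add_pow_le [IsUltrametricDist A] (a b : A) (n : ℕ) {C : ℝ} (hC : 0 ≤ C)
    (h : ∀ i ≤ n, ‖a ^ i‖ * ‖b ^ (n - i)‖ ≤ C) : ‖(a + b) ^ n‖ ≤ C := by
  rw [add_pow]
  refine IsUltrametricDist.norm_sum_le_of_forall_le_of_nonneg hC fun i hi => ?_
  rw [mul_comm, ← nsmul_eq_mul]
  refine (IsUltrametricDist.norm_nsmul_le _ _).trans ((norm_mul_le _ _).trans (h i ?_))
  exact Nat.lt_succ_iff.mp (Finset.mem_range.mp hi)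

theorem norm_neg_pow (a : A) (n : ℕ) : ‖(-a) ^ n‖ = ‖a ^ n‖ := by
  rcases Nat.even_or_odd n with h | h
  · rw [h.neg_pow]
  · rw [h.neg_pow, norm_neg]

theorem exists_bound_all {a : A} {r : PosReal}
    (h : ∃ C : ℝ, ∀ n : ℕ, 1 ≤ n → (r : ℝ)⁻¹ ^ n * ‖a ^ n‖ ≤ C) :
    ∃ C : ℝ, 0 ≤ C ∧ ∀ n : ℕ, (r : ℝ)⁻¹ ^ n * ‖a ^ n‖ ≤ C := by
  obtain ⟨C, hC⟩ := h
  refine ⟨max C ‖(1 : A)‖, le_max_of_le_right (norm_nonneg _), fun n => ?_⟩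
  rcases Nat.eq_zero_or_pos n with rfl | hn
  · simp
  · exact le_max_of_le_left (hC n hn)

theorem scaled_add_pow_le [IsUltrametricDist A] (a b : A) (r : PosReal) (n : ℕ) {C : ℝ} (hC : 0 ≤ C)
    (h : ∀ i ≤ n, ((r : ℝ)⁻¹ ^ i * ‖a ^ i‖) * ((r : ℝ)⁻¹ ^ (n - i) * ‖b ^ (n - i)‖) ≤ C) :
    (r : ℝ)⁻¹ ^ n * ‖(a + b) ^ n‖ ≤ C := by
  have hr : 0 < (r : ℝ)⁻¹ ^ n := pow_pos (inv_pos.mpr r.2) n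
  have : ‖(a + b) ^ n‖ ≤ C / (r : ℝ)⁻¹ ^ n := by
    refine norm_add_pow_le a b n (div_nonneg hC hr.le) fun i hi => ?_
    rw [le_div_iff₀ hr]
    refine le_trans (le_of_eq ?_) (h i hi)
    rw [show (r : ℝ)⁻¹ ^ n = (r : ℝ)⁻¹ ^ i * (r : ℝ)⁻¹ ^ (n - i) by
      rw [← pow_add, Nat.add_sub_cancel' hi]]
    ring
  rw [le_div_iff₀ hr] at this
  linarith

theorem scaled_mul_pow_le (a b : A) (r s : PosReal) (n : ℕ) :
    ((r * s : PosReal) : ℝ)⁻¹ ^ n * ‖(a * b) ^ n‖ ≤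
      ((r : ℝ)⁻¹ ^ n * ‖a ^ n‖) * ((s : ℝ)⁻¹ ^ n * ‖b ^ n‖) := by
  have hr := r.2
  have hs := s.2
  rw [mul_pow, Positive.val_mul, mul_inv, mul_pow]
  calc _ ≤ (r : ℝ)⁻¹ ^ n * (s : ℝ)⁻¹ ^ n * (‖a ^ n‖ * ‖b ^ n‖) := by
        gcongr
        exact norm_mul_le _ _
    _ = _ := by ring

variable (A) [IsUltrametricDist A]

/-- The additive group of those `a` for which the sequence `r⁻ⁿ |aⁿ|`, `n ≥ 1`, is bounded. -/
def powBounded (r : PosReal) : AddSubgroup A where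
  carrier := {a | ∃ C : ℝ, ∀ n : ℕ, 1 ≤ n → (r : ℝ)⁻¹ ^ n * ‖a ^ n‖ ≤ C}
  zero_mem' := ⟨0, fun n hn => by simp [zero_pow (Nat.one_le_iff_ne_zero.mp hn)]⟩
  neg_mem' := by
    rintro a ⟨C, hC⟩
    exact ⟨C, fun n hn => by rw [norm_neg_pow]; exact hC n hn⟩
  add_mem' := by
    intro a b ha hb
    obtain ⟨C, hC0, hC⟩ := exists_bound_all ha
    obtain ⟨D, hD0, hD⟩ := exists_bound_all hb
    refine ⟨C * D, fun n _ => scaled_add_pow_le a b r n (mul_nonneg hC0 hD0) fun i _ => ?_⟩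
    have := r.2
    exact mul_le_mul (hC i) (hD _) (by positivity) hC0

variable {A}

theorem bounded_of_tendsto {a : A} {r : PosReal}
    (h : Tendsto (fun n : ℕ => (r : ℝ)⁻¹ ^ n * ‖a ^ n‖) atTop (𝓝 0)) :
    a ∈ powBounded A r := by
  obtain ⟨C, hC⟩ := h.bddAbove_range
  exact ⟨C, fun n _ => hC ⟨n, rfl⟩⟩

variable (A)

/-- The additive group of those `a` for which the sequence `r⁻ⁿ |aⁿ|` converges to `0`. -/
def topNilp (r : PosReal) : AddSubgroup A where
  carrier := {a | Tendsto (fun n : ℕ => (r : ℝ)⁻¹ ^ n * ‖a ^ n‖) atTop (𝓝 0)}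
  zero_mem' := by
    refine tendsto_const_nhds.congr' ?_
    filter_upwards [eventually_ge_atTop 1] with n hn
    simp [zero_pow (Nat.one_le_iff_ne_zero.mp hn)]
  neg_mem' := by
    intro a ha
    simpa only [Set.mem_ofPred_eq, norm_neg_pow] using ha
  add_mem' := by
    intro a b ha hb
    obtain ⟨C, hC0, hC⟩ := exists_bound_all (bounded_of_tendsto ha)
    obtain ⟨D, hD0, hD⟩ := exists_bound_all (bounded_of_tendsto hb)
    have hr := r.2
    have hpos : ∀ (x : A) (n : ℕ), 0 ≤ (r : ℝ)⁻¹ ^ n * ‖x ^ n‖ := fun x n => by positivity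
    rw [Set.mem_ofPred_eq, Metric.tendsto_atTop] at *
    intro ε hε
    have hM : 0 < C + D + 1 := by positivity
    obtain ⟨N, hN⟩ := ha (ε / 2 / (C + D + 1)) (by positivity)
    obtain ⟨M, hM'⟩ := hb (ε / 2 / (C + D + 1)) (by positivity)
    refine ⟨N + M, fun n hn => ?_⟩
    rw [Real.dist_eq, sub_zero, abs_of_nonneg (hpos _ _)]
    refine lt_of_le_of_lt (scaled_add_pow_le a b r n (C := ε / 2) (by positivity)
      fun i hi => ?_) (by linarith)
    have key : ∀ x y : ℝ, 0 ≤ y → y ≤ C + D + 1 → x ≤ ε / 2 / (C + D + 1) → x * y ≤ ε / 2 := by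
      intro x y hy hy' hx
      calc x * y ≤ ε / 2 / (C + D + 1) * (C + D + 1) := by gcongr
        _ = ε / 2 := by field_simp
    rcases le_or_gt N i with h | h
    · have := hN i h
      rw [Real.dist_eq, sub_zero, abs_of_nonneg (hpos _ _)] at this
      exact key _ _ (hpos _ _) (by linarith [hD (n - i)]) this.le
    · have := hM' (n - i) (by omega)
      rw [Real.dist_eq, sub_zero, abs_of_nonneg (hpos _ _)] at this
      rw [mul_comm]
      exact key _ _ (hpos _ _) (by linarith [hC i]) this.le

variable {A}

theorem one_mem_powBounded : (1 : A) ∈ powBounded A 1 :=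
  ⟨‖(1 : A)‖, fun n _ => by simp⟩

theorem mul_mem_powBounded {r s : PosReal} {a b : A} (ha : a ∈ powBounded A r)
    (hb : b ∈ powBounded A s) : a * b ∈ powBounded A (r * s) := by
  obtain ⟨C, hC0, hC⟩ := exists_bound_all ha
  obtain ⟨D, hD0, hD⟩ := exists_bound_all hb
  refine ⟨C * D, fun n _ => (scaled_mul_pow_le a b r s n).trans ?_⟩
  have := s.2
  exact mul_le_mul (hC n) (hD n) (by positivity) hC0

theorem mul_mem_topNilp {r s : PosReal} {a b : A} (ha : a ∈ topNilp A r)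
    (hb : b ∈ powBounded A s) : a * b ∈ topNilp A (r * s) := by
  obtain ⟨D, hD0, hD⟩ := exists_bound_all hb
  have hr := r.2
  have hs := s.2
  have ha' : Tendsto (fun n : ℕ => ((r : ℝ)⁻¹ ^ n * ‖a ^ n‖) * D) atTop (𝓝 0) := by
    simpa using Tendsto.mul_const D ha
  refine squeeze_zero (fun n => ?_) (fun n => (scaled_mul_pow_le a b r s n).trans ?_) ha'
  · have := (r * s).2
    positivity
  · exact mul_le_mul_of_nonneg_left (hD n) (by positivity)

theorem mul_mem_topNilp' {r s : PosReal} {a b : A} (ha : a ∈ powBounded A r)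
    (hb : b ∈ topNilp A s) : a * b ∈ topNilp A (r * s) := by
  rw [mul_comm a, mul_comm r]
  exact mul_mem_topNilp hb ha

variable (A)

/-- The graded piece of degree `r`: power-bounded elements of weight `r` modulo topologically
nilpotent elements of weight `r`. The index is written additively, as Mathlib requires. -/
abbrev GrPiece (r : Additive PosReal) : Type u :=
  powBounded A r.toMul ⧸ (topNilp A r.toMul).addSubgroupOf (powBounded A r.toMul)

variable {A}

/-- The class in degree `r` of a power-bounded element of weight `r`. -/
def pieceMk (r : Additive PosReal) : powBounded A r.toMul →+ GrPiece A r :=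
  QuotientAddGroup.mk' _

theorem pieceMk_surjective (r : Additive PosReal) :
    Function.Surjective (pieceMk (A := A) r) :=
  QuotientAddGroup.mk'_surjective _

theorem pieceMk_eq_iff {r : Additive PosReal} (a b : powBounded A r.toMul) :
    pieceMk r a = pieceMk r b ↔ -(a : A) + b ∈ topNilp A r.toMul := by
  unfold pieceMk
  rw [QuotientAddGroup.mk'_apply, QuotientAddGroup.mk'_apply, QuotientAddGroup.eq,
    AddSubgroup.mem_addSubgroupOf]
  rfl

/-- Multiplication of representatives. -/
def powMul {r s : Additive PosReal} (a : powBounded A r.toMul) (b : powBounded A s.toMul) :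
    powBounded A (r + s).toMul :=
  ⟨a * b, mul_mem_powBounded a.2 b.2⟩

/-- Multiplication of the graded pieces. -/
def pieceMul {r s : Additive PosReal} (x : GrPiece A r) (y : GrPiece A s) : GrPiece A (r + s) :=
  Quotient.map₂ powMul (by
    intro a a' ha b b' hb
    have ha' := (pieceMk_eq_iff a a').mp (Quotient.sound ha)
    have hb' := (pieceMk_eq_iff b b').mp (Quotient.sound hb)
    refine Quotient.exact ((pieceMk_eq_iff (powMul a b) (powMul a' b')).mpr ?_)
    have : -((powMul a b : A)) + powMul a' b' = (-(a : A) + a') * b + a' * (-(b : A) + b') := by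
      simp only [powMul]
      ring
    rw [this]
    exact add_mem (mul_mem_topNilp ha' b.2) (mul_mem_topNilp' a'.2 hb')) x y

theorem pieceMul_mk {r s : Additive PosReal} (a : powBounded A r.toMul)
    (b : powBounded A s.toMul) :
    pieceMul (pieceMk r a) (pieceMk s b) = pieceMk (r + s) (powMul a b) := rfl

theorem gradedMk_eq {r s : Additive PosReal} (h : r = s) (a : powBounded A r.toMul)
    (b : powBounded A s.toMul) (hab : (a : A) = b) :
    GradedMonoid.mk (A := GrPiece A) r (pieceMk r a) = GradedMonoid.mk s (pieceMk s b) := by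
  subst h
  rw [Subtype.ext hab]

instance : GradedMonoid.GMul (GrPiece A) where
  mul := pieceMul

instance : GradedMonoid.GOne (GrPiece A) where
  one := pieceMk 0 ⟨1, one_mem_powBounded⟩

theorem graded_mul_mk {r s : Additive PosReal} (a : powBounded A r.toMul)
    (b : powBounded A s.toMul) :
    GradedMonoid.mk (A := GrPiece A) r (pieceMk r a) * GradedMonoid.mk s (pieceMk s b) =
      GradedMonoid.mk (r + s) (pieceMk (r + s) (powMul a b)) := rfl

theorem graded_one :
    (1 : GradedMonoid (GrPiece A)) = GradedMonoid.mk 0 (pieceMk 0 ⟨1, one_mem_powBounded⟩) := rfl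

theorem graded_exists (x : GradedMonoid (GrPiece A)) :
    ∃ (r : Additive PosReal) (a : powBounded A r.toMul),
      x = GradedMonoid.mk r (pieceMk r a) := by
  obtain ⟨r, x⟩ := x
  obtain ⟨a, rfl⟩ := pieceMk_surjective r x
  exact ⟨r, a, rfl⟩

instance : DirectSum.GCommRing (GrPiece A) where
  mul_zero := by
    intro r s x
    obtain ⟨a, rfl⟩ := pieceMk_surjective r x
    change pieceMul _ (0 : GrPiece A s) = 0
    rw [← map_zero (pieceMk (A := A) s), pieceMul_mk, ← map_zero (pieceMk (A := A) (r + s))]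
    congr 1
    exact Subtype.ext (mul_zero _)
  zero_mul := by
    intro r s x
    obtain ⟨a, rfl⟩ := pieceMk_surjective s x
    change pieceMul (0 : GrPiece A r) _ = 0
    rw [← map_zero (pieceMk (A := A) r), pieceMul_mk, ← map_zero (pieceMk (A := A) (r + s))]
    congr 1
    exact Subtype.ext (zero_mul _)
  mul_add := by
    intro r s x y z
    obtain ⟨a, rfl⟩ := pieceMk_surjective r x
    obtain ⟨b, rfl⟩ := pieceMk_surjective s y
    obtain ⟨c, rfl⟩ := pieceMk_surjective s z
    change pieceMul _ _ = pieceMul _ _ + pieceMul _ _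
    rw [← map_add, pieceMul_mk, pieceMul_mk, pieceMul_mk, ← map_add]
    congr 1
    exact Subtype.ext (mul_add _ _ _)
  add_mul := by
    intro r s x y z
    obtain ⟨a, rfl⟩ := pieceMk_surjective r x
    obtain ⟨b, rfl⟩ := pieceMk_surjective r y
    obtain ⟨c, rfl⟩ := pieceMk_surjective s z
    change pieceMul _ _ = pieceMul _ _ + pieceMul _ _
    rw [← map_add, pieceMul_mk, pieceMul_mk, pieceMul_mk, ← map_add]
    congr 1
    exact Subtype.ext (add_mul _ _ _)
  one_mul := by
    intro x
    obtain ⟨r, a, rfl⟩ := graded_exists x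
    rw [graded_one, graded_mul_mk]
    exact gradedMk_eq (zero_add r) _ _ (one_mul _)
  mul_one := by
    intro x
    obtain ⟨r, a, rfl⟩ := graded_exists x
    rw [graded_one, graded_mul_mk]
    exact gradedMk_eq (add_zero r) _ _ (mul_one _)
  mul_assoc := by
    intro x y z
    obtain ⟨r, a, rfl⟩ := graded_exists x
    obtain ⟨s, b, rfl⟩ := graded_exists y
    obtain ⟨t, c, rfl⟩ := graded_exists z
    rw [graded_mul_mk, graded_mul_mk, graded_mul_mk, graded_mul_mk]
    exact gradedMk_eq (add_assoc r s t) _ _ (mul_assoc _ _ _)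
  mul_comm := by
    intro x y
    obtain ⟨r, a, rfl⟩ := graded_exists x
    obtain ⟨s, b, rfl⟩ := graded_exists y
    rw [graded_mul_mk, graded_mul_mk]
    exact gradedMk_eq (add_comm r s) _ _ (mul_comm _ _)
  natCast n := n • pieceMk 0 ⟨1, one_mem_powBounded⟩
  natCast_zero := zero_nsmul _
  natCast_succ n := succ_nsmul _ n
  intCast n := n • pieceMk 0 ⟨1, one_mem_powBounded⟩
  intCast_ofNat n := natCast_zsmul _ n
  intCast_negSucc_ofNat n := negSucc_zsmul _ n

variable (A)

/-- The graded ring `Gr A = ⊕_{r > 0} Gr^r A`. -/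
abbrev Gr : Type u := DirectSum (Additive PosReal) (GrPiece A)

variable {A}

/-- The homogeneous class in degree `r` of a power-bounded element of weight `r`. -/
def Gr.cls (r : PosReal) (a : A) (ha : a ∈ powBounded A r) : Gr A :=
  DirectSum.of (GrPiece A) (Additive.ofMul r) (pieceMk (Additive.ofMul r) ⟨a, ha⟩)

/-- An integrally closed graded subring of `Gr A`: it contains the homogeneous components of each
of its elements, and each element of `Gr A` integral over it. For `A` complete and separated,
these are the data making `A` into an affinoid Banach ring. -/
structure IsIntegralStructure (S : Subring (Gr A)) : Prop where
  homogeneous : ∀ x ∈ S, ∀ r : Additive PosReal, DirectSum.of (GrPiece A) r (x r) ∈ S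
  integrallyClosed : ∀ x : Gr A, IsIntegral S x → x ∈ S

/-- The set `A^{+,r}` of power-bounded elements of weight `r` whose class lies in `S`. -/
def plusPart (S : Subring (Gr A)) (r : PosReal) : Set A :=
  {a | ∃ ha : a ∈ powBounded A r, Gr.cls r a ha ∈ S}

/-! ### The reified adic spectrum -/

/-- Boundedness of a point: `v(a) ≤ r` for all topologically nilpotent `a` of weight `r`. -/
def Sprv.IsBounded (x : Sprv A) : Prop :=
  ∀ r : PosReal, ∀ a ∈ topNilp A r, x.LE a 1 r

variable (A)

/-- The space of commensurable points. -/
def Comm : Set (Sprv A) := {x | x.IsBounded ∧ x.IsCofinal}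

variable {A}

/-- The reified adic spectrum of `(A, S)`, as a set of points; it carries the subspace topology. -/
def Spra (S : Subring (Gr A)) : Set (Sprv A) :=
  {x | x ∈ Comm A ∧ ∀ r : PosReal, ∀ a ∈ plusPart S r, x.LE a 1 r}

end Graded

/-! ### Weighted Tate algebras -/

section WeightedTate

variable (A : Type u) [SeminormedCommRing A] {n : ℕ}

/-- The polynomial ring `A[T₁, …, Tₙ]`, to be normed by the Gauss norm of weights `q`. -/
def WPoly (_q : Fin n → PosReal) : Type u := MvPolynomial (Fin n) A

variable (q : Fin n → PosReal)

instance : CommRing (WPoly A q) := inferInstanceAs (CommRing (MvPolynomial (Fin n) A))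

variable {A} {q}

/-- The weight `q₁^{i₁} ⋯ qₙ^{iₙ}` of a monomial. -/
def weight (q : Fin n → PosReal) (I : Fin n →₀ ℕ) : ℝ≥0 :=
  ∏ i, (q i : ℝ).toNNReal ^ I i

theorem weight_add (I J : Fin n →₀ ℕ) : weight q (I + J) = weight q I * weight q J := by
  simp only [weight, Finsupp.add_apply, pow_add, Finset.prod_mul_distrib]

/-- The weighted Gauss norm `max_I |a_I| q^I`. -/
def gaussNNNorm (q : Fin n → PosReal) (P : MvPolynomial (Fin n) A) : ℝ≥0 :=
  P.support.sup fun I => ‖P.coeff I‖₊ * weight q I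

theorem le_gaussNNNorm (P : MvPolynomial (Fin n) A) (I : Fin n →₀ ℕ) :
    ‖P.coeff I‖₊ * weight q I ≤ gaussNNNorm q P := by
  by_cases h : I ∈ P.support
  · exact Finset.le_sup (f := fun I => ‖P.coeff I‖₊ * weight q I) h
  · rw [MvPolynomial.notMem_support_iff.mp h]
    simp

theorem gaussNNNorm_le {P : MvPolynomial (Fin n) A} {C : ℝ≥0}
    (h : ∀ I, ‖P.coeff I‖₊ * weight q I ≤ C) : gaussNNNorm q P ≤ C :=
  Finset.sup_le fun I _ => h I

theorem gaussNNNorm_zero : gaussNNNorm q (0 : MvPolynomial (Fin n) A) = 0 := by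
  simp [gaussNNNorm]

theorem gaussNNNorm_neg (P : MvPolynomial (Fin n) A) :
    gaussNNNorm q (-P) = gaussNNNorm q P := by
  simp [gaussNNNorm]

variable [IsUltrametricDist A]

theorem gaussNNNorm_add (P Q : MvPolynomial (Fin n) A) :
    gaussNNNorm q (P + Q) ≤ max (gaussNNNorm q P) (gaussNNNorm q Q) := by
  refine gaussNNNorm_le fun I => ?_
  rw [MvPolynomial.coeff_add]
  calc _ ≤ max ‖P.coeff I‖₊ ‖Q.coeff I‖₊ * weight q I := by
        gcongr
        exact IsUltrametricDist.nnnorm_add_le_max _ _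
    _ = max (‖P.coeff I‖₊ * weight q I) (‖Q.coeff I‖₊ * weight q I) := max_mul_of_nonneg _ _ zero_le
    _ ≤ _ := max_le_max (le_gaussNNNorm P I) (le_gaussNNNorm Q I)

theorem gaussNNNorm_mul (P Q : MvPolynomial (Fin n) A) :
    gaussNNNorm q (P * Q) ≤ gaussNNNorm q P * gaussNNNorm q Q := by
  classical
  refine gaussNNNorm_le fun I => ?_
  rw [MvPolynomial.coeff_mul]
  rcases eq_or_ne (weight q I) 0 with h0 | h0
  · simp [h0]
  rw [← le_div_iff₀ (pos_iff_ne_zero.mpr h0)]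
  refine IsUltrametricDist.nnnorm_sum_le_of_forall_le fun x hx => ?_
  rw [le_div_iff₀ (pos_iff_ne_zero.mpr h0), show I = x.1 + x.2 from (by simpa using hx : x.1 + x.2 = I).symm, weight_add]
  calc _ ≤ ‖P.coeff x.1‖₊ * ‖Q.coeff x.2‖₊ * (weight q x.1 * weight q x.2) := by
        gcongr
        exact nnnorm_mul_le _ _
    _ = (‖P.coeff x.1‖₊ * weight q x.1) * (‖Q.coeff x.2‖₊ * weight q x.2) := by ring
    _ ≤ _ := mul_le_mul' (le_gaussNNNorm P _) (le_gaussNNNorm Q _)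

variable (A) (q)

/-- The weighted Gauss norm as a group seminorm. -/
def gaussSeminorm : AddGroupSeminorm (WPoly A q) where
  toFun P := gaussNNNorm (A := A) q P
  map_zero' := by
    rw [NNReal.coe_eq_zero]
    exact gaussNNNorm_zero
  add_le' P Q := by
    rw [← NNReal.coe_add, NNReal.coe_le_coe]
    exact (gaussNNNorm_add (A := A) P Q).trans (max_le (le_add_of_nonneg_right zero_le)
      (le_add_of_nonneg_left zero_le))
  neg' P := by
    rw [NNReal.coe_inj]
    exact gaussNNNorm_neg (A := A) P

instance : SeminormedCommRing (WPoly A q) :=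
  { (gaussSeminorm A q).toSeminormedAddCommGroup, (inferInstance : CommRing (WPoly A q)) with
    norm_mul_le := fun P Q => by
      change ((gaussNNNorm (A := A) q _ : ℝ≥0) : ℝ) ≤ gaussNNNorm (A := A) q _ *
        gaussNNNorm (A := A) q _
      exact_mod_cast gaussNNNorm_mul (A := A) P Q }

/-- The weighted Tate algebra `A{T₁/q₁, …, Tₙ/qₙ}`: the completion of the polynomial ring for the
weighted Gauss norm. -/
abbrev WTate : Type u := UniformSpace.Completion (WPoly A q)

/-- The canonical map from the polynomial ring to the weighted Tate algebra. -/
def polyToTate : MvPolynomial (Fin n) A →+* WTate A q :=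
  (UniformSpace.Completion.coeRingHom : WPoly A q →+* WTate A q)

end WeightedTate

/-! ### Rational subspaces and rational localizations -/

section Rational

variable (A : Type u) [NormedCommRing A] [IsUltrametricDist A]

/-- Parameters `f₀, …, fₙ` and scale factors `q₁, …, qₙ` defining a rational subspace, where
`f₁, …, fₙ` generate the unit ideal. -/
structure RationalDatum where
  n : ℕ
  f₀ : A
  f : Fin n → A
  q : Fin n → PosReal
  span_eq_top : Ideal.span (Set.range f) = ⊤

namespace RationalDatum

variable {A} (D : RationalDatum A)

/-- The set of `v` with `v(f_i) ≤ q_i v(f₀) ≠ 0` for `i = 1, …, n`. -/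
def locus : Set (Sprv A) :=
  {x | (∀ i, x.LE (D.f i) D.f₀ (D.q i)) ∧ ¬ x.Vanishes D.f₀}

/-- The rational subspace of the reified adic spectrum defined by `D`. -/
def subspace (S : Subring (Gr A)) : Set (Spra S) := {x | (x : Sprv A) ∈ D.locus}

/-- The closure of the ideal `(f₀ T₁ - f₁, …, f₀ Tₙ - fₙ)`. -/
def relIdeal : Ideal (WTate A D.q) :=
  (Ideal.span (Set.range fun i =>
    polyToTate A D.q (MvPolynomial.C D.f₀ * MvPolynomial.X i - MvPolynomial.C (D.f i)))).closure

instance : IsClosed (D.relIdeal : Set (WTate A D.q)) := by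
  unfold relIdeal
  rw [Ideal.coe_closure]
  exact isClosed_closure

/-- The ring of the rational localization representing the rational subspace defined by `D`,
with the quotient norm. -/
abbrev Loc : Type u := WTate A D.q ⧸ D.relIdeal

/-- The structure homomorphism of the rational localization. -/
def toLoc : A →+* D.Loc :=
  (Ideal.Quotient.mk D.relIdeal).comp ((polyToTate A D.q).comp MvPolynomial.C)

end RationalDatum

end Rational

/-- A homomorphism of seminormed rings is bounded if `|f(a)| ≤ c |a|` for some `c > 0`. -/
def IsBoundedHom {B C : Type u} [SeminormedCommRing B] [SeminormedCommRing C]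
    (f : B →+* C) : Prop :=
  ∃ c : ℝ, 0 < c ∧ ∀ b, ‖f b‖ ≤ c * ‖b‖

/-! ### Uniformity -/

/-- The spectral seminorm `lim |aⁿ|^{1/n}`. -/
def spectralSeminorm {B : Type u} [SeminormedCommRing B] (b : B) : ℝ :=
  limUnder atTop fun n : ℕ => ‖b ^ n‖ ^ (1 / (n : ℝ))

/-- A Banach ring is uniform if its norm is equivalent to its spectral seminorm. -/
def IsUniform (B : Type u) [NormedCommRing B] : Prop :=
  ∃ c C : ℝ, 0 < c ∧ 0 < C ∧
    ∀ b : B, c * spectralSeminorm b ≤ ‖b‖ ∧ ‖b‖ ≤ C * spectralSeminorm b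

/-- Every rational localization of `A` is uniform. (The rings of the rational localizations are
determined by the defining parameters in `A`, so that the graded subring plays no role here.) -/
def IsReallyStablyUniform (A : Type u) [NormedCommRing A] [IsUltrametricDist A] : Prop :=
  ∀ D : RationalDatum A, IsUniform D.Loc

/-! ### The structure presheaf -/

section StructurePresheaf

variable {A : Type u} [NormedCommRing A] [IsUltrametricDist A] (S : Subring (Gr A))

/-- The rational data whose rational subspace is contained in the open set `U`. -/
abbrev RationalIn (U : Opens (TopCat.of (Spra S))) : Type u :=
  {D : RationalDatum A // D.subspace S ⊆ (U : Set (Spra S))}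

/-- The inverse limit of the rings of the rational localizations representing the rational
subspaces contained in `U`, as the ring of compatible families. The transition maps are the bounded
homomorphisms of `A`-algebras belonging to the inclusions of rational subspaces: such a homomorphism
is unique, as `f₀` becomes a unit in the localization and `T_i = f_i / f₀` there. -/
def sections (U : Opens (TopCat.of (Spra S))) : Subring (∀ D : RationalIn S U, D.1.Loc) where
  carrier := {s | ∀ D E : RationalIn S U, E.1.subspace S ⊆ D.1.subspace S →
    ∀ φ : D.1.Loc →+* E.1.Loc, IsBoundedHom φ → φ.comp D.1.toLoc = E.1.toLoc → φ (s D) = s E}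
  zero_mem' := fun _ _ _ φ _ _ => map_zero φ
  one_mem' := fun _ _ _ φ _ _ => map_one φ
  add_mem' := fun {s t} hs ht D E h φ hφ h' => by
    rw [Pi.add_apply, Pi.add_apply, map_add, hs D E h φ hφ h', ht D E h φ hφ h']
  mul_mem' := fun {s t} hs ht D E h φ hφ h' => by
    rw [Pi.mul_apply, Pi.mul_apply, map_mul, hs D E h φ hφ h', ht D E h φ hφ h']
  neg_mem' := fun {s} hs D E h φ hφ h' => by
    rw [Pi.neg_apply, Pi.neg_apply, map_neg, hs D E h φ hφ h']

/-- Restriction of compatible families to a smaller open set. -/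
def restrict {U V : Opens (TopCat.of (Spra S))} (h : V ≤ U) : sections S U →+* sections S V where
  toFun s := ⟨fun D => s.1 ⟨D.1, D.2.trans h⟩,
    fun D E => s.2 ⟨D.1, D.2.trans h⟩ ⟨E.1, E.2.trans h⟩⟩
  map_zero' := rfl
  map_one' := rfl
  map_add' _ _ := rfl
  map_mul' _ _ := rfl

/-- The structure presheaf on the reified adic spectrum. -/
def structurePresheaf : TopCat.Presheaf CommRingCat.{u} (TopCat.of (Spra S)) where
  obj U := CommRingCat.of (sections S U.unop)
  map f := CommRingCat.ofHom (restrict S f.unop.le)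
  map_id _ := rfl
  map_comp _ _ := rfl

/-- `(A, S)` is sheafy if its structure presheaf is a sheaf. -/
def IsSheafy : Prop := (structurePresheaf S).IsSheaf

end StructurePresheaf

end

end Readic

-- Uniformity makes the norm of a localization visible at Berkovich points, the multiplicative
-- seminorms bounded by the norm: up to a constant, the norm is controlled by the values there
-- (`IsUniform.exists_norm_le`). Behind this is the classical existence argument: a
-- power-multiplicative seminorm is made multiplicative at finitely many elements at a time, and
-- compactness gives a limit multiplicative everywhere. Every Berkovich point of `A` is a rank-one
-- point of the reified spectrum, whatever the graded subring, and it lies in a rational subspace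
-- exactly when it extends to the localization. Hence inclusions of rational subspaces induce
-- bounded maps (`exists_trans`), and the norm on a localization is bounded by a constant times the
-- norms on any rational cover (`exists_norm_le_of_cover`). The latter gives separatedness, and also
-- that a localization has closed image in the product over a finite cover.
--
-- The heart of the gluing is the two-piece cover v(f) ≤ q v(g), v(f) ≥ q v(g) of a rational
-- subspace on which v(g) is bounded below. Put c = f/g in `D.Loc`. Sections on the pieces are
-- approximated by polynomials in the defining fractions, and these lift to Laurent polynomials in T
-- over `D.Loc`, with T standing for c: nonnegative powers on one piece, nonpositive on the other.
-- If the sections agree on the overlap, the two lifts differ by s + (T - c)u with s of small Gauss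
-- norm. Evaluating the two halves of this identity separately yields one element of `D.Loc` close
-- to both sections, with an error that depends on s alone (`exists_approx_of_congr`). As no bound
-- on u is needed, no closedness of the ideal (T - c) in a completed Laurent algebra enters.
-- Closedness of the image then makes the gluing exact (`exists_glue_laurent`).
--
-- General covers reduce to this case. Rational subspaces are quasi-compact: in an ultraproduct of
-- points, values that fall below every positive real are set to 0; the result is again a point of
-- the spectrum, and rational conditions pass to it in both directions (`exists_ultralimit`). For a
-- finite cover, consider products of one parameter from each member. Finitely many comparisons,
-- each of them a two-piece cover, decide which products are bounded below and which is largest;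
-- every nonempty piece left over lies in a single member of the cover (`glues_of_covered`). Since
-- rational subspaces form a basis, the sheaf property follows.

universe w

namespace Readic

noncomputable section

/-! ### Bounded multiplicative seminorms -/

section Berkovich

/-- A power-multiplicative seminorm can be made multiplicative with respect to finitely many
elements without changing its value at an element for which it is already multiplicative. -/
theorem exists_seminorm_isMul_finset {R : Type u} [CommRing R] (p : RingSeminorm R)
    (hp1 : p 1 = 1) (hpm : IsPowMul p) (hna : IsNonarchimedean p) (b : R)
    (hb : ∀ x, p (b * x) = p b * p x) (F : Finset R) :
    ∃ f : RingSeminorm R, f 1 = 1 ∧ IsPowMul f ∧ IsNonarchimedean f ∧ (∀ x, f x ≤ p x) ∧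
      f b = p b ∧ (∀ x, f (b * x) = f b * f x) ∧ ∀ c ∈ F, ∀ x, f (c * x) = f c * f x := by
  classical
  induction F using Finset.induction_on with
  | empty => exact ⟨p, hp1, hpm, hna, fun _ => le_rfl, rfl, hb, by simp⟩
  | insert c F _ ih =>
    obtain ⟨f, h1, h2, h3, h4, h5, h6, h7⟩ := ih
    by_cases hc : f c = 0
    · refine ⟨f, h1, h2, h3, h4, h5, h6, fun d hd x => ?_⟩
      rcases Finset.mem_insert.mp hd with rfl | hd
      · rw [hc, zero_mul]
        refine le_antisymm ((map_mul_le_mul f _ _).trans ?_) (apply_nonneg f _)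
        rw [hc, zero_mul]
      · exact h7 d hd x
    -- The limit of f(x cⁿ) / f(c)ⁿ is multiplicative at c, stays multiplicative at every element
    -- where f already was, and has the same value as f there, in particular at b.
    · refine ⟨seminormFromConst h1.le hc h2, ?_, ?_, ?_, ?_, ?_, ?_, ?_⟩
      · exact seminormFromConst_one h1.le hc h2
      · exact seminormFromConst_isPowMul h1.le hc h2
      · exact seminormFromConst_isNonarchimedean h1.le hc h2 h3
      · exact fun x => (seminormFromConst_le_seminorm h1.le hc h2 x).trans (h4 x)
      · exact (seminormFromConst_apply_of_isMul h1.le hc h2 h6).trans h5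
      · exact seminormFromConst_isMul_of_isMul h1.le hc h2 h6
      · intro d hd x
        rcases Finset.mem_insert.mp hd with rfl | hd
        · exact seminormFromConst_const_mul h1.le hc h2 x
        · exact seminormFromConst_isMul_of_isMul h1.le hc h2 (h7 d hd) x

/-- A nonarchimedean power-multiplicative seminorm dominates a multiplicative one with the same
value at a given element. -/
theorem exists_valuation_le_of_isPowMul {R : Type u} [CommRing R] (p : RingSeminorm R)
    (hp1 : p 1 ≤ 1) (hpm : IsPowMul p) (hna : IsNonarchimedean p) (b : R) (hb : p b ≠ 0) :
    ∃ v : Valuation R ℝ≥0, (∀ x, (v x : ℝ) ≤ p x) ∧ (v b : ℝ) = p b := by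
  classical
  -- Multiplicativity at b is secured first: later modifications lower the seminorm, but not at
  -- elements where it is already multiplicative.
  set p' : RingSeminorm R := seminormFromConst hp1 hb hpm with hp'
  have hp'1 : p' 1 = 1 := seminormFromConst_one hp1 hb hpm
  have hp'b : p' b = p b := seminormFromConst_apply_c hp1 hb hpm
  have hp'le : ∀ x, p' x ≤ p x := seminormFromConst_le_seminorm hp1 hb hpm
  -- All conditions are closed in the product of the compact intervals [0, p x]. The sets shrink as
  -- F grows, so they have a common point, which is multiplicative at every element.
  let K : Finset R → Set (R → ℝ) := fun F => {f | (∀ x, f x ∈ Set.Icc 0 (p x)) ∧ f 0 = 0 ∧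
    f 1 = 1 ∧ f b = p b ∧ (∀ x y, f (x + y) ≤ max (f x) (f y)) ∧
    ∀ c ∈ F, ∀ x, f (c * x) = f c * f x}
  have hne : ∀ F, (K F).Nonempty := fun F => by
    obtain ⟨f, h1, h2, h3, h4, h5, h6, h7⟩ := exists_seminorm_isMul_finset p' hp'1
      (seminormFromConst_isPowMul hp1 hb hpm)
      (seminormFromConst_isNonarchimedean hp1 hb hpm hna) b
      (seminormFromConst_const_mul hp1 hb hpm) F
    exact ⟨f, fun x => ⟨apply_nonneg f x, (h4 x).trans (hp'le x)⟩, map_zero f, h1,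
      h5.trans hp'b, h3, h7⟩
  have hcl : ∀ F, IsClosed (K F) := fun F => by
    simp only [K, Set.mem_Icc, Set.ofPred_and, Set.ofPred_forall]
    refine IsClosed.inter (isClosed_iInter fun x => ?_) (IsClosed.inter ?_ (IsClosed.inter ?_
      (IsClosed.inter ?_ (IsClosed.inter ?_ ?_))))
    · exact (isClosed_le continuous_const (continuous_apply x)).inter
        (isClosed_le (continuous_apply x) continuous_const)
    · exact isClosed_eq (continuous_apply _) continuous_const
    · exact isClosed_eq (continuous_apply _) continuous_const
    · exact isClosed_eq (continuous_apply _) continuous_const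
    · exact isClosed_iInter fun x => isClosed_iInter fun y => isClosed_le (continuous_apply _)
        ((continuous_apply x).max (continuous_apply y))
    · exact isClosed_iInter fun c => isClosed_iInter fun _ => isClosed_iInter fun y =>
        isClosed_eq (continuous_apply (c * y)) ((continuous_apply c).mul (continuous_apply y))
  have hcpt : ∀ F, IsCompact (K F) := fun F =>
    (isCompact_univ_pi fun x => isCompact_Icc (a := (0 : ℝ)) (b := p x)).of_isClosed_subset
      (hcl F) fun f hf x _ => hf.1 x
  have hdir : Directed (· ⊇ ·) K := fun F G =>
    ⟨F ∪ G, fun f hf => ⟨hf.1, hf.2.1, hf.2.2.1, hf.2.2.2.1, hf.2.2.2.2.1, fun c hc =>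
        hf.2.2.2.2.2 c (Finset.mem_union_left _ hc)⟩,
      fun f hf => ⟨hf.1, hf.2.1, hf.2.2.1, hf.2.2.2.1, hf.2.2.2.2.1, fun c hc =>
        hf.2.2.2.2.2 c (Finset.mem_union_right _ hc)⟩⟩
  obtain ⟨f, hf⟩ := IsCompact.nonempty_iInter_of_directed_nonempty_isCompact_isClosed K hdir hne
    hcpt hcl
  rw [Set.mem_iInter] at hf
  have h := hf ∅
  have hmul : ∀ x y, f (x * y) = f x * f y := fun x y =>
    (hf {x}).2.2.2.2.2 x (Finset.mem_singleton_self x) y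
  refine ⟨{ toFun := fun x => ⟨f x, (h.1 x).1⟩
            map_zero' := NNReal.eq h.2.1
            map_one' := NNReal.eq h.2.2.1
            map_mul' := fun x y => NNReal.eq (hmul x y)
            map_add_le_max' := fun x y => ?_ }, fun x => (h.1 x).2, h.2.2.2.1⟩
  exact_mod_cast h.2.2.2.2.1 x y

variable (B : Type u) [NormedCommRing B]

/-- The points of the Berkovich spectrum: multiplicative seminorms bounded by the norm. -/
def Berk : Type u := {v : Valuation B ℝ≥0 // ∀ b, (v b : ℝ) ≤ ‖b‖}

variable {B}

instance : CoeFun (Berk B) (fun _ => B → ℝ≥0) := ⟨fun v => v.1⟩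

/-- An equivalent norm whose value at `1` is at most `1`. -/
def unitalSeminorm (B : Type u) [NormedCommRing B] : RingSeminorm B :=
  seminormFromBounded (f := (norm : B → ℝ)) (c := 1) norm_zero norm_nonneg
    (fun x y => by simpa using norm_mul_le x y) norm_add_le norm_neg

theorem unitalSeminorm_one_le : unitalSeminorm B 1 ≤ 1 :=
  seminormFromBounded_one_le (f := (norm : B → ℝ)) (c := 1) norm_nonneg
    (fun x y => by simpa using norm_mul_le x y)

theorem unitalSeminorm_le (x : B) : unitalSeminorm B x ≤ ‖x‖ :=
  (seminormFromBounded_le (f := (norm : B → ℝ)) (c := 1) norm_nonneg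
    (fun x y => by simpa using norm_mul_le x y) x).trans_eq (one_mul _)

theorem le_unitalSeminorm (x : B) : ‖x‖ ≤ ‖(1 : B)‖ * unitalSeminorm B x :=
  seminormFromBounded_ge (f := (norm : B → ℝ)) (c := 1) norm_nonneg
    (fun x y => by simpa using norm_mul_le x y) x

/-- Smoothing requires a seminorm with value at most 1 at 1, which the norm need not satisfy. The
norm and `unitalSeminorm` differ at most by the factor ‖1‖, whose n-th roots tend to 1 unless the
ring is zero. -/
theorem spectralSeminorm_eq_smoothingFun (b : B) :
    spectralSeminorm b = smoothingFun (unitalSeminorm B) b := by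
  have h0 := tendsto_smoothingFun_of_map_one_le_one (unitalSeminorm B) unitalSeminorm_one_le b
  unfold spectralSeminorm
  refine Tendsto.limUnder_eq ?_
  rcases subsingleton_or_nontrivial B with hB | hB
  · have : ∀ x : B, ‖x‖ = 0 := fun x => by rw [Subsingleton.elim x 0, norm_zero]
    have h2 : ∀ x : B, unitalSeminorm B x = 0 := fun x => by
      rw [Subsingleton.elim x 0, map_zero]
    refine h0.congr' (Eventually.of_forall fun n => ?_)
    simp [smoothingSeminormSeq, this, h2]
  · have h1 : 0 < ‖(1 : B)‖ := norm_pos_iff.mpr one_ne_zero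
    have hc : Tendsto (fun n : ℕ => ‖(1 : B)‖ ^ (1 / (n : ℝ))) atTop (𝓝 1) := by
      have : Tendsto (fun n : ℕ => 1 / (n : ℝ)) atTop (𝓝 0) := tendsto_one_div_atTop_nhds_zero_nat
      simpa using (tendsto_const_nhds (x := ‖(1 : B)‖)).rpow this (Or.inl h1.ne')
    refine tendsto_of_tendsto_of_tendsto_of_le_of_le h0 (by simpa only [one_mul] using hc.mul h0) ?_ ?_
    · intro n
      exact Real.rpow_le_rpow (apply_nonneg _ _) (unitalSeminorm_le _) (by positivity)
    · intro n
      change _ ≤ ‖(1 : B)‖ ^ (1 / (n : ℝ)) * unitalSeminorm B (b ^ n) ^ (1 / (n : ℝ))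
      rw [← Real.mul_rpow (norm_nonneg _) (apply_nonneg _ _)]
      exact Real.rpow_le_rpow (norm_nonneg _) (le_unitalSeminorm _) (by positivity)

variable [IsUltrametricDist B]

theorem isNonarchimedean_norm' : IsNonarchimedean (norm : B → ℝ) :=
  fun x y => IsUltrametricDist.norm_add_le_max x y

theorem unitalSeminorm_isNonarchimedean : IsNonarchimedean (unitalSeminorm B) :=
  seminormFromBounded_isNonarchimedean (f := (norm : B → ℝ)) (c := 1) norm_nonneg
    (fun x y => by simpa using norm_mul_le x y) isNonarchimedean_norm'

/-- The smoothing is nonarchimedean and power-multiplicative, so it dominates a multiplicative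
seminorm that agrees with it at b; being below the norm, that seminorm is a Berkovich point. -/
theorem exists_berk_eq_smoothingFun (b : B) (hb : smoothingFun (unitalSeminorm B) b ≠ 0) :
    ∃ v : Berk B, (v b : ℝ) = smoothingFun (unitalSeminorm B) b := by
  obtain ⟨v, hv, hvb⟩ := exists_valuation_le_of_isPowMul
    (smoothingSeminorm (unitalSeminorm B) unitalSeminorm_one_le unitalSeminorm_isNonarchimedean)
    (smoothingSeminorm_map_one_le_one _ _ _) (isPowMul_smoothingFun _ unitalSeminorm_one_le)
    (isNonarchimedean_smoothingFun _ unitalSeminorm_one_le unitalSeminorm_isNonarchimedean) b hb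
  exact ⟨⟨v, fun x => (hv x).trans ((smoothingFun_le_self _ _).trans (unitalSeminorm_le x))⟩, hvb⟩

/-- On a uniform ring, the norm is controlled by the values at the Berkovich points. -/
theorem IsUniform.exists_norm_le (h : IsUniform B) :
    ∃ K : ℝ, 0 < K ∧ ∀ (b : B) (c : ℝ), 0 ≤ c → (∀ v : Berk B, (v b : ℝ) ≤ c) → ‖b‖ ≤ K * c := by
  obtain ⟨_, C, _, hC, h⟩ := h
  refine ⟨C, hC, fun b c hc hv => (h b).2.trans ?_⟩
  refine mul_le_mul_of_nonneg_left ?_ hC.le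
  rw [spectralSeminorm_eq_smoothingFun]
  by_cases h0 : smoothingFun (unitalSeminorm B) b = 0
  · rwa [h0]
  · obtain ⟨v, hvb⟩ := exists_berk_eq_smoothingFun b h0
    rw [← hvb]
    exact hv v

theorem nonempty_berk [Nontrivial B] : Nonempty (Berk B) := by
  have : smoothingFun (unitalSeminorm B) 1 ≠ 0 := by
    have hpm := isPowMul_smoothingFun (unitalSeminorm B) unitalSeminorm_one_le
    have h := exists_berk_eq_smoothingFun (1 : B)
    have h1 : unitalSeminorm B 1 = 1 := by
      refine seminormFromBounded_one (f := (norm : B → ℝ)) (c := 1) (fun h => ?_) norm_nonneg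
        (fun x y => by simpa using norm_mul_le x y)
      exact (norm_ne_zero_iff.mpr (one_ne_zero (α := B))) (congrFun h 1)
    rw [smoothingFun_apply_of_map_mul_eq_mul _ unitalSeminorm_one_le (x := (1 : B))
      (fun y => by rw [h1, one_mul, one_mul]), h1]
    exact one_ne_zero
  exact (exists_berk_eq_smoothingFun 1 this).nonempty

/-- A quotient of an ultrametric ring is ultrametric. -/
theorem isUltrametricDist_quotient {R : Type u} [NormedCommRing R] [IsUltrametricDist R]
    (I : Ideal R) [IsClosed (I : Set R)] : IsUltrametricDist (R ⧸ I) := by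
  refine IsUltrametricDist.isUltrametricDist_of_forall_norm_add_le_max_norm fun x y => ?_
  refine le_of_forall_pos_lt_add fun ε hε => ?_
  obtain ⟨a, rfl, ha⟩ := Ideal.Quotient.norm_mk_lt x hε
  obtain ⟨b, rfl, hb⟩ := Ideal.Quotient.norm_mk_lt y hε
  rw [← map_add, ← max_add_add_right]
  refine (Ideal.Quotient.norm_mk_le I _).trans_lt ?_
  exact (IsUltrametricDist.norm_add_le_max a b).trans_lt (max_lt_max ha hb)

/-- An element at which no Berkovich point vanishes is a unit. -/
theorem isUnit_of_berk [CompleteSpace B] (b : B) (hb : ∀ v : Berk B, v b ≠ 0) : IsUnit b := by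
  by_contra hu
  -- By completeness a maximal ideal containing b is closed. The residue ring is then a nonzero
  -- normed ring, and a Berkovich point of it pulls back to one that vanishes at b.
  obtain ⟨m, hm, hbm⟩ := exists_max_ideal_of_mem_nonunits hu
  have : IsClosed (m : Set B) := Ideal.IsMaximal.isClosed
  have := isUltrametricDist_quotient m
  have : Nontrivial (B ⧸ m) := Ideal.Quotient.nontrivial_iff.mpr hm.ne_top
  obtain ⟨v⟩ := nonempty_berk (B := B ⧸ m)
  refine hb ⟨v.1.comap (Ideal.Quotient.mk m), fun x => (v.2 _).trans
    (Ideal.Quotient.norm_mk_le m x)⟩ ?_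
  change v.1 (Ideal.Quotient.mk m b) = 0
  rw [Ideal.Quotient.eq_zero_iff_mem.mpr hbm, map_zero]

end Berkovich

/-! ### Rational localizations: density, presentation and universal property -/

/-- The completion of an ultrametric group is ultrametric. -/
theorem isUltrametricDist_completion {E : Type u} [SeminormedAddCommGroup E]
    (h : ∀ x y : E, ‖x + y‖ ≤ max ‖x‖ ‖y‖) : IsUltrametricDist (UniformSpace.Completion E) := by
  refine IsUltrametricDist.isUltrametricDist_of_forall_norm_add_le_max_norm fun x y => ?_
  refine UniformSpace.Completion.induction_on₂ x y ?_ fun a b => ?_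
  · exact isClosed_le (continuous_norm.comp (continuous_fst.add continuous_snd))
      ((continuous_norm.comp continuous_fst).max (continuous_norm.comp continuous_snd))
  · rw [← UniformSpace.Completion.coe_add]
    simpa only [UniformSpace.Completion.norm_coe] using h a b

/-! ### Gauss norms and evaluation of polynomials. -/

section

variable {A : Type u} [NormedCommRing A]

theorem gaussNNNorm_C_le {n : ℕ} (q : Fin n → PosReal) (a : A) :
    gaussNNNorm q (MvPolynomial.C a) ≤ ‖a‖₊ := by
  classical
  refine gaussNNNorm_le fun I => ?_
  rw [MvPolynomial.coeff_C]
  split_ifs with h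
  · subst h
    simp [weight]
  · simp

/-- The weight of a monomial as a real product. -/
theorem coe_weight {n : ℕ} (q : Fin n → PosReal) (I : Fin n →₀ ℕ) :
    (weight q I : ℝ) = ∏ i, (q i : ℝ) ^ I i := by
  simp only [weight, NNReal.coe_prod, NNReal.coe_pow]
  exact Finset.prod_congr rfl fun i _ => by rw [Real.coe_toNNReal _ (q i).2.le]

/-- Evaluation of polynomials at power-bounded tuples is bounded for the Gauss norm. -/
theorem norm_eval₂_le {C : Type w} [NormedCommRing C] [IsUltrametricDist C] {n : ℕ}
    (q : Fin n → PosReal) (ψ : A →+* C) (x : Fin n → C) {M K : ℝ} (hM : 0 ≤ M)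
    (hψ : ∀ a, ‖ψ a‖ ≤ M * ‖a‖) (hK : 0 ≤ K)
    (hx : ∀ I : Fin n →₀ ℕ, ‖∏ i, x i ^ I i‖ ≤ K * weight q I) (P : MvPolynomial (Fin n) A) :
    ‖MvPolynomial.eval₂ ψ x P‖ ≤ M * K * gaussNNNorm q P := by
  rw [MvPolynomial.eval₂_eq']
  refine IsUltrametricDist.norm_sum_le_of_forall_le_of_nonneg (by positivity) fun I _ => ?_
  have h := le_gaussNNNorm (q := q) P I
  rw [← NNReal.coe_le_coe, NNReal.coe_mul, coe_nnnorm] at h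
  calc _ ≤ ‖ψ (P.coeff I)‖ * ‖∏ i, x i ^ I i‖ := norm_mul_le _ _
    _ ≤ (M * ‖P.coeff I‖) * (K * weight q I) := by
        gcongr
        · exact hψ _
        · exact hx I
    _ = M * K * (‖P.coeff I‖ * weight q I) := by ring
    _ ≤ _ := by gcongr

variable [IsUltrametricDist A]

theorem norm_wpoly {n : ℕ} (q : Fin n → PosReal) (P : WPoly A q) :
    ‖P‖ = (gaussNNNorm (A := A) q P : ℝ) := rfl

instance {n : ℕ} (q : Fin n → PosReal) : IsUltrametricDist (WTate A q) :=
  isUltrametricDist_completion fun x y => by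
    rw [norm_wpoly, norm_wpoly, norm_wpoly, ← NNReal.coe_max, NNReal.coe_le_coe]
    exact gaussNNNorm_add (A := A) x y

theorem norm_polyToTate {n : ℕ} (q : Fin n → PosReal) (P : MvPolynomial (Fin n) A) :
    ‖polyToTate A q P‖ = (gaussNNNorm q P : ℝ) :=
  UniformSpace.Completion.norm_coe (E := WPoly A q) P

theorem denseRange_polyToTate {n : ℕ} (q : Fin n → PosReal) :
    DenseRange (polyToTate A q) :=
  UniformSpace.Completion.denseRange_coe (α := WPoly A q)

end

namespace RationalDatum

variable {A : Type u} [NormedCommRing A] [IsUltrametricDist A] (D : RationalDatum A)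

instance : IsUltrametricDist D.Loc := isUltrametricDist_quotient D.relIdeal

/-- The relations defining the rational localization. -/
def rel (i : Fin D.n) : MvPolynomial (Fin D.n) A :=
  MvPolynomial.C D.f₀ * MvPolynomial.X i - MvPolynomial.C (D.f i)

/-- Evaluation of polynomials in the rational localization. -/
def ev : MvPolynomial (Fin D.n) A →+* D.Loc :=
  (Ideal.Quotient.mk D.relIdeal).comp (polyToTate A D.q)

/-- The fraction `fᵢ / f₀` in the rational localization. -/
def frac (i : Fin D.n) : D.Loc := D.ev (MvPolynomial.X i)

theorem ev_C (a : A) : D.ev (MvPolynomial.C a) = D.toLoc a := rfl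

theorem ev_eq_eval₂ (P : MvPolynomial (Fin D.n) A) :
    D.ev P = MvPolynomial.eval₂ D.toLoc D.frac P := by
  have : D.ev = MvPolynomial.eval₂Hom D.toLoc D.frac := by
    refine MvPolynomial.ringHom_ext (fun a => ?_) fun i => ?_
    · simp [ev_C]
    · simp [frac]
  rw [this]
  rfl

theorem ev_rel (i : Fin D.n) : D.ev (D.rel i) = 0 := by
  refine Ideal.Quotient.eq_zero_iff_mem.mpr ?_
  unfold relIdeal
  rw [← SetLike.mem_coe, Ideal.coe_closure]
  exact subset_closure (Ideal.subset_span ⟨i, rfl⟩)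

theorem toLoc_f₀_mul_frac (i : Fin D.n) : D.toLoc D.f₀ * D.frac i = D.toLoc (D.f i) := by
  have := D.ev_rel i
  rw [rel, map_sub, map_mul, ev_C, ev_C, sub_eq_zero] at this
  exact this

/-- Each fᵢ is f₀ times a fraction, and the fᵢ generate the unit ideal; a relation ∑ cᵢ fᵢ = 1
therefore exhibits an inverse of f₀. -/
theorem isUnit_toLoc_f₀ : IsUnit (D.toLoc D.f₀) := by
  have h : (1 : A) ∈ Ideal.span (Set.range D.f) := by
    rw [D.span_eq_top]
    trivial
  obtain ⟨c, hc⟩ := Ideal.mem_span_range_iff_exists_fun.mp h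
  refine IsUnit.of_mul_eq_one (∑ i, D.toLoc (c i) * D.frac i) ?_
  rw [Finset.mul_sum, ← map_one D.toLoc, ← hc, map_sum]
  refine Finset.sum_congr rfl fun i _ => ?_
  rw [map_mul, ← D.toLoc_f₀_mul_frac]
  ring

theorem norm_ev_le (P : MvPolynomial (Fin D.n) A) : ‖D.ev P‖ ≤ gaussNNNorm D.q P :=
  (Ideal.Quotient.norm_mk_le D.relIdeal _).trans_eq (norm_polyToTate D.q P)

theorem norm_toLoc_le (a : A) : ‖D.toLoc a‖ ≤ ‖a‖ := by
  rw [← ev_C]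
  exact (D.norm_ev_le _).trans (NNReal.coe_le_coe.mpr (gaussNNNorm_C_le D.q a))

theorem denseRange_ev : DenseRange D.ev :=
  (Ideal.Quotient.mk_surjective (I := D.relIdeal)).denseRange.comp (denseRange_polyToTate D.q)
    (AddMonoidHomClass.continuous_of_bound (Ideal.Quotient.mk D.relIdeal) 1 fun x => by
      rw [one_mul]
      exact Ideal.Quotient.norm_mk_le D.relIdeal x)

theorem exists_norm_sub_ev_lt (b : D.Loc) {ε : ℝ} (hε : 0 < ε) :
    ∃ P, ‖b - D.ev P‖ < ε := by
  obtain ⟨P, hP⟩ := Metric.denseRange_iff.mp D.denseRange_ev b ε hε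
  exact ⟨P, by rwa [← dist_eq_norm]⟩

/-- Polynomials that evaluate to something small are small modulo the relations. -/
theorem exists_gauss_add_lt (P : MvPolynomial (Fin D.n) A) {ε : ℝ} (h : ‖D.ev P‖ < ε) :
    ∃ Q ∈ Ideal.span (Set.range D.rel), (gaussNNNorm D.q (P + Q) : ℝ) < ε := by
  obtain ⟨m, hm, hmε⟩ := Ideal.Quotient.norm_mk_lt (D.ev P) (sub_pos.mpr h)
  rw [add_sub_cancel] at hmε
  have hmem : m - polyToTate A D.q P ∈ D.relIdeal := Ideal.Quotient.eq.mp hm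
  unfold relIdeal at hmem
  rw [← SetLike.mem_coe, Ideal.coe_closure] at hmem
  obtain ⟨z, hz, hzε⟩ := Metric.mem_closure_iff.mp hmem ε ((norm_nonneg _).trans_lt h)
  obtain ⟨c, hc⟩ := Ideal.mem_span_range_iff_exists_fun.mp hz
  -- The coefficients c live in the completion. The norm depends continuously on them and
  -- polynomials are dense, so they can be replaced by polynomials; the correction then lies in the
  -- uncompleted ideal, where exact algebra is possible.
  let F : (Fin D.n → WTate A D.q) → ℝ := fun c =>
    ‖polyToTate A D.q P + ∑ i, c i * polyToTate A D.q (D.rel i)‖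
  have hF : Continuous F := by
    refine continuous_norm.comp (continuous_const.add (continuous_finsetSum _ fun i _ => ?_))
    exact (continuous_apply i).mul continuous_const
  have hFc : F c < ε := by
    have : polyToTate A D.q P + ∑ i, c i * polyToTate A D.q (D.rel i) =
        m - (m - polyToTate A D.q P - z) := by
      rw [← hc]
      simp only [rel]
      ring
    change ‖polyToTate A D.q P + ∑ i, c i * polyToTate A D.q (D.rel i)‖ < ε
    rw [this, sub_eq_add_neg]
    refine (IsUltrametricDist.norm_add_le_max _ _).trans_lt (max_lt hmε ?_)
    rwa [norm_neg, ← dist_eq_norm]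
  have hd : DenseRange (Pi.map fun (_ : Fin D.n) => (polyToTate A D.q : _ → WTate A D.q)) :=
    DenseRange.piMap fun _ => denseRange_polyToTate D.q
  obtain ⟨c', hc'⟩ := hd.exists_mem_open (isOpen_lt hF continuous_const) ⟨c, hFc⟩
  refine ⟨∑ i, c' i * D.rel i, Ideal.sum_mem _ fun i _ =>
    Ideal.mul_mem_left _ _ (Ideal.subset_span ⟨i, rfl⟩), ?_⟩
  rw [← norm_polyToTate, map_add, map_sum]
  simp only [map_mul]
  exact hc'

/-- The universal property of the rational localization. -/
theorem exists_lift {C : Type w} [NormedCommRing C] [IsUltrametricDist C] [CompleteSpace C]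
    (ψ : A →+* C) (x : Fin D.n → C) {M K : ℝ} (hM : 0 ≤ M) (hψ : ∀ a, ‖ψ a‖ ≤ M * ‖a‖)
    (hK : 0 ≤ K) (hx : ∀ I : Fin D.n →₀ ℕ, ‖∏ i, x i ^ I i‖ ≤ K * weight D.q I)
    (hrel : ∀ i, ψ D.f₀ * x i = ψ (D.f i)) :
    ∃ φ : D.Loc →+* C, (∀ b, ‖φ b‖ ≤ M * K * ‖b‖) ∧ φ.comp D.toLoc = ψ := by
  let e : WPoly A D.q →+* C := MvPolynomial.eval₂Hom ψ x
  have he : ∀ P, ‖e P‖ ≤ M * K * ‖P‖ := fun P =>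
    norm_eval₂_le D.q ψ x hM hψ hK hx P
  have hec : Continuous e := AddMonoidHomClass.continuous_of_bound e _ he
  let E : WTate A D.q →+* C := UniformSpace.Completion.extensionHom e hec
  have hEc : Continuous E := UniformSpace.Completion.continuous_extension
  have hEe : ∀ P, E (polyToTate A D.q P) = e P := fun P =>
    UniformSpace.Completion.extensionHom_coe e hec P
  have hE : ∀ z, ‖E z‖ ≤ M * K * ‖z‖ := fun z => by
    refine UniformSpace.Completion.induction_on z ?_ fun P => ?_
    · exact isClosed_le (continuous_norm.comp hEc) (continuous_const.mul continuous_norm)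
    · rw [UniformSpace.Completion.norm_coe]
      exact (congrArg norm (hEe P)).trans_le (he P)
  have hker : ∀ z ∈ D.relIdeal, E z = 0 := by
    have h1 : Ideal.span (Set.range fun i => polyToTate A D.q
        (MvPolynomial.C D.f₀ * MvPolynomial.X i - MvPolynomial.C (D.f i))) ≤ RingHom.ker E := by
      rw [Ideal.span_le]
      rintro _ ⟨i, rfl⟩
      change E _ = 0
      rw [hEe]
      change MvPolynomial.eval₂Hom ψ x _ = 0
      simp [hrel]
    intro z hz
    unfold relIdeal at hz
    rw [← SetLike.mem_coe, Ideal.coe_closure] at hz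
    have hcl : IsClosed {z | E z = 0} := isClosed_eq hEc continuous_const
    exact closure_minimal (fun y hy => h1 hy) hcl hz
  refine ⟨Ideal.Quotient.lift D.relIdeal E hker, fun b => ?_, ?_⟩
  · refine le_of_forall_pos_lt_add fun ε hε => ?_
    -- The product M * K may vanish, hence the summand 1 in the denominator.
    obtain ⟨m, rfl, hm⟩ := Ideal.Quotient.norm_mk_lt b
      (div_pos hε (by positivity : 0 < M * K + 1))
    rw [Ideal.Quotient.lift_mk]
    refine (hE m).trans_lt ?_
    calc M * K * ‖m‖ ≤ M * K * (‖Ideal.Quotient.mk D.relIdeal m‖ + ε / (M * K + 1)) := by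
          gcongr
      _ = M * K * ‖Ideal.Quotient.mk D.relIdeal m‖ + M * K / (M * K + 1) * ε := by ring
      _ < _ := by
          gcongr
          refine mul_lt_of_lt_one_left hε ((div_lt_one (by positivity)).mpr (lt_add_one _))
  · ext a
    change E (polyToTate A D.q (MvPolynomial.C a)) = ψ a
    rw [hEe]
    exact MvPolynomial.eval₂Hom_C ψ x a

/-- Bounded homomorphisms from a rational localization are determined on the base ring. -/
theorem hom_ext {C : Type w} [NormedCommRing C] {φ φ' : D.Loc →+* C} (hφ : Continuous φ)
    (hφ' : Continuous φ') (h : φ.comp D.toLoc = φ'.comp D.toLoc) : φ = φ' := by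
  have h' : ∀ a, φ (D.toLoc a) = φ' (D.toLoc a) := fun a => RingHom.congr_fun h a
  have hfrac : ∀ i, φ (D.frac i) = φ' (D.frac i) := fun i => by
    refine (D.isUnit_toLoc_f₀.map φ).mul_left_cancel ?_
    rw [← map_mul, toLoc_f₀_mul_frac, h', h', ← map_mul, toLoc_f₀_mul_frac]
  have hev : φ.comp D.ev = φ'.comp D.ev := MvPolynomial.ringHom_ext h' hfrac
  ext b
  exact congrFun (D.denseRange_ev.equalizer hφ hφ' (congrArg DFunLike.coe hev)) b

end RationalDatum

/-! ### Rank-one points of the reified adic spectrum -/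

theorem le_of_forall_pow_le {x y C : ℝ} (hy : 0 ≤ y) (h : ∀ n : ℕ, 1 ≤ n → x ^ n ≤ C * y ^ n) :
    x ≤ y := by
  by_contra! hlt
  have hx : 0 < x := hy.trans_lt hlt
  rcases hy.eq_or_lt with rfl | hy
  · have := h 1 le_rfl
    simp only [pow_one, mul_zero] at this
    linarith
  obtain ⟨n, hn⟩ := pow_unbounded_of_one_lt (max C 1) ((one_lt_div hy).mpr hlt)
  have hn0 : 1 ≤ n := Nat.one_le_iff_ne_zero.mpr fun h0 => by
    subst h0
    simp at hn
  rw [div_pow, lt_div_iff₀ (pow_pos hy n)] at hn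
  have := (le_max_left C 1)
  have h2 := h n hn0
  have h3 : C * y ^ n ≤ max C 1 * y ^ n := by gcongr
  linarith

/-- A valuation with nonnegative real values comes from a complete ultrametric field. -/
theorem exists_completed_residue_field {A : Type u} [CommRing A] (v : Valuation A ℝ≥0) :
    ∃ (C : Type u) (_ : NormedField C) (_ : IsUltrametricDist C) (_ : CompleteSpace C)
      (ψ : A →+* C), ∀ a, ‖ψ a‖ = v a := by
  let R := A ⧸ v.supp
  let vR : Valuation R ℝ≥0 := v.onQuot le_rfl
  have hvR : vR.supp = ⊥ := v.supp_quot_supp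
  have hR : nonZeroDivisors R ≤ vR.supp.primeCompl := fun x hx hx' => by
    rw [SetLike.mem_coe, hvR, Ideal.mem_bot] at hx'
    subst hx'
    exact zero_notMem_nonZeroDivisors hx
  let κ := FractionRing R
  let vκ : Valuation κ ℝ≥0 := vR.extendToLocalization hR κ
  let av : AbsoluteValue κ ℝ :=
    { toFun := fun x => (vκ x : ℝ)
      map_mul' := fun x y => by rw [map_mul, NNReal.coe_mul]
      nonneg' := fun x => NNReal.coe_nonneg _
      eq_zero' := fun x => by rw [NNReal.coe_eq_zero, vκ.zero_iff]
      add_le' := fun x y => by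
        rw [← NNReal.coe_add, NNReal.coe_le_coe]
        exact (vκ.map_add x y).trans (max_le (le_add_of_nonneg_right zero_le)
          (le_add_of_nonneg_left zero_le)) }
  let ψ : A →+* UniformSpace.Completion (WithAbs av) :=
    (UniformSpace.Completion.coeRingHom (α := WithAbs av)).comp
      (((WithAbs.equiv av).symm : κ →+* WithAbs av).comp
        ((algebraMap R κ).comp (Ideal.Quotient.mk v.supp)))
  refine ⟨UniformSpace.Completion (WithAbs av), inferInstance,
    isUltrametricDist_completion fun x y => ?_, inferInstance, ψ, fun a => ?_⟩
  · exact_mod_cast vκ.map_add x.ofAbs y.ofAbs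
  · refine (UniformSpace.Completion.norm_coe (E := WithAbs av) _).trans ?_
    change ((vκ (algebraMap R κ (Ideal.Quotient.mk v.supp a)) : ℝ≥0) : ℝ) = v a
    rw [Valuation.extendToLocalization_apply_map_apply]
    rfl

instance : IsOrderedMonoid (ULift.{u} PosReal) where
  mul_le_mul_left _ _ h c := mul_le_mul_left (α := PosReal) h c.down

/-- The identification of the nonnegative reals with the positive reals and zero. -/
def nnrealToWithZero : ℝ≥0 →*₀ WithZero (ULift.{u} PosReal) where
  toFun x := if h : 0 < (x : ℝ) then ((⟨⟨x, h⟩⟩ : ULift.{u} PosReal) : WithZero (ULift.{u} PosReal)) else 0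
  map_zero' := by simp
  map_one' := by
    rw [dif_pos (by simp)]
    rfl
  map_mul' x y := by
    by_cases hx : 0 < (x : ℝ)
    · by_cases hy : 0 < (y : ℝ)
      · have hxy : 0 < ((x * y : ℝ≥0) : ℝ) := by
          rw [NNReal.coe_mul]
          exact mul_pos hx hy
        rw [dif_pos hx, dif_pos hy, dif_pos hxy, ← WithZero.coe_mul]
        rfl
      · have hy0 : y = 0 := by
          rw [NNReal.coe_pos, not_lt] at hy
          exact le_zero_iff.mp hy
        subst hy0
        simp
    · have hx0 : x = 0 := by
        rw [NNReal.coe_pos, not_lt] at hx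
        exact le_zero_iff.mp hx
      subst hx0
      simp

theorem nnrealToWithZero_of_pos {x : ℝ≥0} (h : 0 < (x : ℝ)) :
    nnrealToWithZero.{u} x = ((⟨⟨x, h⟩⟩ : ULift.{u} PosReal) : WithZero (ULift.{u} PosReal)) :=
  dif_pos h

theorem nnrealToWithZero_le {x y : ℝ≥0} :
    nnrealToWithZero.{u} x ≤ nnrealToWithZero.{u} y ↔ x ≤ y := by
  rcases eq_or_ne x 0 with rfl | hx
  · simp
  have hx' : 0 < (x : ℝ) := NNReal.coe_pos.mpr (pos_iff_ne_zero.mpr hx)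
  rcases eq_or_ne y 0 with rfl | hy
  · rw [map_zero, le_zero_iff, le_zero_iff, nnrealToWithZero_of_pos hx']
    simp [hx]
  have hy' : 0 < (y : ℝ) := NNReal.coe_pos.mpr (pos_iff_ne_zero.mpr hy)
  rw [nnrealToWithZero_of_pos hx', nnrealToWithZero_of_pos hy', WithZero.coe_le_coe]
  exact Iff.rfl

/-- The reified semivaluation belonging to a valuation with real values. -/
def reifiedOfReal {A : Type u} [CommRing A] (v : Valuation A ℝ≥0) : ReifiedSemivaluation A where
  Γ := ULift.{u} PosReal
  val := v.map nnrealToWithZero fun _ _ h => nnrealToWithZero_le.mpr h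
  reif := { toFun := ULift.up, map_one' := rfl, map_mul' := fun _ _ => rfl }
  reif_strictMono := fun _ _ h => h

section

variable {A : Type u} [CommRing A] (v : Valuation A ℝ≥0)

theorem reifiedOfReal_le {a b : A} {q : PosReal} :
    (reifiedOfReal v).LE a b q ↔ (v a : ℝ) ≤ q * v b := by
  have hq : (((reifiedOfReal v).reif q : (reifiedOfReal v).Γ) : WithZero (reifiedOfReal v).Γ) =
      nnrealToWithZero.{u} (NNReal.mk q q.2.le) :=
    (nnrealToWithZero_of_pos (x := NNReal.mk q q.2.le) q.2).symm
  unfold ReifiedSemivaluation.LE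
  rw [hq]
  change nnrealToWithZero.{u} (v a) ≤ nnrealToWithZero.{u} _ * nnrealToWithZero.{u} (v b) ↔ _
  rw [← map_mul, nnrealToWithZero_le, ← NNReal.coe_le_coe, NNReal.coe_mul]
  rfl

theorem reifiedOfReal_val_eq_zero {a : A} : (reifiedOfReal v).val a = 0 ↔ v a = 0 := by
  change nnrealToWithZero.{u} (v a) = 0 ↔ v a = 0
  rw [← le_zero_iff, ← map_zero nnrealToWithZero.{u}, nnrealToWithZero_le, le_zero_iff]

theorem reifiedOfReal_isCofinal : (reifiedOfReal v).IsCofinal :=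
  fun γ _ => ⟨(γ : ULift.{u} PosReal).down, le_rfl⟩

end

namespace Berk

variable {A : Type u} [NormedCommRing A] (v : Berk A)

/-- The point of the reified adic spectrum belonging to a bounded multiplicative seminorm. -/
def toSprv : Sprv A := Quotient.mk _ (reifiedOfReal v.1)

theorem toSprv_le {a b : A} {q : PosReal} : v.toSprv.LE a b q ↔ (v a : ℝ) ≤ q * v b :=
  reifiedOfReal_le v.1

theorem toSprv_vanishes {a : A} : v.toSprv.Vanishes a ↔ v a = 0 :=
  reifiedOfReal_val_eq_zero v.1

variable [IsUltrametricDist A]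

theorem le_of_mem_powBounded {r : PosReal} {a : A} (ha : a ∈ powBounded A r) :
    (v a : ℝ) ≤ r := by
  obtain ⟨C, hC⟩ := ha
  refine le_of_forall_pow_le (C := C) r.2.le fun n hn => ?_
  have h := hC n hn
  rw [inv_pow, inv_mul_le_iff₀ (pow_pos r.2 n)] at h
  rw [← NNReal.coe_pow, ← map_pow, mul_comm]
  exact (v.2 _).trans h

/-- A real-valued bounded seminorm is at most r on every power-bounded element of weight r. The
conditions imposed by `S` concern only such elements, so they hold automatically. -/
theorem toSprv_mem (S : Subring (Gr A)) : v.toSprv ∈ Spra S := by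
  have h1 : ∀ (r : PosReal) (a : A), a ∈ powBounded A r → v.toSprv.LE a 1 r := fun r a ha => by
    rw [toSprv_le, map_one, NNReal.coe_one, mul_one]
    exact v.le_of_mem_powBounded ha
  exact ⟨⟨fun r a ha => h1 r a (bounded_of_tendsto ha), reifiedOfReal_isCofinal v.1⟩,
    fun r a ⟨ha, _⟩ => h1 r a ha⟩

/-- The condition that a Berkovich point lies in a rational subspace. -/
def Mem (D : RationalDatum A) : Prop :=
  (∀ i, (v (D.f i) : ℝ) ≤ D.q i * v D.f₀) ∧ v D.f₀ ≠ 0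

theorem toSprv_mem_subspace_iff (S : Subring (Gr A)) (D : RationalDatum A) :
    (⟨v.toSprv, v.toSprv_mem S⟩ : Spra S) ∈ D.subspace S ↔ v.Mem D := by
  change ((∀ i, v.toSprv.LE _ _ _) ∧ ¬ v.toSprv.Vanishes _) ↔ _
  simp only [toSprv_le, toSprv_vanishes, Mem, ne_eq]

end Berk

namespace RationalDatum

variable {A : Type u} [NormedCommRing A] [IsUltrametricDist A] (D : RationalDatum A)

/-- Restriction of Berkovich points along a rational localization. -/
def pull (w : Berk D.Loc) : Berk A :=
  ⟨w.1.comap D.toLoc, fun a => (w.2 _).trans (D.norm_toLoc_le a)⟩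

theorem pull_apply (w : Berk D.Loc) (a : A) : D.pull w a = w (D.toLoc a) := rfl

/-- The n-th power of a variable has Gauss norm at most ‖1‖ qⁿ; comparing all powers removes the
constant ‖1‖. -/
theorem berk_frac_le (w : Berk D.Loc) (i : Fin D.n) : (w (D.frac i) : ℝ) ≤ D.q i := by
  classical
  refine le_of_forall_pow_le (C := ‖(1 : A)‖) (D.q i).2.le fun n _ => ?_
  rw [← NNReal.coe_pow, ← map_pow]
  refine (w.2 _).trans ?_
  rw [frac, ← map_pow]
  refine (D.norm_ev_le _).trans ?_
  rw [MvPolynomial.X_pow_eq_monomial]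
  have : gaussNNNorm D.q (MvPolynomial.monomial (Finsupp.single i n) (1 : A)) ≤
      ‖(1 : A)‖₊ * weight D.q (Finsupp.single i n) := by
    refine gaussNNNorm_le fun I => ?_
    rw [MvPolynomial.coeff_monomial]
    split_ifs with h
    · rw [h]
    · simp
  refine (NNReal.coe_le_coe.mpr this).trans_eq ?_
  rw [NNReal.coe_mul, coe_weight, coe_nnnorm, Finset.prod_eq_single i]
  · simp
  · intro j _ hj
    rw [Finsupp.single_eq_of_ne hj, pow_zero]
  · simp

theorem berk_toLoc_f₀_ne_zero (w : Berk D.Loc) : w (D.toLoc D.f₀) ≠ 0 := fun h => by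
  obtain ⟨c, hc⟩ := D.isUnit_toLoc_f₀.exists_right_inv
  have : w (D.toLoc D.f₀ * c) = 1 := by rw [hc, map_one]
  rw [map_mul, h, zero_mul] at this
  exact zero_ne_one this

theorem pull_mem (w : Berk D.Loc) : (D.pull w).Mem D := by
  refine ⟨fun i => ?_, D.berk_toLoc_f₀_ne_zero w⟩
  rw [pull_apply, pull_apply, ← toLoc_f₀_mul_frac, map_mul, NNReal.coe_mul, mul_comm]
  exact mul_le_mul_of_nonneg_right (D.berk_frac_le w i) (NNReal.coe_nonneg _)

/-- A Berkovich point in a rational subspace extends to the rational localization. -/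
theorem exists_pull_eq (v : Berk A) (hv : v.Mem D) : ∃ w : Berk D.Loc, D.pull w = v := by
  -- In the completed residue field f₀ is invertible and the fractions satisfy the required bounds
  -- exactly, so the universal property applies with both constants equal to 1.
  obtain ⟨C, _, _, _, ψ, hψ⟩ := exists_completed_residue_field v.1
  have h0 : ψ D.f₀ ≠ 0 := norm_ne_zero_iff.mp (by
    rw [hψ]
    exact_mod_cast hv.2)
  obtain ⟨φ, hφ, hφA⟩ := D.exists_lift ψ (fun i => ψ (D.f i) / ψ D.f₀) (M := 1) (K := 1)
    zero_le_one (fun a => by rw [hψ, one_mul]; exact v.2 a) zero_le_one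
    (fun I => by
      rw [one_mul, norm_prod, coe_weight]
      refine Finset.prod_le_prod (fun _ _ => norm_nonneg _) fun i _ => ?_
      rw [norm_pow]
      refine pow_le_pow_left₀ (norm_nonneg _) ?_ _
      rw [norm_div, div_le_iff₀ (norm_pos_iff.mpr h0), hψ, hψ]
      exact hv.1 i)
    (fun i => mul_div_cancel₀ _ h0)
  refine ⟨⟨{ toFun := fun b => ‖φ b‖₊
             map_zero' := by simp
             map_one' := by simp
             map_mul' := fun x y => by simp
             map_add_le_max' := fun x y => ?_ }, fun b => ?_⟩, ?_⟩
  · rw [map_add]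
    exact IsUltrametricDist.nnnorm_add_le_max _ _
  · have := hφ b
    rwa [one_mul, one_mul] at this
  · refine Subtype.ext (Valuation.ext fun a => NNReal.eq ?_)
    change ‖φ (D.toLoc a)‖ = v.1 a
    rw [← hψ, ← hφA]
    rfl

end RationalDatum

/-- A bounded valuation is continuous. -/
theorem continuous_of_bounded_valuation {B : Type u} [SeminormedCommRing B] (v : Valuation B ℝ≥0)
    (C : ℝ) (h : ∀ b, (v b : ℝ) ≤ C * ‖b‖) : Continuous v := by
  have hlip : LipschitzWith (max C 0).toNNReal v := by
    refine LipschitzWith.of_dist_le_mul fun x y => ?_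
    rw [Real.coe_toNNReal _ (le_max_right _ _), NNReal.dist_eq, dist_eq_norm]
    have hsub : ∀ x y : B, (v x : ℝ) - v y ≤ v (x - y) := fun x y => by
      have := v.map_add (x - y) y
      rw [sub_add_cancel, ← NNReal.coe_le_coe, NNReal.coe_max] at this
      rcases le_max_iff.mp this with h | h
      · exact (sub_le_self _ (NNReal.coe_nonneg _)).trans h
      · exact (sub_nonpos.mpr h).trans (NNReal.coe_nonneg _)
    have h2 : |(v x : ℝ) - v y| ≤ v (x - y) :=
      abs_sub_le_iff.mpr ⟨hsub x y, by rw [v.map_sub_swap]; exact hsub y x⟩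
    exact h2.trans ((h _).trans (mul_le_mul_of_nonneg_right (le_max_left _ _) (norm_nonneg _)))
  exact hlip.continuous

namespace RationalDatum

variable {A : Type u} [NormedCommRing A] [IsUltrametricDist A] (D : RationalDatum A)

/-- Clearing denominators: every variable costs one factor f₀. Since f₀ is a unit, a valuation on
the image of the polynomials is determined by its values on `A`. -/
theorem exists_pow_mul_ev_eq (P : MvPolynomial (Fin D.n) A) :
    ∃ (N : ℕ) (a : A), D.toLoc D.f₀ ^ N * D.ev P = D.toLoc a := by
  induction P using MvPolynomial.induction_on with
  | C a => exact ⟨0, a, by rw [pow_zero, one_mul, ev_C]⟩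
  | add P Q hP hQ =>
    obtain ⟨N, a, ha⟩ := hP
    obtain ⟨M, b, hb⟩ := hQ
    refine ⟨N + M, D.f₀ ^ M * a + D.f₀ ^ N * b, ?_⟩
    simp only [map_add, map_mul, map_pow, ← ha, ← hb]
    ring
  | mul_X P i hP =>
    obtain ⟨N, a, ha⟩ := hP
    refine ⟨N + 1, a * D.f i, ?_⟩
    rw [map_mul, map_mul, ← ha, ← toLoc_f₀_mul_frac, frac]
    ring

/-- Bounded valuations on a rational localization are determined on the base ring. -/
theorem valuation_ext {v w : Valuation D.Loc ℝ≥0} (hv : Continuous v) (hw : Continuous w)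
    (h : ∀ a, v (D.toLoc a) = w (D.toLoc a)) (b : D.Loc) : v b = w b := by
  refine congrFun (D.denseRange_ev.equalizer hv hw (funext fun P => ?_)) b
  obtain ⟨N, a, ha⟩ := D.exists_pow_mul_ev_eq P
  have hne : v (D.toLoc D.f₀) ^ N ≠ 0 := by
    obtain ⟨c, hc⟩ := D.isUnit_toLoc_f₀.exists_right_inv
    refine pow_ne_zero _ fun h0 => ?_
    have : v (D.toLoc D.f₀ * c) = 1 := by rw [hc, map_one]
    rw [map_mul, h0, zero_mul] at this
    exact zero_ne_one this
  have h1 := h a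
  rw [← ha, map_mul, map_mul, map_pow, map_pow, ← h] at h1
  exact mul_left_cancel₀ hne h1

variable {D} {S : Subring (Gr A)} {E : RationalDatum A}

/-- Berkovich points are points of `Spra S`, so an inclusion of reified rational subspaces can be
tested on them. -/
theorem mem_of_subspace_le (hED : E.subspace S ⊆ D.subspace S) {v : Berk A} (hv : v.Mem E) :
    v.Mem D :=
  (v.toSprv_mem_subspace_iff S D).mp (hED ((v.toSprv_mem_subspace_iff S E).mpr hv))

end RationalDatum

/-- Monomials in elements whose values at all Berkovich points are bounded are bounded. -/
theorem norm_prod_pow_le {B : Type u} [NormedCommRing B] {K : ℝ}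
    (hK : ∀ (b : B) (c : ℝ), 0 ≤ c → (∀ v : Berk B, (v b : ℝ) ≤ c) → ‖b‖ ≤ K * c)
    {n : ℕ} (x : Fin n → B) (r : Fin n → ℝ) (hr : ∀ i, 0 ≤ r i)
    (hx : ∀ i (v : Berk B), (v (x i) : ℝ) ≤ r i) (I : Fin n → ℕ) :
    ‖∏ i, x i ^ I i‖ ≤ K * ∏ i, r i ^ I i := by
  refine hK _ _ (Finset.prod_nonneg fun i _ => pow_nonneg (hr i) _) fun v => ?_
  rw [map_prod, NNReal.coe_prod]
  refine Finset.prod_le_prod (fun _ _ => NNReal.coe_nonneg _) fun i _ => ?_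
  rw [map_pow, NNReal.coe_pow]
  exact pow_le_pow_left₀ (NNReal.coe_nonneg _) (hx i v) _

/-! ### Transition maps and norm control on covers. -/

namespace RationalDatum

variable {A : Type u} [NormedCommRing A] [IsUltrametricDist A] {S : Subring (Gr A)}
  {D E : RationalDatum A}

/-- An inclusion of rational subspaces induces a bounded homomorphism. -/
theorem exists_trans (hE : IsUniform E.Loc) (hED : E.subspace S ⊆ D.subspace S) :
    ∃ φ : D.Loc →+* E.Loc, IsBoundedHom φ ∧ φ.comp D.toLoc = E.toLoc := by
  have hmem : ∀ w : Berk E.Loc, (E.pull w).Mem D := fun w => mem_of_subspace_le hED (E.pull_mem w)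
  obtain ⟨K, hK0, hK⟩ := hE.exists_norm_le
  -- No Berkovich point of `E.Loc` kills f₀, because each restricts to a point of the larger
  -- subspace.
  obtain ⟨c, hc⟩ := (isUnit_of_berk (E.toLoc D.f₀) fun w => (hmem w).2).exists_right_inv
  have hval : ∀ (i) (w : Berk E.Loc), (w (E.toLoc (D.f i) * c) : ℝ) ≤ D.q i := fun i w => by
    have h1 := (hmem w).1 i
    have h2 : (w (E.toLoc D.f₀) : ℝ) * w c = 1 := by
      rw [← NNReal.coe_mul, ← map_mul, hc, map_one, NNReal.coe_one]
    rw [pull_apply, pull_apply] at h1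
    rw [map_mul, NNReal.coe_mul]
    calc _ ≤ (D.q i : ℝ) * w (E.toLoc D.f₀) * w c := by gcongr
      _ = (D.q i : ℝ) := by rw [mul_assoc, h2, mul_one]
  -- Uniformity of `E.Loc` enters here: one constant K bounds all monomials in the fractions at
  -- once, which bounds on the individual fractions would not give.
  obtain ⟨φ, hφ, hφA⟩ := D.exists_lift E.toLoc (fun i => E.toLoc (D.f i) * c) (M := 1) (K := K)
    zero_le_one (fun a => by rw [one_mul]; exact E.norm_toLoc_le a) hK0.le
    (fun I => by
      rw [coe_weight]
      exact norm_prod_pow_le hK _ _ (fun i => (D.q i).2.le) hval I)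
    (fun i => by linear_combination E.toLoc (D.f i) * hc)
  exact ⟨φ, ⟨1 * K, by positivity, hφ⟩, hφA⟩

theorem _root_.Readic.IsBoundedHom.continuous {B C : Type u} [SeminormedCommRing B]
    [SeminormedCommRing C] {f : B →+* C} (h : IsBoundedHom f) : Continuous f := by
  obtain ⟨c, _, h⟩ := h
  exact AddMonoidHomClass.continuous_of_bound f c h

variable (h : IsReallyStablyUniform A)

/-- The transition map belonging to an inclusion of rational subspaces. -/
def trans (hED : E.subspace S ⊆ D.subspace S) : D.Loc →+* E.Loc :=
  (exists_trans (h E) hED).choose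

theorem trans_isBoundedHom (hED : E.subspace S ⊆ D.subspace S) : IsBoundedHom (trans h hED) :=
  (exists_trans (h E) hED).choose_spec.1

theorem trans_comp_toLoc (hED : E.subspace S ⊆ D.subspace S) :
    (trans h hED).comp D.toLoc = E.toLoc :=
  (exists_trans (h E) hED).choose_spec.2

theorem trans_toLoc (hED : E.subspace S ⊆ D.subspace S) (a : A) :
    trans h hED (D.toLoc a) = E.toLoc a :=
  RingHom.congr_fun (trans_comp_toLoc h hED) a

/-- The definition of `sections` quantifies over all bounded homomorphisms over `A`; by density
there is only this one to consider. -/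
theorem eq_trans (hED : E.subspace S ⊆ D.subspace S) (φ : D.Loc →+* E.Loc)
    (hφ : IsBoundedHom φ) (hφA : φ.comp D.toLoc = E.toLoc) : φ = trans h hED :=
  D.hom_ext hφ.continuous (trans_isBoundedHom h hED).continuous
    (hφA.trans (trans_comp_toLoc h hED).symm)

theorem trans_trans {F : RationalDatum A} (hED : E.subspace S ⊆ D.subspace S)
    (hFE : F.subspace S ⊆ E.subspace S) (b : D.Loc) :
    trans h hFE (trans h hED b) = trans h (hFE.trans hED) b := by
  refine RingHom.congr_fun (f := (trans h hFE).comp (trans h hED)) (D.hom_ext ?_ ?_ ?_) b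
  · exact (trans_isBoundedHom h hFE).continuous.comp (trans_isBoundedHom h hED).continuous
  · exact (trans_isBoundedHom h _).continuous
  · rw [RingHom.comp_assoc, trans_comp_toLoc, trans_comp_toLoc, trans_comp_toLoc]

theorem trans_refl (b : D.Loc) : trans h (subset_refl (D.subspace S)) b = b :=
  (RingHom.congr_fun (eq_trans h (subset_refl (D.subspace S)) (RingHom.id _)
    ⟨1, one_pos, fun b => (one_mul ‖b‖).ge⟩ (RingHom.id_comp _)) b).symm

/-- The norm on a rational localization is controlled on every cover by rational subspaces. -/
theorem exists_norm_le_of_cover (D : RationalDatum A) (S : Subring (Gr A)) :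
    ∃ K : ℝ, 0 < K ∧ ∀ (𝒰 : Set (RationalDatum A)),
      (∀ x ∈ D.subspace S, ∃ E ∈ 𝒰, E.subspace S ⊆ D.subspace S ∧ x ∈ E.subspace S) →
      ∀ (b : D.Loc) (c : ℝ), 0 ≤ c →
      (∀ E ∈ 𝒰, ∀ hED : E.subspace S ⊆ D.subspace S, ‖trans h hED b‖ ≤ c) → ‖b‖ ≤ K * c := by
  obtain ⟨K, hK0, hK⟩ := (h D).exists_norm_le
  refine ⟨K, hK0, fun 𝒰 h𝒰 b c hc hb => hK b c hc fun w => ?_⟩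
  -- Restrict w to `A`, find a member of the cover containing the restriction, and extend it to w'
  -- there. Both w and w' restrict to the same seminorm on `A`, so they agree on `D.Loc`. The
  -- constant K comes from D alone, hence serves all covers.
  obtain ⟨E, hE, hED, hw⟩ := h𝒰 _ (((D.pull w).toSprv_mem_subspace_iff S D).mpr (D.pull_mem w))
  obtain ⟨w', hw'⟩ := E.exists_pull_eq _ (((D.pull w).toSprv_mem_subspace_iff S E).mp hw)
  have hwc : Continuous w.1 :=
    continuous_of_bounded_valuation w.1 1 fun b => by rw [one_mul]; exact w.2 b
  have hwc' : Continuous w'.1 :=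
    continuous_of_bounded_valuation w'.1 1 fun b => by rw [one_mul]; exact w'.2 b
  have : w b = w' (trans h hED b) := by
    refine D.valuation_ext (v := w.1) (w := w'.1.comap (trans h hED)) hwc
      (hwc'.comp (trans_isBoundedHom h hED).continuous) (fun a => ?_) b
    change D.pull w a = w' (trans h hED (D.toLoc a))
    rw [trans_toLoc, ← hw', pull_apply]
  rw [this]
  exact (w'.2 _).trans (hb E hE hED)

/-- The structure presheaf is separated on rational subspaces. -/
theorem eq_of_cover (D : RationalDatum A) (𝒰 : Set (RationalDatum A))
    (h𝒰 : ∀ x ∈ D.subspace S, ∃ E ∈ 𝒰, E.subspace S ⊆ D.subspace S ∧ x ∈ E.subspace S)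
    (b c : D.Loc) (hbc : ∀ E ∈ 𝒰, ∀ hED : E.subspace S ⊆ D.subspace S,
      trans h hED b = trans h hED c) : b = c := by
  obtain ⟨K, _, hK⟩ := exists_norm_le_of_cover h D S
  have := hK 𝒰 h𝒰 (b - c) 0 le_rfl fun E hE hED => by
    rw [map_sub, hbc E hE hED, sub_self, norm_zero]
  rw [mul_zero] at this
  exact sub_eq_zero.mp (norm_le_zero_iff.mp this)

end RationalDatum

/-! ### Rational subspaces: intersections, basis of the topology -/

namespace ReifiedSemivaluation

variable {A : Type u} [CommRing A] (v : ReifiedSemivaluation A)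

/-- The positive reals as elements of the value monoid. -/
def rv (q : PosReal) : WithZero v.Γ := (v.reif q : WithZero v.Γ)

theorem rv_mul (q r : PosReal) : v.rv (q * r) = v.rv q * v.rv r := by
  rw [rv, map_mul, WithZero.coe_mul]
  rfl

theorem rv_one : v.rv 1 = 1 := by
  rw [rv, map_one, WithZero.coe_one]

theorem rv_ne_zero (q : PosReal) : v.rv q ≠ 0 := WithZero.coe_ne_zero

theorem rv_pos (q : PosReal) : 0 < v.rv q := zero_lt_iff.mpr (v.rv_ne_zero q)

theorem rv_le {q r : PosReal} : v.rv q ≤ v.rv r ↔ q ≤ r := by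
  rw [rv, rv, WithZero.coe_le_coe]
  exact v.reif_strictMono.le_iff_le

theorem rv_inv_mul (q : PosReal) : v.rv q⁻¹ * v.rv q = 1 := by
  rw [← rv_mul, inv_mul_cancel, rv_one]

theorem rv_mul_inv (q : PosReal) : v.rv q * v.rv q⁻¹ = 1 := by
  rw [← rv_mul, mul_inv_cancel, rv_one]

theorem le_rv_mul_iff {x y : WithZero v.Γ} (q : PosReal) :
    x ≤ v.rv q * y ↔ v.rv q⁻¹ * x ≤ y := by
  constructor
  · intro h
    calc v.rv q⁻¹ * x ≤ v.rv q⁻¹ * (v.rv q * y) := mul_le_mul_right h _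
      _ = y := by rw [← mul_assoc, rv_inv_mul, one_mul]
  · intro h
    calc x = v.rv q * (v.rv q⁻¹ * x) := by rw [← mul_assoc, rv_mul_inv, one_mul]
      _ ≤ _ := mul_le_mul_right h _

theorem rv_prod {ι : Type*}
    (t : Finset ι) (f : ι → PosReal) : v.rv (∏ i ∈ t, f i) = ∏ i ∈ t, v.rv (f i) := by
  classical
  induction t using Finset.induction_on with
  | empty => simp [v.rv_one]
  | insert a t ha ih => rw [Finset.prod_insert ha, Finset.prod_insert ha, v.rv_mul, ih]

end ReifiedSemivaluation

namespace Sprv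

variable {A : Type u} [CommRing A] (x : Sprv A)

/-- A representative of a point of the reified valuative spectrum. -/
def rep : ReifiedSemivaluation A := Quotient.out x

theorem mk_rep : (Quotient.mk _ x.rep : Sprv A) = x := Quotient.out_eq x

theorem le_iff {a b : A} {q : PosReal} :
    x.LE a b q ↔ x.rep.val a ≤ x.rep.rv q * x.rep.val b := by
  conv_lhs => rw [← x.mk_rep]
  rfl

theorem vanishes_iff {a : A} : x.Vanishes a ↔ x.rep.val a = 0 := by
  conv_lhs => rw [← x.mk_rep]
  rfl

end Sprv

section

variable {A : Type u} [NormedCommRing A] [IsUltrametricDist A] {S : Subring (Gr A)}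

theorem Spra.exists_rv_le (x : Spra S) {a : A} (ha : x.1.rep.val a ≠ 0) :
    ∃ r : PosReal, x.1.rep.rv r ≤ x.1.rep.val a := by
  have hc : x.1.rep.IsCofinal := by
    have := x.2.1.2
    rw [← x.1.mk_rep] at this
    exact this
  obtain ⟨γ, hγ⟩ := WithZero.ne_zero_iff_exists.mp ha
  obtain ⟨r, hr⟩ := hc γ (x.1.rep.mem_of_val_eq hγ.symm)
  refine ⟨r, ?_⟩
  rw [← hγ]
  exact WithZero.coe_le_coe.mpr hr

/-- A positive real strictly larger than the norm of an element. -/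
def posNorm (a : A) : PosReal := ⟨‖a‖ + 1, by positivity⟩

/-- The summand 1 in `posNorm` makes the scaled powers decay geometrically; the factor ‖1‖ below
accounts for exponent zero. -/
theorem mem_topNilp_posNorm (a : A) : a ∈ topNilp A (posNorm a) := by
  have hpos : 0 < ‖a‖ + 1 := by positivity
  have hlt : (‖a‖ + 1)⁻¹ * ‖a‖ < 1 := by
    rw [inv_mul_lt_iff₀ hpos]
    linarith
  have h0 : Tendsto (fun n : ℕ => ‖(1 : A)‖ * ((‖a‖ + 1)⁻¹ * ‖a‖) ^ n) atTop (𝓝 0) := by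
    simpa using (tendsto_pow_atTop_nhds_zero_of_lt_one (by positivity) hlt).const_mul ‖(1 : A)‖
  refine squeeze_zero' (Eventually.of_forall fun n => ?_) ?_ h0
  · have := (posNorm a).2
    positivity
  · refine Eventually.of_forall fun n => ?_
    change (‖a‖ + 1)⁻¹ ^ n * ‖a ^ n‖ ≤ _
    have h1 : ‖a ^ n‖ ≤ ‖(1 : A)‖ * ‖a‖ ^ n := by
      rcases Nat.eq_zero_or_pos n with rfl | hn
      · simp
      · rcases subsingleton_or_nontrivial A with hA | hA
        · rw [Subsingleton.elim (a ^ n) 0, norm_zero]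
          positivity
        · have : 1 ≤ ‖(1 : A)‖ := one_le_norm_one A
          exact (norm_pow_le' a hn).trans (le_mul_of_one_le_left (by positivity) this)
    calc _ ≤ (‖a‖ + 1)⁻¹ ^ n * (‖(1 : A)‖ * ‖a‖ ^ n) := by gcongr
      _ = _ := by rw [mul_pow]; ring

/-- The bound depends on a but not on x. This is the source of the uniform constants in the
quasi-compactness argument. -/
theorem Spra.val_le (x : Spra S) (a : A) : x.1.rep.val a ≤ x.1.rep.rv (posNorm a) := by
  have := x.1.le_iff.mp (x.2.1.1 _ a (mem_topNilp_posNorm a))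
  rwa [map_one, mul_one] at this

namespace RationalDatum

theorem mem_subspace_iff (D : RationalDatum A) (x : Spra S) : x ∈ D.subspace S ↔
    (∀ i, x.1.rep.val (D.f i) ≤ x.1.rep.rv (D.q i) * x.1.rep.val D.f₀) ∧ x.1.rep.val D.f₀ ≠ 0 := by
  change ((∀ i, x.1.LE _ _ _) ∧ ¬ x.1.Vanishes _) ↔ _
  simp only [x.1.le_iff, x.1.vanishes_iff, ne_eq]

/-- A rational datum with parameters indexed by a finite type. -/
def ofFintype {ι : Type} [Fintype ι] (f₀ : A) (f : ι → A) (q : ι → PosReal)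
    (hf : Ideal.span (Set.range f) = ⊤) : RationalDatum A where
  n := Fintype.card ι
  f₀ := f₀
  f := f ∘ (Fintype.equivFin ι).symm
  q := q ∘ (Fintype.equivFin ι).symm
  span_eq_top := by rw [EquivLike.range_comp f]; exact hf

theorem mem_ofFintype_iff {ι : Type} [Fintype ι] (f₀ : A) (f : ι → A) (q : ι → PosReal)
    (hf : Ideal.span (Set.range f) = ⊤) (x : Spra S) : x ∈ (ofFintype f₀ f q hf).subspace S ↔
      (∀ i, x.1.rep.val (f i) ≤ x.1.rep.rv (q i) * x.1.rep.val f₀) ∧ x.1.rep.val f₀ ≠ 0 := by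
  rw [mem_subspace_iff]
  refine and_congr_left fun _ => ⟨fun h i => ?_, fun h i => h _⟩
  have := h (Fintype.equivFin ι i)
  simpa [ofFintype] using this

/-- The parameters of the intersection of two rational subspaces. -/
def interParam {α : Type*} [Mul α] (D E : RationalDatum A) (d e : α) (x : Fin D.n → α)
    (y : Fin E.n → α) : (Fin D.n × Fin E.n) ⊕ Fin D.n ⊕ Fin E.n → α :=
  Sum.elim (fun p => x p.1 * y p.2) (Sum.elim (fun i => x i * e) fun j => d * y j)

theorem span_interParam (D E : RationalDatum A) :
    Ideal.span (Set.range (interParam D E D.f₀ E.f₀ D.f E.f)) = ⊤ := by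
  have h : Ideal.span (Set.range D.f) * Ideal.span (Set.range E.f) ≤
      Ideal.span (Set.range (interParam D E D.f₀ E.f₀ D.f E.f)) := by
    rw [Ideal.span_mul_span', Ideal.span_le]
    rintro _ ⟨_, ⟨i, rfl⟩, _, ⟨j, rfl⟩, rfl⟩
    exact Ideal.subset_span ⟨Sum.inl (i, j), rfl⟩
  rw [D.span_eq_top, E.span_eq_top, Ideal.top_mul] at h
  exact top_le_iff.mp h

/-- The intersection of two rational subspaces. -/
def inter (D E : RationalDatum A) : RationalDatum A :=
  ofFintype (D.f₀ * E.f₀) (interParam D E D.f₀ E.f₀ D.f E.f) (interParam D E 1 1 D.q E.q)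
    (span_interParam D E)

/-- The mixed parameters, a numerator of one datum times the denominator of the other, recover the
separate inequalities by cancellation. Products of two numerators follow from these; they are
included so that the unit ideal is generated. -/
theorem mem_inter_iff (D E : RationalDatum A) (x : Spra S) :
    x ∈ (D.inter E).subspace S ↔ x ∈ D.subspace S ∧ x ∈ E.subspace S := by
  set v := x.1.rep with hv
  rw [inter, mem_ofFintype_iff, mem_subspace_iff, mem_subspace_iff, ← hv]
  simp only [Sum.forall, interParam, Sum.elim_inl, Sum.elim_inr, Prod.forall, map_mul, mul_one,
    one_mul, v.rv_mul, mul_ne_zero_iff]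
  constructor
  · rintro ⟨⟨_, h1, h2⟩, hD, hE⟩
    refine ⟨⟨fun i => ?_, hD⟩, fun j => ?_, hE⟩
    · have := h1 i
      rw [← mul_assoc] at this
      exact (mul_le_mul_iff_left₀ (zero_lt_iff.mpr hE)).mp this
    · have := h2 j
      rw [mul_left_comm] at this
      exact (mul_le_mul_iff_right₀ (zero_lt_iff.mpr hD)).mp this
  · rintro ⟨⟨h1, hD⟩, h2, hE⟩
    refine ⟨⟨fun i j => ?_, fun i => ?_, fun j => ?_⟩, hD, hE⟩
    · exact (mul_le_mul' (h1 i) (h2 j)).trans_eq (mul_mul_mul_comm _ _ _ _)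
    · rw [← mul_assoc]
      exact mul_le_mul_left (h1 i) _
    · rw [mul_left_comm]
      exact mul_le_mul_right (h2 j) _

theorem inter_subset_left (D E : RationalDatum A) : (D.inter E).subspace S ⊆ D.subspace S :=
  fun x hx => ((mem_inter_iff D E x).mp hx).1

theorem inter_subset_right (D E : RationalDatum A) : (D.inter E).subspace S ⊆ E.subspace S :=
  fun x hx => ((mem_inter_iff D E x).mp hx).2

theorem span_eq_top_of_one_mem {R : Type*} [CommRing R] {n : ℕ} (f : Fin n → R) (i : Fin n) (hi : f i = 1) :
    Ideal.span (Set.range f) = ⊤ :=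
  (Ideal.eq_top_iff_one _).mpr (Ideal.subset_span ⟨i, hi⟩)

/-- The rational subspace `v(f) ≤ q v(g)`, `r ≤ v(g)`. -/
def basic (f g : A) (q r : PosReal) : RationalDatum A where
  n := 2
  f₀ := g
  f := ![f, 1]
  q := ![q, r⁻¹]
  span_eq_top := span_eq_top_of_one_mem _ 1 rfl

/-- The numerator 1 with weight r⁻¹ encodes the lower bound on v(g) and makes the unit ideal
condition automatic. -/
theorem mem_basic_iff (f g : A) (q r : PosReal) (x : Spra S) : x ∈ (basic f g q r).subspace S ↔
    x.1.rep.val f ≤ x.1.rep.rv q * x.1.rep.val g ∧ x.1.rep.rv r ≤ x.1.rep.val g := by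
  rw [mem_subspace_iff]
  simp only [basic, Fin.forall_fin_two, Matrix.cons_val_zero, Matrix.cons_val_one, map_one]
  rw [x.1.rep.le_rv_mul_iff r⁻¹, inv_inv, mul_one]
  constructor
  · rintro ⟨⟨h1, h2⟩, _⟩
    exact ⟨h1, h2⟩
  · rintro ⟨h1, h2⟩
    exact ⟨⟨h1, h2⟩, ((x.1.rep.rv_pos r).trans_le h2).ne'⟩

/-- The rational subspaces form a basis of the topology. -/
theorem exists_mem_subspace_subset (U : Opens (TopCat.of (Spra S))) (x : Spra S) (hx : x ∈ U) :
    ∃ D : RationalDatum A, x ∈ D.subspace S ∧ D.subspace S ⊆ (U : Set (Spra S)) := by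
  obtain ⟨W, hW, hWU⟩ := isOpen_induced_iff.mp U.2
  change ∃ D : RationalDatum A, x ∈ D.subspace S ∧ D.subspace S ⊆ U.carrier
  rw [← hWU]
  have hxW : x.1 ∈ W := by
    have : x ∈ U.carrier := hx
    rw [← hWU] at this
    exact this
  have key : ∀ W : Set (Sprv A), GenerateOpen
      {U | ∃ (a b : A) (q : PosReal), U = {x : Sprv A | x.LE a b q ∧ ¬ x.Vanishes b}} W →
      x.1 ∈ W → ∃ D : RationalDatum A, x ∈ D.subspace S ∧ D.subspace S ⊆ Subtype.val ⁻¹' W := by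
    intro W hW
    induction hW with
    | basic V hV =>
      obtain ⟨a, b, q, rfl⟩ := hV
      rintro ⟨h1, h2⟩
      rw [x.1.le_iff] at h1
      rw [x.1.vanishes_iff] at h2
      -- Cofinality of the positive reals turns the condition v(b) ≠ 0, which is not rational by
      -- itself, into v(b) ≥ r near x.
      obtain ⟨r, hr⟩ := Spra.exists_rv_le x h2
      refine ⟨basic a b q r, (mem_basic_iff _ _ _ _ x).mpr ⟨h1, hr⟩, fun y hy => ?_⟩
      rw [mem_basic_iff] at hy
      refine ⟨y.1.le_iff.mpr hy.1, fun h => ?_⟩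
      rw [y.1.vanishes_iff] at h
      exact (y.1.rep.rv_pos r).not_ge (hy.2.trans_eq h)
    | univ =>
      refine fun _ => ⟨basic 1 1 1 1, (mem_basic_iff _ _ _ _ x).mpr ?_, fun _ _ => trivial⟩
      simp [x.1.rep.rv_one]
    | inter V W _ _ hV hW =>
      rintro ⟨h1, h2⟩
      obtain ⟨D, hD, hDV⟩ := hV h1
      obtain ⟨E, hE, hEW⟩ := hW h2
      exact ⟨D.inter E, (mem_inter_iff D E x).mpr ⟨hD, hE⟩, fun y hy =>
        ⟨hDV (inter_subset_left D E hy), hEW (inter_subset_right D E hy)⟩⟩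
    | sUnion T _ ih =>
      rintro ⟨V, hV, hxV⟩
      obtain ⟨D, hD, hDV⟩ := ih V hV hxV
      exact ⟨D, hD, fun y hy => ⟨V, hV, hDV hy⟩⟩
  exact key W hW hxW

/-- Generators of the unit ideal are not simultaneously small at any point. -/
theorem exists_forall_exists_le (D : RationalDatum A) : ∃ c : PosReal, ∀ x : Spra S,
    ∃ i, x.1.rep.rv (c * D.q i) ≤ x.1.rep.val (D.f i) := by
  have h : (1 : A) ∈ Ideal.span (Set.range D.f) := by
    rw [D.span_eq_top]
    trivial
  obtain ⟨a, ha⟩ := Ideal.mem_span_range_iff_exists_fun.mp h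
  -- With ∑ aᵢ fᵢ = 1, the number mᵢ bounds v(aᵢ) qᵢ at every point. If all v(fᵢ) were below qᵢ / M
  -- with M ≥ mᵢ, then v(1) < 1. The summand 1 in M keeps it positive for an empty family.
  let m : Fin D.n → PosReal := fun i => posNorm (a i) * D.q i
  let M : PosReal := ⟨∑ i, (m i : ℝ) + 1, by
    have : 0 ≤ ∑ i, (m i : ℝ) := Finset.sum_nonneg fun i _ => (m i).2.le
    positivity⟩
  have hM : ∀ i, m i ≤ M := fun i => by
    have : (m i : ℝ) ≤ ∑ i, (m i : ℝ) :=
      Finset.single_le_sum (f := fun i => (m i : ℝ)) (fun i _ => (m i).2.le) (Finset.mem_univ i)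
    exact Subtype.coe_le_coe.mp (this.trans (by simp [M]))
  refine ⟨M⁻¹, fun x => ?_⟩
  by_contra! hlt
  have h1 : x.1.rep.val (∑ i, a i * D.f i) < 1 := by
    refine Valuation.map_sum_lt _ one_ne_zero fun i _ => ?_
    rw [map_mul]
    have hi := hlt i
    calc x.1.rep.val (a i) * x.1.rep.val (D.f i)
        ≤ x.1.rep.rv (posNorm (a i)) * x.1.rep.val (D.f i) := mul_le_mul_left (Spra.val_le x _) _
      _ < x.1.rep.rv (posNorm (a i)) * x.1.rep.rv (M⁻¹ * D.q i) :=
        mul_lt_mul_of_pos_left hi (x.1.rep.rv_pos _)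
      _ = x.1.rep.rv (M⁻¹ * m i) := by rw [← x.1.rep.rv_mul, mul_left_comm]
      _ ≤ x.1.rep.rv 1 := x.1.rep.rv_le.mpr (inv_mul_le_iff_le_mul.mpr ((hM i).trans_eq (mul_one M).symm))
      _ = 1 := x.1.rep.rv_one
  rw [ha, map_one] at h1
  exact lt_irrefl _ h1

end RationalDatum

end

/-! ### Laurent polynomials over a normed ring -/

section Laurent

open scoped LaurentPolynomial
open LaurentPolynomial

/-- The weighted Gauss norm of a Laurent polynomial is at most `c`. -/
def LaurentBound {B : Type u} [NormedCommRing B] (q : ℝ) (s : B[T;T⁻¹]) (c : ℝ) : Prop :=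
  ∀ j : ℤ, ‖s.coeff j‖ * q ^ j ≤ c

theorem coeff_C_mul_T {B : Type u} [CommRing B] (b : B) (j i : ℤ) :
    (C b * T j).coeff i = if j = i then b else 0 := by
  rw [← single_eq_C_mul_T, AddMonoidAlgebra.coeff_single, Finsupp.single_apply]

theorem laurentBound_C_mul_T {B : Type u} [NormedCommRing B] {q : ℝ} (b : B) (j : ℤ) {c : ℝ}
    (hc : 0 ≤ c) (h : ‖b‖ * q ^ j ≤ c) : LaurentBound q (C b * T j) c := fun i => by
  rw [coeff_C_mul_T]
  split_ifs with hj
  · rwa [← hj]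
  · simpa using hc

theorem laurentBound_sum {B : Type u} [NormedCommRing B] [IsUltrametricDist B] {q : ℝ} (hq : 0 < q)
    {ι : Type*} (t : Finset ι) (s : ι → B[T;T⁻¹]) {c : ℝ} (hc : 0 ≤ c)
    (h : ∀ i ∈ t, LaurentBound q (s i) c) : LaurentBound q (∑ i ∈ t, s i) c := fun j => by
  rw [AddMonoidAlgebra.coeff_sum, Finsupp.finsetSum_apply]
  have hqj : 0 < q ^ j := zpow_pos hq j
  rw [← le_div_iff₀ hqj]
  refine IsUltrametricDist.norm_sum_le_of_forall_le_of_nonneg (by positivity) fun i hi => ?_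
  rw [le_div_iff₀ hqj]
  exact h i hi j

/-- Weighted evaluation of Laurent polynomials: `∑ sⱼ Tʲ` is sent to `∑ φ(sⱼ) wⱼ`. -/
def wev {B C : Type*} [CommRing B] [CommRing C] (φ : B →+* C) (w : ℤ → C) : B[T;T⁻¹] →+ C :=
  (Finsupp.liftAddHom fun j => (AddMonoidHom.mulRight (w j)).comp φ.toAddMonoidHom).comp
    AddMonoidAlgebra.coeffAddEquiv.toAddMonoidHom

theorem wev_eq_sum {B R : Type*} [CommRing B] [CommRing R] (φ : B →+* R) (w : ℤ → R)
    (s : B[T;T⁻¹]) : wev φ w s = ∑ j ∈ s.coeff.support, φ (s.coeff j) * w j := by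
  simp [wev, AddMonoidAlgebra.coeffAddEquiv, Finsupp.sum]

theorem wev_C_mul_T {B R : Type*} [CommRing B] [CommRing R] (φ : B →+* R) (w : ℤ → R)
    (b : B) (j : ℤ) : wev φ w (C b * T j) = φ b * w j := by
  have h : wev φ w (C b * T j) = (C b * T j).coeff.sum fun j b => φ b * w j := wev_eq_sum φ w _
  rw [h, ← single_eq_C_mul_T, AddMonoidAlgebra.coeff_single, Finsupp.sum_single_index]
  rw [map_zero, zero_mul]

theorem norm_wev_le {B R : Type*} [NormedCommRing B] [NormedCommRing R] [IsUltrametricDist R]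
    (φ : B →+* R) (w : ℤ → R) {q M N c : ℝ} (hM : 0 ≤ M) (hN : 0 ≤ N) (hc : 0 ≤ c)
    (hφ : ∀ b, ‖φ b‖ ≤ M * ‖b‖) (hw : ∀ j, ‖w j‖ ≤ N * q ^ j) {s : B[T;T⁻¹]}
    (hs : LaurentBound q s c) : ‖wev φ w s‖ ≤ M * N * c := by
  rw [wev_eq_sum]
  refine IsUltrametricDist.norm_sum_le_of_forall_le_of_nonneg (by positivity) fun j _ => ?_
  calc _ ≤ ‖φ (s.coeff j)‖ * ‖w j‖ := norm_mul_le _ _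
    _ ≤ (M * ‖s.coeff j‖) * (N * q ^ j) := mul_le_mul (hφ _) (hw _) (norm_nonneg _) (by positivity)
    _ = M * N * (‖s.coeff j‖ * q ^ j) := by ring
    _ ≤ _ := by gcongr; exact hs j

/-- The weights for evaluating the part of a Laurent polynomial on one side of zero. -/
def halfWeight {R : Type*} [CommRing R] (σ : ℤ) (c : R) (j : ℤ) : R :=
  if 0 ≤ σ * j then c ^ (σ * j).toNat else 0

theorem halfWeight_zero {R : Type*} [CommRing R] (σ : ℤ) (c : R) : halfWeight σ c 0 = 1 := by
  simp [halfWeight]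

theorem halfWeight_add {R : Type*} [CommRing R] (σ : ℤ) (c : R) {i j : ℤ} (hi : 0 ≤ σ * i)
    (hj : 0 ≤ σ * j) : halfWeight σ c (i + j) = halfWeight σ c i * halfWeight σ c j := by
  unfold halfWeight
  rw [if_pos hi, if_pos hj, mul_add, if_pos (add_nonneg hi hj), Int.toNat_add hi hj, pow_add]

theorem halfWeight_natCast_mul {R : Type*} [CommRing R] (σ : ℤ) (c : R) {j : ℤ} (hj : 0 ≤ σ * j)
    (n : ℕ) : halfWeight σ c (n * j) = halfWeight σ c j ^ n := by
  induction n with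
  | zero => simp [halfWeight_zero]
  | succ n ih =>
    have h : 0 ≤ σ * (n * j) := by
      rw [mul_left_comm]
      positivity
    rw [Nat.cast_succ, add_mul, one_mul, halfWeight_add σ c h hj, ih, pow_succ]

theorem halfWeight_sum {R : Type*} [CommRing R] (σ : ℤ) (c : R) {ι : Type*} (t : Finset ι)
    (m : ι → ℤ) (hm : ∀ i, 0 ≤ σ * m i) (I : ι → ℕ) :
    0 ≤ σ * (∑ i ∈ t, I i * m i) ∧
      halfWeight σ c (∑ i ∈ t, I i * m i) = ∏ i ∈ t, halfWeight σ c (m i) ^ I i := by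
  classical
  induction t using Finset.induction_on with
  | empty => simp [halfWeight_zero]
  | insert a t ha ih =>
    have h : 0 ≤ σ * (I a * m a) := by
      rw [mul_left_comm]
      exact mul_nonneg (Int.natCast_nonneg _) (hm a)
    rw [Finset.sum_insert ha, Finset.prod_insert ha, halfWeight_add σ c h ih.1, ih.2,
      halfWeight_natCast_mul σ c (hm a), mul_add]
    exact ⟨add_nonneg h ih.1, rfl⟩

theorem halfWeight_neg {R : Type*} [CommRing R] {σ : ℤ} (hσ : σ ≠ 0) (c : R) {j : ℤ}
    (hj : 0 ≤ σ * j) : halfWeight (-σ) c j = if j = 0 then 1 else 0 := by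
  unfold halfWeight
  split_ifs with h1 h2 h2
  · subst h2
    simp
  · have : σ * j = 0 := by linarith
    exact absurd this (mul_ne_zero hσ h2)
  · subst h2
    simp at h1
  · rfl

/-- Evaluating the nonnegative part of a multiple of `T - h` at `h`. -/
theorem wev_one_mul {B R : Type*} [CommRing B] [CommRing R] (φ : B →+* R) (h : B) (u : B[T;T⁻¹]) :
    wev φ (halfWeight 1 (φ h)) ((T 1 - C h) * u) = φ (u.coeff (-1)) := by
  induction u using LaurentPolynomial.induction_on' with
  | add p q hp hq =>
    rw [mul_add, map_add, hp, hq, AddMonoidAlgebra.coeff_add, Finsupp.add_apply, map_add]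
  | C_mul_T j b =>
    have e : (T 1 - C h) * (C b * T j) = C b * T (j + 1) - C (h * b) * T j := by
      rw [T_add, map_mul]
      ring
    rw [e, map_sub, wev_C_mul_T, wev_C_mul_T, coeff_C_mul_T]
    unfold halfWeight
    -- For j ≥ 0 the two terms cancel and for j < -1 both are cut off. At j = -1 only T ^ (j + 1) =
    -- 1 survives the cut.
    rcases lt_trichotomy j (-1) with hj | rfl | hj
    · rw [if_neg (by omega), if_neg (by omega), if_neg (by omega)]
      simp
    · simp
    · have : (1 * (j + 1)).toNat = (1 * j).toNat + 1 := by omega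
      rw [if_pos (by omega), if_pos (by omega), if_neg (by omega), this, pow_succ]
      simp only [map_mul, map_zero]
      ring

/-- Evaluating the nonpositive part of a multiple of `T - h` at an inverse of `h`. -/
theorem wev_neg_one_mul {B R : Type*} [CommRing B] [CommRing R] (φ : B →+* R) (h : B) {c : R}
    (hc : φ h * c = 1) (u : B[T;T⁻¹]) :
    wev φ (halfWeight (-1) c) ((T 1 - C h) * u) = -φ (h * u.coeff 0) := by
  induction u using LaurentPolynomial.induction_on' with
  | add p q hp hq =>
    rw [mul_add, map_add, hp, hq, AddMonoidAlgebra.coeff_add, Finsupp.add_apply, mul_add, map_add,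
      neg_add]
  | C_mul_T j b =>
    have e : (T 1 - C h) * (C b * T j) = C b * T (j + 1) - C (h * b) * T j := by
      rw [T_add, map_mul]
      ring
    rw [e, map_sub, wev_C_mul_T, wev_C_mul_T, coeff_C_mul_T]
    unfold halfWeight
    -- Now the boundary is j = 0: T ^ (j + 1) is cut off and the term -h b remains.
    rcases lt_trichotomy j 0 with hj | rfl | hj
    · have : (-1 * j).toNat = (-1 * (j + 1)).toNat + 1 := by omega
      rw [if_pos (by omega), if_pos (by omega), if_neg (by omega), this, pow_succ]
      simp only [map_mul, map_zero, mul_zero, neg_zero]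
      linear_combination (-(φ b * c ^ (-1 * (j + 1)).toNat)) * hc
    · simp
    · rw [if_neg (by omega), if_neg (by omega), if_neg (by omega)]
      simp

theorem coeff_zero_sub_mul {B : Type*} [CommRing B] (h : B) (u : B[T;T⁻¹]) :
    ((T 1 - C h) * u).coeff 0 = u.coeff (-1) - h * u.coeff 0 := by
  induction u using LaurentPolynomial.induction_on' with
  | add p q hp hq =>
    rw [mul_add, AddMonoidAlgebra.coeff_add, Finsupp.add_apply, hp, hq,
      AddMonoidAlgebra.coeff_add, Finsupp.add_apply, Finsupp.add_apply]
    ring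
  | C_mul_T j b =>
    have e : (T 1 - C h) * (C b * T j) = C b * T (j + 1) - C (h * b) * T j := by
      rw [T_add, map_mul]
      ring
    rw [e, sub_eq_add_neg, ← neg_mul, ← map_neg, AddMonoidAlgebra.coeff_add, Finsupp.add_apply,
      coeff_C_mul_T, coeff_C_mul_T, coeff_C_mul_T, coeff_C_mul_T]
    split_ifs <;> first | omega | simp

/-- If two one-sided Laurent polynomials are congruent modulo `T - h` up to a small error,
their values at `h` both come, up to a small error, from one element of the base. -/
theorem exists_approx_of_congr {B R R' : Type*} [NormedCommRing B] [NormedCommRing R]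
    [NormedCommRing R'] [IsUltrametricDist R] [IsUltrametricDist R'] (φ : B →+* R) (φ' : B →+* R')
    (h : B) {c : R'} (hc : φ' h * c = 1) {q M N ε : ℝ} (hM : 0 ≤ M) (hN : 1 ≤ N)
    (hε : 0 ≤ ε) (hφ : ∀ b, ‖φ b‖ ≤ M * ‖b‖) (hφ' : ∀ b, ‖φ' b‖ ≤ M * ‖b‖)
    (hw : ∀ j, ‖halfWeight 1 (φ h) j‖ ≤ N * q ^ j)
    (hw' : ∀ j, ‖halfWeight (-1) c j‖ ≤ N * q ^ j)
    (p p' s u : B[T;T⁻¹]) (hs : LaurentBound q s ε) (hp : p - p' = s + (T 1 - C h) * u)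
    (hp1 : wev φ (halfWeight 1 (φ h)) p' = φ (p'.coeff 0))
    (hp2 : wev φ' (halfWeight (-1) c) p = φ' (p.coeff 0)) :
    ∃ b, ‖wev φ (halfWeight 1 (φ h)) p - φ b‖ ≤ M * N * ε ∧
      ‖wev φ' (halfWeight (-1) c) p' - φ' b‖ ≤ M * N * ε := by
  have hp' : p = p' + s + (T 1 - C h) * u := by rw [add_assoc, ← hp]; ring
  have hp0 : p.coeff 0 = p'.coeff 0 + s.coeff 0 + (u.coeff (-1) - h * u.coeff 0) := by
    rw [hp', AddMonoidAlgebra.coeff_add, Finsupp.add_apply, coeff_zero_sub_mul,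
      AddMonoidAlgebra.coeff_add, Finsupp.add_apply]
  -- Evaluate the nonnegative half of p = p' + s + (T - h)u at h: p' contributes its constant
  -- coefficient and (T - h)u contributes only u₋₁. What remains is the value of s.
  refine ⟨p'.coeff 0 + u.coeff (-1), ?_, ?_⟩
  · have : wev φ (halfWeight 1 (φ h)) p - φ (p'.coeff 0 + u.coeff (-1)) =
        wev φ (halfWeight 1 (φ h)) s := by
      rw [hp', map_add, map_add, wev_one_mul, hp1, map_add]
      ring
    rw [this]
    exact norm_wev_le φ _ hM (zero_le_one.trans hN) hε hφ hw hs
  · have : wev φ' (halfWeight (-1) c) p' - φ' (p'.coeff 0 + u.coeff (-1)) =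
        φ' (s.coeff 0) + -wev φ' (halfWeight (-1) c) s := by
      -- On the nonpositive half, (T - h)u contributes -h u₀, which cancels against the same term in
      -- the constant coefficient of p. Again only s is left.
      have e := hp2
      rw [hp0, hp', map_add, map_add, wev_neg_one_mul φ' h hc] at e
      simp only [map_add, map_sub] at e ⊢
      linear_combination e
    rw [this]
    refine (IsUltrametricDist.norm_add_le_max _ _).trans (max_le ?_ ?_)
    · have h0 := hs 0
      rw [zpow_zero, mul_one] at h0
      calc _ ≤ M * ‖s.coeff 0‖ := hφ' _
        _ ≤ M * ε := by gcongr
        _ = M * 1 * ε := by ring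
        _ ≤ _ := by gcongr
    · rw [norm_neg]
      exact norm_wev_le φ' _ hM (zero_le_one.trans hN) hε hφ' hw' hs

/-! ### Presentations by Laurent monomials -/

variable {A : Type u} [NormedCommRing A] {B : Type u} [NormedCommRing B]

/-- The homomorphism from a polynomial ring to Laurent polynomials with `X k ↦ b k T ^ m k`. -/
def monoHom (ι : A →+* B) {n : ℕ} (b : Fin n → B) (m : Fin n → ℤ) :
    MvPolynomial (Fin n) A →+* B[T;T⁻¹] :=
  MvPolynomial.eval₂Hom ((C : B →+* B[T;T⁻¹]).comp ι) fun k => C (b k) * T (m k)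

theorem monoHom_eq_sum (ι : A →+* B) {n : ℕ} (b : Fin n → B) (m : Fin n → ℤ)
    (P : MvPolynomial (Fin n) A) : monoHom ι b m P =
      ∑ I ∈ P.support, C (ι (P.coeff I) * ∏ k, b k ^ I k) * T (∑ k, (I k : ℤ) * m k) := by
  rw [monoHom, MvPolynomial.coe_eval₂Hom, MvPolynomial.eval₂_eq']
  refine Finset.sum_congr rfl fun I _ => ?_
  have hT : (T (∑ k, (I k : ℤ) * m k) : B[T;T⁻¹]) = ∏ k, T (m k) ^ I k := by
    have : ∀ t : Finset (Fin n), (T (∑ k ∈ t, (I k : ℤ) * m k) : B[T;T⁻¹]) =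
        ∏ k ∈ t, T (m k) ^ I k := fun t => by
      classical
      induction t using Finset.induction_on with
      | empty => simp
      | insert a t ha ih => rw [Finset.sum_insert ha, Finset.prod_insert ha, T_add, ih, T_pow]
    exact this _
  simp only [mul_pow, Finset.prod_mul_distrib, RingHom.comp_apply, map_mul, map_prod, map_pow, hT,
    mul_assoc]

/-- The values of ∏ bₖ^Iₖ at Berkovich points are at most ∏ (rₖ / q^mₖ)^Iₖ, so its norm costs a
single factor K whatever the degree. The powers of q cancel against the weight of T. -/
theorem laurentBound_monoHom [IsUltrametricDist B] (ι : A →+* B) (hι : ∀ a, ‖ι a‖ ≤ ‖a‖) {n : ℕ}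
    (b : Fin n → B) (m : Fin n → ℤ) {K q : ℝ} (hK0 : 0 ≤ K) (hq : 0 < q)
    (hK : ∀ (b : B) (c : ℝ), 0 ≤ c → (∀ v : Berk B, (v b : ℝ) ≤ c) → ‖b‖ ≤ K * c)
    (r : Fin n → PosReal) (hb : ∀ k (v : Berk B), (v (b k) : ℝ) * q ^ m k ≤ r k)
    (P : MvPolynomial (Fin n) A) : LaurentBound q (monoHom ι b m P) (K * gaussNNNorm r P) := by
  rw [monoHom_eq_sum]
  refine laurentBound_sum hq _ _ (by positivity) fun I _ => ?_
  refine laurentBound_C_mul_T _ _ (by positivity) ?_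
  have hq' : ∀ j : ℤ, 0 < q ^ j := fun j => zpow_pos hq j
  have h1 : ‖∏ k, b k ^ I k‖ ≤ K * ∏ k, ((r k : ℝ) / q ^ m k) ^ I k := by
    refine norm_prod_pow_le hK b _ (fun k => div_nonneg (r k).2.le (hq' _).le) (fun k v => ?_) I
    rw [le_div_iff₀ (hq' _)]
    exact hb k v
  have h2 : q ^ (∑ k, (I k : ℤ) * m k) = ∏ k, (q ^ m k) ^ I k := by
    have : ∀ t : Finset (Fin n), q ^ (∑ k ∈ t, (I k : ℤ) * m k) =
        ∏ k ∈ t, (q ^ m k) ^ I k := fun t => by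
      classical
      induction t using Finset.induction_on with
      | empty => simp
      | insert a t ha ih =>
        rw [Finset.sum_insert ha, Finset.prod_insert ha, zpow_add₀ hq.ne', ih, mul_comm (I a : ℤ),
          zpow_mul, zpow_natCast]
    exact this _
  have h3 := le_gaussNNNorm (q := r) P I
  rw [← NNReal.coe_le_coe, NNReal.coe_mul, coe_nnnorm, coe_weight] at h3
  rw [h2]
  have hq2 : 0 ≤ ∏ k, (q ^ m k) ^ I k := Finset.prod_nonneg fun k _ => by
    have := hq' (m k)
    positivity
  calc _ ≤ ‖ι (P.coeff I)‖ * ‖∏ k, b k ^ I k‖ * ∏ k, (q ^ m k) ^ I k := by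
        gcongr
        exact norm_mul_le _ _
    _ ≤ ‖P.coeff I‖ * (K * ∏ k, ((r k : ℝ) / q ^ m k) ^ I k) * ∏ k, (q ^ m k) ^ I k := by
        gcongr
        exact hι _
    _ = K * (‖P.coeff I‖ * ∏ k, (((r k : ℝ) / q ^ m k) ^ I k * (q ^ m k) ^ I k)) := by
        rw [Finset.prod_mul_distrib]
        ring
    _ = K * (‖P.coeff I‖ * ∏ k, (r k : ℝ) ^ I k) := by
        congr 2
        refine Finset.prod_congr rfl fun k _ => ?_
        rw [← mul_pow, div_mul_cancel₀ _ (hq' _).ne']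
    _ ≤ _ := by gcongr

/-- In general `wev` is only additive, but the half weights are multiplicative on exponents of one
sign, so here it is an evaluation of polynomials. -/
theorem wev_monoHom {R : Type*} [CommRing R] (ι : A →+* B) {n : ℕ} (b : Fin n → B)
    (m : Fin n → ℤ) (φ : B →+* R) (σ : ℤ) (c : R) (hm : ∀ k, 0 ≤ σ * m k)
    (P : MvPolynomial (Fin n) A) : wev φ (halfWeight σ c) (monoHom ι b m P) =
      MvPolynomial.eval₂ (φ.comp ι) (fun k => φ (b k) * halfWeight σ c (m k)) P := by
  rw [monoHom_eq_sum, map_sum, MvPolynomial.eval₂_eq']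
  refine Finset.sum_congr rfl fun I _ => ?_
  rw [wev_C_mul_T, (halfWeight_sum σ c Finset.univ m hm I).2]
  simp only [map_mul, map_prod, map_pow, mul_pow, Finset.prod_mul_distrib, RingHom.comp_apply,
    mul_assoc]

/-- The opposite half weight kills every exponent of the given sign except 0, where it is 1. -/
theorem wev_neg_monoHom {R : Type*} [CommRing R] (ι : A →+* B) {n : ℕ} (b : Fin n → B)
    (m : Fin n → ℤ) (φ : B →+* R) {σ : ℤ} (hσ : σ ≠ 0) (c : R) (hm : ∀ k, 0 ≤ σ * m k)
    (P : MvPolynomial (Fin n) A) : wev φ (halfWeight (-σ) c) (monoHom ι b m P) =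
      φ ((monoHom ι b m P).coeff 0) := by
  rw [monoHom_eq_sum, map_sum, AddMonoidAlgebra.coeff_sum, Finsupp.finsetSum_apply, map_sum]
  refine Finset.sum_congr rfl fun I _ => ?_
  rw [wev_C_mul_T, halfWeight_neg hσ c (halfWeight_sum σ c Finset.univ m hm I).1, coeff_C_mul_T]
  split_ifs <;> simp

end Laurent

/-! ### Gluing on simple Laurent covers -/

section Laurent

open scoped LaurentPolynomial
open LaurentPolynomial

variable {A : Type u} [NormedCommRing A] [IsUltrametricDist A]

/-- The fractions `fₖ / f₀` defining `E` are, over the localization at `D`, of the form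
`b k * h ^ m k`, with norms bounded by the weights when `h` is given the weight `q`. -/
structure IsMonomialPresentation (D : RationalDatum A) (h : D.Loc) (q : ℝ) (E : RationalDatum A)
    (b : Fin E.n → D.Loc) (m : Fin E.n → ℤ) : Prop where
  rel : ∀ k, D.toLoc E.f₀ * b k * h ^ (m k).toNat = D.toLoc (E.f k) * h ^ (-m k).toNat
  bound : ∀ k (v : Berk D.Loc), (v (b k) : ℝ) * q ^ m k ≤ E.q k

namespace IsMonomialPresentation

/-- The indices of the parameters of an intersection. -/
def interEquiv (D E : RationalDatum A) :
    Fin (D.inter E).n ≃ (Fin D.n × Fin E.n) ⊕ Fin D.n ⊕ Fin E.n :=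
  (Fintype.equivFin _).symm

theorem inter_f (D E : RationalDatum A) (k : Fin (D.inter E).n) : (D.inter E).f k =
    RationalDatum.interParam D E D.f₀ E.f₀ D.f E.f (interEquiv D E k) := rfl

theorem inter_q (D E : RationalDatum A) (k : Fin (D.inter E).n) : (D.inter E).q k =
    RationalDatum.interParam D E 1 1 D.q E.q (interEquiv D E k) := rfl

/-- The coefficients for the intersection with the base. -/
def interCoeff (D E : RationalDatum A) (b : Fin E.n → D.Loc) (k : Fin (D.inter E).n) : D.Loc :=
  RationalDatum.interParam D E 1 1 D.frac b (interEquiv D E k)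

/-- The exponents for the intersection with the base. -/
def interExp (D E : RationalDatum A) (m : Fin E.n → ℤ) (k : Fin (D.inter E).n) : ℤ :=
  Sum.elim (fun p : Fin D.n × Fin E.n => m p.2) (Sum.elim (fun _ : Fin D.n => 0) m)
    (interEquiv D E k)

theorem interExp_mem {D E : RationalDatum A} {m : Fin E.n → ℤ} {p : ℤ → Prop} (h0 : p 0)
    (hm : ∀ j, p (m j)) (k) : p (interExp D E m k) := by
  unfold interExp
  generalize interEquiv D E k = k
  rcases k with ⟨i, j⟩ | i | j
  · exact hm j
  · exact h0
  · exact hm j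

variable {D : RationalDatum A} {h : D.Loc} {q : ℝ} {E : RationalDatum A} {b : Fin E.n → D.Loc}
  {m : Fin E.n → ℤ}

/-- The piece that actually occurs over D is the intersection. Its fractions are products of those
of D, which carry exponent 0, with those of E. -/
theorem inter (hq : 0 < q) (hE : IsMonomialPresentation D h q E b m) :
    IsMonomialPresentation D h q (D.inter E) (interCoeff D E b) (interExp D E m) := by
  have hf₀ : D.toLoc (D.inter E).f₀ = D.toLoc D.f₀ * D.toLoc E.f₀ := map_mul _ _ _
  constructor
  · intro k
    rw [hf₀, inter_f]
    unfold interCoeff interExp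
    generalize interEquiv D E k = k
    rcases k with ⟨i, j⟩ | i | j
    · simp only [RationalDatum.interParam, Sum.elim_inl, map_mul]
      rw [← D.toLoc_f₀_mul_frac i]
      linear_combination D.toLoc D.f₀ * D.frac i * hE.rel j
    · simp only [RationalDatum.interParam, Sum.elim_inl, Sum.elim_inr, map_mul]
      rw [← D.toLoc_f₀_mul_frac i]
      simp only [neg_zero, Int.toNat_zero, pow_zero]
      ring
    · simp only [RationalDatum.interParam, Sum.elim_inr, map_mul]
      linear_combination D.toLoc D.f₀ * hE.rel j
  · intro k v
    rw [inter_q]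
    unfold interCoeff interExp
    generalize interEquiv D E k = k
    rcases k with ⟨i, j⟩ | i | j
    · simp only [RationalDatum.interParam, Sum.elim_inl, map_mul, NNReal.coe_mul,
        Positive.val_mul]
      rw [mul_assoc]
      exact mul_le_mul (D.berk_frac_le v i) (hE.bound j v) (mul_nonneg (NNReal.coe_nonneg _)
        (zpow_nonneg hq.le _)) (D.q i).2.le
    · simp only [RationalDatum.interParam, Sum.elim_inl, Sum.elim_inr, mul_one, zpow_zero]
      exact D.berk_frac_le v i
    · simp only [RationalDatum.interParam, Sum.elim_inr, one_mul]
      exact hE.bound j v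

/-- The ideal generated by `T - h`. -/
def _root_.Readic.laurentIdeal {B : Type u} [CommRing B] (h : B) : Ideal B[T;T⁻¹] :=
  Ideal.span {T 1 - C h}

theorem _root_.Readic.mk_T_one {B : Type u} [CommRing B] (h : B) :
    Ideal.Quotient.mk (laurentIdeal h) (T 1) = Ideal.Quotient.mk (laurentIdeal h) (C h) :=
  Ideal.Quotient.eq.mpr (Ideal.subset_span rfl)

theorem _root_.Readic.T_mul_T_toNat {B : Type u} [CommRing B] (m : ℤ) :
    (T m : B[T;T⁻¹]) * T 1 ^ (-m).toNat = T 1 ^ m.toNat := by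
  rw [T_pow, T_pow, ← T_add]
  congr 1
  omega

theorem _root_.Readic.isUnit_mk_C {B : Type u} [CommRing B] (h : B) :
    IsUnit (Ideal.Quotient.mk (laurentIdeal h) (C h)) := by
  rw [← mk_T_one]
  exact (isUnit_T 1).map _

/-- Modulo T - h the variable T becomes h. As T is a unit, the negative powers avoided in the field
`rel` become available and can be cancelled. -/
theorem mk_rel (hE : IsMonomialPresentation D h q E b m) (k : Fin E.n) :
    Ideal.Quotient.mk (laurentIdeal h) (C (D.toLoc E.f₀)) *
      Ideal.Quotient.mk (laurentIdeal h) (C (b k) * T (m k)) =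
      Ideal.Quotient.mk (laurentIdeal h) (C (D.toLoc (E.f k))) := by
  have h1 := congrArg (fun x => Ideal.Quotient.mk (laurentIdeal h) (C x)) (hE.rel k)
  simp only [map_mul, map_pow, ← mk_T_one] at h1
  have h2 := congrArg (Ideal.Quotient.mk (laurentIdeal h)) (T_mul_T_toNat (B := D.Loc) (m k))
  simp only [map_mul, map_pow] at h2
  have hu : IsUnit (Ideal.Quotient.mk (laurentIdeal h) (T 1) ^ (-m k).toNat) := by
    rw [mk_T_one]
    exact (isUnit_mk_C h).pow _
  refine hu.mul_right_cancel ?_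
  rw [← h1, ← h2, map_mul]
  ring

/-- Polynomials evaluating to something small are small modulo `T - h` as Laurent polynomials. -/
theorem exists_decomp (hE : IsMonomialPresentation D h q E b m) {K : ℝ} (hK0 : 0 < K) (hq : 0 < q)
    (hK : ∀ (b : D.Loc) (c : ℝ), 0 ≤ c → (∀ v : Berk D.Loc, (v b : ℝ) ≤ c) → ‖b‖ ≤ K * c)
    (P : MvPolynomial (Fin E.n) A) {ε : ℝ} (hP : ‖E.ev P‖ < ε) :
    ∃ s u : D.Loc[T;T⁻¹], LaurentBound q s (K * ε) ∧
      monoHom D.toLoc b m P = s + (T 1 - C h) * u := by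
  obtain ⟨Q, hQ, hPQ⟩ := E.exists_gauss_add_lt P hP
  have hQI : monoHom D.toLoc b m Q ∈ laurentIdeal h := by
    have : Ideal.span (Set.range E.rel) ≤ (laurentIdeal h).comap (monoHom D.toLoc b m) := by
      rw [Ideal.span_le]
      rintro _ ⟨k, rfl⟩
      rw [SetLike.mem_coe, Ideal.mem_comap, ← Ideal.Quotient.eq_zero_iff_mem]
      simp only [RationalDatum.rel, monoHom, map_sub, map_mul, MvPolynomial.coe_eval₂Hom,
        MvPolynomial.eval₂_C,
        MvPolynomial.eval₂_X, RingHom.comp_apply]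
      rw [← hE.mk_rel k, map_mul, sub_self]
    exact this hQ
  obtain ⟨u, hu⟩ := Ideal.mem_span_singleton'.mp hQI
  refine ⟨monoHom D.toLoc b m (P + Q), -u, fun j => ?_, ?_⟩
  · refine (laurentBound_monoHom D.toLoc D.norm_toLoc_le b m hK0.le hq hK E.q hE.bound
      (P + Q) j).trans ?_
    gcongr
  · rw [map_add, ← hu]
    ring

/-- Two ways of evaluating polynomials agree if they agree on constants and satisfy the
relations. -/
theorem comp_monoHom_eq (hE : IsMonomialPresentation D h q E b m) {R : Type u} [CommRing R]
    (ρ : D.Loc[T;T⁻¹] ⧸ laurentIdeal h →+* R) (x : MvPolynomial (Fin E.n) A →+* R)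
    (hx : ∀ a, x (MvPolynomial.C a) = ρ (Ideal.Quotient.mk _ (C (D.toLoc a))))
    (hxrel : ∀ k, x (E.rel k) = 0) (hu : IsUnit (x (MvPolynomial.C E.f₀)))
    (P : MvPolynomial (Fin E.n) A) :
    ρ (Ideal.Quotient.mk _ (monoHom D.toLoc b m P)) = x P := by
  refine RingHom.congr_fun (f := (ρ.comp (Ideal.Quotient.mk _)).comp (monoHom D.toLoc b m))
    (MvPolynomial.ringHom_ext (fun a => ?_) fun k => ?_) P
  · rw [hx]
    simp [monoHom]
  · refine hu.mul_left_cancel ?_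
    have h1 := hxrel k
    rw [RationalDatum.rel, map_sub, map_mul, sub_eq_zero, hx (E.f k), ← hE.mk_rel k, map_mul,
      ← hx] at h1
    rw [h1]
    simp [monoHom]

/-- Monomials for an intersection generate the same subring as monomials for the pieces. -/
theorem mk_mem_range_inter (D E : RationalDatum A) (h : D.Loc) (b : Fin E.n → D.Loc)
    (m : Fin E.n → ℤ) :
    (∀ i, Ideal.Quotient.mk (laurentIdeal h) (C (D.frac i)) ∈ ((Ideal.Quotient.mk
      (laurentIdeal h)).comp (monoHom D.toLoc (interCoeff D E b) (interExp D E m))).range) ∧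
    ∀ j, Ideal.Quotient.mk (laurentIdeal h) (C (b j) * T (m j)) ∈ ((Ideal.Quotient.mk
      (laurentIdeal h)).comp (monoHom D.toLoc (interCoeff D E b) (interExp D E m))).range := by
  have key : ∀ k, Ideal.Quotient.mk (laurentIdeal h) (C (interCoeff D E b k) *
      T (interExp D E m k)) ∈ ((Ideal.Quotient.mk (laurentIdeal h)).comp
        (monoHom D.toLoc (interCoeff D E b) (interExp D E m))).range := fun k =>
    ⟨MvPolynomial.X k, by simp [monoHom]⟩
  constructor
  · intro i
    have := key ((interEquiv D E).symm (Sum.inr (Sum.inl i)))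
    simpa only [interCoeff, interExp, RationalDatum.interParam, Equiv.apply_symm_apply,
      Sum.elim_inr, Sum.elim_inl, mul_one, one_mul, T_zero] using this
  · intro j
    have := key ((interEquiv D E).symm (Sum.inr (Sum.inr j)))
    simpa only [interCoeff, interExp, RationalDatum.interParam, Equiv.apply_symm_apply,
      Sum.elim_inr, Sum.elim_inl, mul_one, one_mul, T_zero] using this

theorem range_inter_le (D E : RationalDatum A) (h : D.Loc) (b : Fin E.n → D.Loc)
    (m : Fin E.n → ℤ) (R : Subring (D.Loc[T;T⁻¹] ⧸ laurentIdeal h))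
    (hR : ∀ a, Ideal.Quotient.mk (laurentIdeal h) (C (D.toLoc a)) ∈ R)
    (hD : ∀ i, Ideal.Quotient.mk (laurentIdeal h) (C (D.frac i)) ∈ R)
    (hE : ∀ j, Ideal.Quotient.mk (laurentIdeal h) (C (b j) * T (m j)) ∈ R)
    (P : MvPolynomial (Fin (D.inter E).n) A) : Ideal.Quotient.mk (laurentIdeal h)
      (monoHom D.toLoc (interCoeff D E b) (interExp D E m) P) ∈ R := by
  have key : ∀ k, Ideal.Quotient.mk (laurentIdeal h) (C (interCoeff D E b k) *
      T (interExp D E m k)) ∈ R := fun k => by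
    unfold interCoeff interExp
    generalize interEquiv D E k = k
    rcases k with ⟨i, j⟩ | i | j
    · simp only [RationalDatum.interParam, Sum.elim_inl, map_mul, mul_assoc]
      have := hE j
      rw [map_mul] at this
      exact R.mul_mem (hD i) this
    · simpa [RationalDatum.interParam] using hD i
    · simpa [RationalDatum.interParam] using hE j
  induction P using MvPolynomial.induction_on with
  | C a => simpa [monoHom] using hR a
  | add P Q hP hQ =>
    rw [map_add, map_add]
    exact R.add_mem hP hQ
  | mul_X P k hP =>
    rw [map_mul, map_mul]
    refine R.mul_mem hP ?_
    simpa [monoHom] using key k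

/-- The value of the half evaluation on a presentation with exponents of one sign. -/
theorem wev_eq_ev (hE : IsMonomialPresentation D h q E b m) (φ : D.Loc →+* E.Loc)
    (hφ : φ.comp D.toLoc = E.toLoc) (σ : ℤ) (c : E.Loc) (hσ : (σ = 1 ∧ c = φ h) ∨
      (σ = -1 ∧ φ h * c = 1)) (hm : ∀ k, 0 ≤ σ * m k) (P : MvPolynomial (Fin E.n) A) :
    wev φ (halfWeight σ c) (monoHom D.toLoc b m P) = E.ev P := by
  rw [wev_monoHom _ _ _ _ _ _ hm, hφ, E.ev_eq_eval₂]
  congr 1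
  funext k
  refine E.isUnit_toLoc_f₀.mul_left_cancel ?_
  have hrel := congrArg φ (hE.rel k)
  have hφ' : ∀ a, φ (D.toLoc a) = E.toLoc a := fun a => RingHom.congr_fun hφ a
  simp only [map_mul, map_pow, hφ'] at hrel
  rw [E.toLoc_f₀_mul_frac, halfWeight, if_pos (hm k), ← mul_assoc]
  have hk := hm k
  rcases hσ with ⟨rfl, rfl⟩ | ⟨rfl, hc⟩
  · rw [one_mul]
    rw [show (-m k).toNat = 0 by omega, pow_zero, mul_one] at hrel
    exact hrel
  · rw [show (m k).toNat = 0 by omega, pow_zero, mul_one] at hrel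
    rw [hrel, neg_one_mul, mul_assoc, ← mul_pow, hc, one_pow, mul_one]

end IsMonomialPresentation

end Laurent

/-! ### Approximate and exact gluing on two-piece covers. -/

section Laurent

open scoped LaurentPolynomial
open LaurentPolynomial

theorem norm_halfWeight_one_le {R : Type*} [NormedCommRing R] {c : R} {q N : ℝ} (hq : 0 < q)
    (hN : 0 ≤ N) (h : ∀ n : ℕ, ‖c ^ n‖ ≤ N * q ^ n) (j : ℤ) :
    ‖halfWeight 1 c j‖ ≤ N * q ^ j := by
  have hqj := zpow_pos hq j
  unfold halfWeight
  split_ifs with hj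
  · refine (h _).trans_eq ?_
    rw [one_mul] at hj
    rw [one_mul, ← zpow_natCast, Int.toNat_of_nonneg hj]
  · rw [norm_zero]
    positivity

theorem norm_halfWeight_neg_one_le {R : Type*} [NormedCommRing R] {c : R} {q N : ℝ} (hq : 0 < q)
    (hN : 0 ≤ N) (h : ∀ n : ℕ, ‖c ^ n‖ ≤ N * q⁻¹ ^ n) (j : ℤ) :
    ‖halfWeight (-1) c j‖ ≤ N * q ^ j := by
  have hqj := zpow_pos hq j
  unfold halfWeight
  split_ifs with hj
  · refine (h _).trans_eq ?_
    rw [← zpow_natCast, Int.toNat_of_nonneg hj, inv_zpow', neg_mul, one_mul, neg_neg]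
  · rw [norm_zero]
    positivity

namespace RationalDatum

variable {A : Type u} [NormedCommRing A] [IsUltrametricDist A] {S : Subring (Gr A)}

/-- The rational subspace `v(f) = q v(g)`, for `v(g) ≥ r`. -/
def basicEq (f g : A) (q r : PosReal) : RationalDatum A where
  n := 3
  f₀ := f * g
  f := ![f ^ 2, g ^ 2, 1]
  q := ![q, q⁻¹, (q * r ^ 2)⁻¹]
  span_eq_top := span_eq_top_of_one_mem _ 2 rfl

/-- Cancel f in f² ≤ q f g and g in g² ≤ q⁻¹ f g. -/
theorem basicEq_subset_left (f g : A) (q r : PosReal) {x : Spra S}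
    (hx : x ∈ (basicEq f g q r).subspace S) (hr : x.1.rep.rv r ≤ x.1.rep.val g) :
    x ∈ (basic f g q r).subspace S ∧ x ∈ (basic g f q⁻¹ (q * r)).subspace S := by
  rw [mem_subspace_iff] at hx
  rw [mem_basic_iff, mem_basic_iff]
  obtain ⟨h1, h2⟩ := hx
  have ha := h1 (0 : Fin 3)
  have hb := h1 (1 : Fin 3)
  simp only [basicEq, Matrix.cons_val_zero, Matrix.cons_val_one, map_mul, map_pow, mul_ne_zero_iff]
    at ha hb h2
  have hf := zero_lt_iff.mpr h2.1
  have hg := zero_lt_iff.mpr h2.2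
  have h3 : x.1.rep.val f ≤ x.1.rep.rv q * x.1.rep.val g := by
    rw [sq, mul_left_comm] at ha
    exact (mul_le_mul_iff_right₀ hf).mp ha
  have h4 : x.1.rep.val g ≤ x.1.rep.rv q⁻¹ * x.1.rep.val f := by
    rw [sq, ← mul_assoc] at hb
    exact (mul_le_mul_iff_left₀ hg).mp hb
  refine ⟨⟨h3, hr⟩, h4, ?_⟩
  rw [x.1.rep.le_rv_mul_iff, inv_inv] at h4
  rw [x.1.rep.rv_mul]
  exact (mul_le_mul_right hr _).trans h4

theorem norm_pow_le_of_berk {B : Type u} [NormedCommRing B] {K : ℝ}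
    (hK : ∀ (b : B) (c : ℝ), 0 ≤ c → (∀ v : Berk B, (v b : ℝ) ≤ c) → ‖b‖ ≤ K * c) {x : B} {q : ℝ}
    (hq : 0 ≤ q) (hx : ∀ v : Berk B, (v x : ℝ) ≤ q) (n : ℕ) : ‖x ^ n‖ ≤ K * q ^ n := by
  refine hK _ _ (pow_nonneg hq n) fun v => ?_
  rw [map_pow, NNReal.coe_pow]
  exact pow_le_pow_left₀ (NNReal.coe_nonneg _) (hx v) n

/-- Sections over the two halves of a simple Laurent cover can approximately be glued. -/
theorem exists_approx_glue (h : IsReallyStablyUniform A) {D D₁ D₂ D₃ : RationalDatum A}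
    (h₁ : D₁.subspace S ⊆ D.subspace S) (h₂ : D₂.subspace S ⊆ D.subspace S)
    (h₃ : D₃.subspace S ⊆ D.subspace S) (h₃₁ : D₃.subspace S ⊆ D₁.subspace S)
    (h₃₂ : D₃.subspace S ⊆ D₂.subspace S) {c : D.Loc} {q : ℝ} (hq : 0 < q)
    {b₁ : Fin D₁.n → D.Loc} {b₂ : Fin D₂.n → D.Loc} {b₃ : Fin D₃.n → D.Loc}
    {m₁ : Fin D₁.n → ℤ} {m₂ : Fin D₂.n → ℤ} {m₃ : Fin D₃.n → ℤ}
    (hQ₁ : IsMonomialPresentation D c q D₁ b₁ m₁) (hQ₂ : IsMonomialPresentation D c q D₂ b₂ m₂)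
    (hQ₃ : IsMonomialPresentation D c q D₃ b₃ m₃) (hm₁ : ∀ k, 0 ≤ 1 * m₁ k)
    (hm₂ : ∀ k, 0 ≤ -1 * m₂ k)
    (hR₁ : ∀ P, Ideal.Quotient.mk (laurentIdeal c) (monoHom D.toLoc b₁ m₁ P) ∈
      ((Ideal.Quotient.mk (laurentIdeal c)).comp (monoHom D.toLoc b₃ m₃)).range)
    (hR₂ : ∀ P, Ideal.Quotient.mk (laurentIdeal c) (monoHom D.toLoc b₂ m₂ P) ∈
      ((Ideal.Quotient.mk (laurentIdeal c)).comp (monoHom D.toLoc b₃ m₃)).range)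
    {c₂ : D₂.Loc} (hc₂ : trans h h₂ c * c₂ = 1) (hu : IsUnit (trans h h₃ c))
    (hv₁ : ∀ v : Berk D₁.Loc, (v (trans h h₁ c) : ℝ) ≤ q)
    (hv₂ : ∀ v : Berk D₂.Loc, (v c₂ : ℝ) ≤ q⁻¹)
    (t₁ : D₁.Loc) (t₂ : D₂.Loc) (ht : trans h h₃₁ t₁ = trans h h₃₂ t₂) {ε : ℝ} (hε : 0 < ε) :
    ∃ b : D.Loc, ‖t₁ - trans h h₁ b‖ ≤ ε ∧ ‖t₂ - trans h h₂ b‖ ≤ ε := by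
  obtain ⟨K, hK0, hK⟩ := (h D).exists_norm_le
  obtain ⟨K₁, hK₁0, hK₁⟩ := (h D₁).exists_norm_le
  obtain ⟨K₂, hK₂0, hK₂⟩ := (h D₂).exists_norm_le
  obtain ⟨M₁, hM₁0, hM₁⟩ := trans_isBoundedHom h h₁
  obtain ⟨M₂, hM₂0, hM₂⟩ := trans_isBoundedHom h h₂
  obtain ⟨L₁, hL₁0, hL₁⟩ := trans_isBoundedHom h h₃₁
  obtain ⟨L₂, hL₂0, hL₂⟩ := trans_isBoundedHom h h₃₂
  -- evaluation at the quotient on the overlap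
  let ev₃ : D.Loc[T;T⁻¹] ⧸ laurentIdeal c →+* D₃.Loc :=
    Ideal.Quotient.lift (laurentIdeal c) (LaurentPolynomial.eval₂ (trans h h₃) hu.unit) fun a ha => by
      have : laurentIdeal c ≤ RingHom.ker (LaurentPolynomial.eval₂ (trans h h₃) hu.unit) := by
        refine Ideal.span_le.mpr (Set.singleton_subset_iff.mpr ?_)
        rw [SetLike.mem_coe, RingHom.mem_ker, map_sub, LaurentPolynomial.eval₂_T,
          LaurentPolynomial.eval₂_C]
        simp
      exact this ha
  have hev₃C : ∀ a, ev₃ (Ideal.Quotient.mk _ (C (D.toLoc a))) = D₃.toLoc a := fun a => by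
    change LaurentPolynomial.eval₂ _ _ _ = _
    rw [LaurentPolynomial.eval₂_C, trans_toLoc]
  have hev : ∀ {E : RationalDatum A} (hE : E.subspace S ⊆ D.subspace S)
      (h₃E : D₃.subspace S ⊆ E.subspace S) {b m} (_ : IsMonomialPresentation D c q E b m) (P),
      ev₃ (Ideal.Quotient.mk _ (monoHom D.toLoc b m P)) = trans h h₃E (E.ev P) := by
    intro E hE h₃E b m hQ P
    refine hQ.comp_monoHom_eq ev₃ ((trans h h₃E).comp E.ev) (fun a => ?_) (fun k => ?_) ?_ P
    · rw [RingHom.comp_apply, ev_C, trans_toLoc, hev₃C]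
    · rw [RingHom.comp_apply, ev_rel, map_zero]
    · rw [RingHom.comp_apply, ev_C]
      exact E.isUnit_toLoc_f₀.map _
  set M := max M₁ M₂
  set N := max 1 (max K₁ K₂)
  set L := max L₁ L₂
  have hM : 0 < M := hM₁0.trans_le (le_max_left _ _)
  have hN : 1 ≤ N := le_max_left _ _
  have hN0 : 0 < N := zero_lt_one.trans_le hN
  have hL : 0 < L := hL₁0.trans_le (le_max_left _ _)
  -- Chosen so that the final error M * N * (K * η) is ε. The approximations are taken within η / L
  -- to remain below η after restriction to the overlap.
  set η := ε / (M * N * K)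
  have hη : 0 < η := by positivity
  obtain ⟨P₁, hP₁⟩ := D₁.exists_norm_sub_ev_lt t₁ (ε := min ε (η / L)) (by positivity)
  obtain ⟨P₂, hP₂⟩ := D₂.exists_norm_sub_ev_lt t₂ (ε := min ε (η / L)) (by positivity)
  -- Modulo T - c, the difference of the two lifts is a polynomial in the generators of the overlap.
  -- Its norm can thus be estimated in the overlap ring and lifted back.
  obtain ⟨P₃, hP₃⟩ := Subring.sub_mem _ (hR₁ P₁) (hR₂ P₂)
  rw [RingHom.comp_apply, ← map_sub] at hP₃
  have hsmall : ‖D₃.ev P₃‖ < η := by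
    have e : D₃.ev P₃ = trans h h₃₂ (t₂ - D₂.ev P₂) - trans h h₃₁ (t₁ - D₁.ev P₁) := by
      have e1 := hev h₃ subset_rfl hQ₃ P₃
      rw [trans_refl] at e1
      rw [← e1, hP₃, map_sub, map_sub, hev h₁ h₃₁ hQ₁, hev h₂ h₃₂ hQ₂, map_sub, map_sub, ht]
      ring
    have key : ∀ {x y : ℝ}, y ≤ L → 0 ≤ x → x < min ε (η / L) → y * x < η := by
      intro x y hy hx hxη
      calc y * x ≤ L * x := by gcongr
        _ < L * (η / L) := by gcongr; exact hxη.trans_le (min_le_right _ _)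
        _ = η := by field_simp
    rw [e]
    refine (sub_eq_add_neg (trans h h₃₂ _) _ ▸ IsUltrametricDist.norm_add_le_max _ _).trans_lt (max_lt ?_ ?_)
    · exact (hL₂ _).trans_lt (key (le_max_right _ _) (norm_nonneg _) hP₂)
    · rw [norm_neg]
      exact (hL₁ _).trans_lt (key (le_max_left _ _) (norm_nonneg _) hP₁)
  -- Smallness on the overlap gives a small representative s modulo T - c. The multiplier u corrects
  -- this choice of representative, and u' corrects the passage to P₃; their sizes do not matter.
  obtain ⟨s, u, hs, hsu⟩ := hQ₃.exists_decomp hK0 hq hK P₃ hsmall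
  obtain ⟨u', hu'⟩ := Ideal.mem_span_singleton'.mp (Ideal.Quotient.eq.mp hP₃.symm)
  obtain ⟨b, hb₁, hb₂⟩ := exists_approx_of_congr (trans h h₁) (trans h h₂) c hc₂ hM.le hN
    (q := q) (ε := K * η) (by positivity)
    (fun b => (hM₁ b).trans (by gcongr; exact le_max_left _ _))
    (fun b => (hM₂ b).trans (by gcongr; exact le_max_right _ _))
    (norm_halfWeight_one_le hq hN0.le fun n => (norm_pow_le_of_berk hK₁ hq.le hv₁ n).trans (by
      gcongr
      exact (le_max_left _ _).trans (le_max_right _ _)))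
    (norm_halfWeight_neg_one_le hq hN0.le fun n =>
      (norm_pow_le_of_berk hK₂ (inv_nonneg.mpr hq.le) hv₂ n).trans (by
        gcongr
        exact (le_max_right _ _).trans (le_max_right _ _)))
    (monoHom D.toLoc b₁ m₁ P₁) (monoHom D.toLoc b₂ m₂ P₂) s (u + u') hs
    (by rw [mul_add, ← add_assoc, ← hsu, mul_comm _ u', hu']; ring)
    (wev_neg_monoHom _ _ _ _ (σ := -1) (by decide) _ hm₂ _)
    (wev_neg_monoHom _ _ _ _ (σ := 1) (by decide) _ hm₁ _)
  rw [hQ₁.wev_eq_ev _ (trans_comp_toLoc h h₁) 1 _ (Or.inl ⟨rfl, rfl⟩) hm₁] at hb₁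
  rw [hQ₂.wev_eq_ev _ (trans_comp_toLoc h h₂) (-1) _ (Or.inr ⟨rfl, hc₂⟩) hm₂] at hb₂
  have hεη : M * N * (K * η) = ε := by
    simp only [η]
    field_simp
  rw [hεη] at hb₁ hb₂
  refine ⟨b, ?_, ?_⟩
  · rw [← sub_add_sub_cancel t₁ (D₁.ev P₁)]
    exact (IsUltrametricDist.norm_add_le_max _ _).trans
      (max_le (hP₁.le.trans (min_le_left _ _)) hb₁)
  · rw [← sub_add_sub_cancel t₂ (D₂.ev P₂)]
    exact (IsUltrametricDist.norm_add_le_max _ _).trans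
      (max_le (hP₂.le.trans (min_le_left _ _)) hb₂)

section Basic

variable {D : RationalDatum A} {f g : A} {q r : PosReal} {g' : D.Loc}

/-- With c = f/g, the fractions are f/g = c and 1/g = g'. -/
theorem isMonomialPresentation_basic (hg' : D.toLoc g * g' = 1)
    (hv : ∀ v : Berk D.Loc, (v g' : ℝ) ≤ (r : ℝ)⁻¹) :
    IsMonomialPresentation D (D.toLoc f * g') q (basic f g q r) ![1, g'] ![1, 0] := by
  constructor
  · change ∀ k : Fin 2, D.toLoc g * (![1, g'] k : D.Loc) * _ = D.toLoc (![f, 1] k) * _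
    rw [Fin.forall_fin_two]
    refine ⟨?_, ?_⟩
    · simp
      linear_combination D.toLoc f * hg'
    · simpa using hg'
  · change ∀ (k : Fin 2) (v : Berk D.Loc), (v (![1, g'] k) : ℝ) * _ ≤ (![q, r⁻¹] k : PosReal)
    rw [Fin.forall_fin_two]
    refine ⟨fun v => ?_, fun v => ?_⟩
    · simp
    · simpa using hv v

/-- Here f is the denominator: g/f = c⁻¹ and 1/f = g' c⁻¹. -/
theorem isMonomialPresentation_basic_symm (hg' : D.toLoc g * g' = 1)
    (hv : ∀ v : Berk D.Loc, (v g' : ℝ) ≤ (r : ℝ)⁻¹) :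
    IsMonomialPresentation D (D.toLoc f * g') q (basic g f q⁻¹ (q * r)) ![1, g'] ![-1, -1] := by
  constructor
  · change ∀ k : Fin 2, D.toLoc f * (![1, g'] k : D.Loc) * _ = D.toLoc (![g, 1] k) * _
    rw [Fin.forall_fin_two]
    refine ⟨?_, ?_⟩
    · simp
      linear_combination - D.toLoc f * hg'
    · simp
  · change ∀ (k : Fin 2) (v : Berk D.Loc), (v (![1, g'] k) : ℝ) * _ ≤
      (![q⁻¹, (q * r)⁻¹] k : PosReal)
    rw [Fin.forall_fin_two]
    refine ⟨fun v => ?_, fun v => ?_⟩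
    · simp
    · have := q.2
      simp
      gcongr
      exact hv v

/-- With denominator f g, the fractions are c, c⁻¹ and 1/(f g) = g'² c⁻¹. -/
theorem isMonomialPresentation_basicEq (hg' : D.toLoc g * g' = 1)
    (hv : ∀ v : Berk D.Loc, (v g' : ℝ) ≤ (r : ℝ)⁻¹) :
    IsMonomialPresentation D (D.toLoc f * g') q (basicEq f g q r) ![1, 1, g' ^ 2] ![1, -1, -1] := by
  constructor
  · change ∀ k : Fin 3, D.toLoc (f * g) * (![1, 1, g' ^ 2] k : D.Loc) * _ =
      D.toLoc (![f ^ 2, g ^ 2, 1] k) * _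
    rw [Fin.forall_fin_succ, Fin.forall_fin_two]
    refine ⟨?_, ?_, ?_⟩
    · simp
      linear_combination D.toLoc f ^ 2 * hg'
    · simp
      linear_combination - D.toLoc f * D.toLoc g * hg'
    · simp
      linear_combination D.toLoc f * g' * hg'
  · change ∀ (k : Fin 3) (v : Berk D.Loc), (v (![1, 1, g' ^ 2] k) : ℝ) * _ ≤
      (![q, q⁻¹, (q * r ^ 2)⁻¹] k : PosReal)
    rw [Fin.forall_fin_succ, Fin.forall_fin_two]
    refine ⟨fun v => ?_, fun v => ?_, fun v => ?_⟩
    · simp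
    · simp
    · have := q.2
      simp
      rw [← inv_pow]
      gcongr
      exact hv v

end Basic

/-- Sections over the two halves of a simple Laurent cover can be glued. -/
theorem exists_glue_laurent (h : IsReallyStablyUniform A) (D : RationalDatum A) (f g : A)
    (q r : PosReal) (hg : ∀ x ∈ D.subspace S, x.1.rep.rv r ≤ x.1.rep.val g)
    (t₁ : (D.inter (basic f g q r)).Loc) (t₂ : (D.inter (basic g f q⁻¹ (q * r))).Loc)
    (ht : ∀ (W : RationalDatum A) (h₁ : W.subspace S ⊆ (D.inter (basic f g q r)).subspace S)
      (h₂ : W.subspace S ⊆ (D.inter (basic g f q⁻¹ (q * r))).subspace S),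
      trans h h₁ t₁ = trans h h₂ t₂) :
    ∃ b : D.Loc, trans h (inter_subset_left (S := S) D _) b = t₁ ∧
      trans h (inter_subset_left (S := S) D _) b = t₂ := by
  have h₁ : (D.inter (basic f g q r)).subspace S ⊆ D.subspace S := inter_subset_left D _
  have h₂ : (D.inter (basic g f q⁻¹ (q * r))).subspace S ⊆ D.subspace S := inter_subset_left D _
  have h₃ : (D.inter (basicEq f g q r)).subspace S ⊆ D.subspace S := inter_subset_left D _
  have h₃₁ : (D.inter (basicEq f g q r)).subspace S ⊆ (D.inter (basic f g q r)).subspace S :=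
    fun x hx => by
      rw [mem_inter_iff] at hx ⊢
      exact ⟨hx.1, (basicEq_subset_left f g q r hx.2 (hg x hx.1)).1⟩
  have h₃₂ : (D.inter (basicEq f g q r)).subspace S ⊆
      (D.inter (basic g f q⁻¹ (q * r))).subspace S := fun x hx => by
    rw [mem_inter_iff] at hx ⊢
    exact ⟨hx.1, (basicEq_subset_left f g q r hx.2 (hg x hx.1)).2⟩
  have hq : (0 : ℝ) < q := q.2
  have hr : (0 : ℝ) < r := r.2
  have hvg : ∀ v : Berk D.Loc, (r : ℝ) ≤ v (D.toLoc g) := fun v => by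
    have h0 := hg _ (((D.pull v).toSprv_mem_subspace_iff S D).mpr (D.pull_mem v))
    have h1 : (D.pull v).toSprv.LE 1 g r⁻¹ := by
      rw [Sprv.le_iff, map_one, ← ReifiedSemivaluation.rv_one, ReifiedSemivaluation.le_rv_mul_iff,
        inv_inv, ReifiedSemivaluation.rv_one, mul_one]
      exact h0
    rw [Berk.toSprv_le, map_one, NNReal.coe_one, Positive.coe_inv, ← div_eq_inv_mul,
      le_div_iff₀ hr, one_mul] at h1
    exact h1
  obtain ⟨g', hg'⟩ := (isUnit_of_berk (D.toLoc g) fun v h0 => by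
    have := hvg v
    rw [h0, NNReal.coe_zero] at this
    linarith).exists_right_inv
  have hvg' : ∀ v : Berk D.Loc, (v g' : ℝ) ≤ (r : ℝ)⁻¹ := fun v => by
    have e : (v (D.toLoc g) : ℝ) * v g' = 1 := by
      rw [← NNReal.coe_mul, ← map_mul, hg', map_one, NNReal.coe_one]
    rw [eq_inv_of_mul_eq_one_right e]
    exact inv_anti₀ hr (hvg v)
  have hQ₁ := (isMonomialPresentation_basic (f := f) (q := q) hg' hvg').inter hq
  have hQ₂ := (isMonomialPresentation_basic_symm (f := f) (q := q) hg' hvg').inter hq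
  have hQ₃ := (isMonomialPresentation_basicEq (f := f) (q := q) hg' hvg').inter hq
  have hTT : ∀ x : D.Loc[T;T⁻¹] ⧸ laurentIdeal (D.toLoc f * g'),
      x * Ideal.Quotient.mk _ (C (D.toLoc f * g')) * Ideal.Quotient.mk _ (T (-1)) = x := fun x => by
    rw [← mk_T_one, mul_assoc, ← map_mul, ← T_add, add_neg_cancel, T_zero, map_one, mul_one]
  obtain ⟨hRD, hRE⟩ := IsMonomialPresentation.mk_mem_range_inter D (basicEq f g q r)
    (D.toLoc f * g') ![1, 1, g' ^ 2] ![1, -1, -1]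
  have hRC : ∀ a, Ideal.Quotient.mk (laurentIdeal (D.toLoc f * g')) (C (D.toLoc a)) ∈
      ((Ideal.Quotient.mk (laurentIdeal (D.toLoc f * g'))).comp (monoHom D.toLoc
        (IsMonomialPresentation.interCoeff D (basicEq f g q r) ![1, 1, g' ^ 2])
        (IsMonomialPresentation.interExp D (basicEq f g q r) ![1, -1, -1]))).range := fun a =>
    ⟨MvPolynomial.C a, by simp [monoHom]⟩
  have hR2 := hRE (2 : Fin 3)
  have hR₁ := IsMonomialPresentation.range_inter_le D (basic f g q r) (D.toLoc f * g') ![1, g']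
    ![1, 0] _ hRC hRD (by
      change ∀ j : Fin 2, _
      rw [Fin.forall_fin_two]
      refine ⟨hRE (0 : Fin 3), ?_⟩
      -- Modulo T - f g', f times the generator g'² T⁻¹ is g', since f g' = T.
      convert Subring.mul_mem _ (hRC f) hR2 using 1
      rw [← hTT (Ideal.Quotient.mk _ (C (![1, g'] 1) * T (![1, 0] 1)))]
      simp
      ring)
  have hR₂ := IsMonomialPresentation.range_inter_le D (basic g f q⁻¹ (q * r)) (D.toLoc f * g')
    ![1, g'] ![-1, -1] _ hRC hRD (by
      change ∀ j : Fin 2, _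
      rw [Fin.forall_fin_two]
      refine ⟨hRE (1 : Fin 3), ?_⟩
      -- Similarly g' T⁻¹ is g times g'² T⁻¹.
      convert Subring.mul_mem _ (hRC g) hR2 using 1
      simp
      rw [← mul_assoc]
      congr 1
      rw [← map_pow, ← map_pow, ← map_mul, ← map_mul]
      congr 2
      linear_combination - g' * hg')
  have hfu : ∀ (q r : PosReal) {E : RationalDatum A}, E.f₀ = D.f₀ * f → IsUnit (E.toLoc f) :=
    fun q r E hE => by
      have := E.isUnit_toLoc_f₀
      rw [hE, map_mul] at this
      exact isUnit_of_mul_isUnit_right this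
  obtain ⟨f', hf'⟩ := (hfu q r (E := D.inter (basic g f q⁻¹ (q * r))) rfl).exists_right_inv
  have hgg : ∀ {E : RationalDatum A} (hE : E.subspace S ⊆ D.subspace S),
      E.toLoc g * trans h hE g' = 1 := fun hE => by
    rw [← trans_toLoc h hE, ← map_mul, hg', map_one]
  have hc₂ : trans h h₂ (D.toLoc f * g') * (f' * (D.inter (basic g f q⁻¹ (q * r))).toLoc g) = 1 := by
    rw [map_mul, trans_toLoc]
    linear_combination (exp := 1) (trans h h₂ g' * (D.inter (basic g f q⁻¹ (q * r))).toLoc g) * hf' +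
      hgg h₂
  have hu : IsUnit (trans h h₃ (D.toLoc f * g')) := by
    rw [map_mul, trans_toLoc]
    refine IsUnit.mul ?_ (IsUnit.of_mul_eq_one_right _ (hgg h₃))
    have : IsUnit ((D.inter (basicEq f g q r)).toLoc (D.f₀ * (f * g))) :=
      (D.inter (basicEq f g q r)).isUnit_toLoc_f₀
    rw [map_mul, map_mul] at this
    exact isUnit_of_mul_isUnit_left (isUnit_of_mul_isUnit_right this)
  have hmem : ∀ {E : RationalDatum A} (v : Berk (D.inter E).Loc), ((D.inter E).pull v).Mem E :=
    fun {E} v => by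
      have := (((D.inter E).pull v).toSprv_mem_subspace_iff S (D.inter E)).mpr
        ((D.inter E).pull_mem v)
      exact (((D.inter E).pull v).toSprv_mem_subspace_iff S E).mp (inter_subset_right D E this)
  have hv₁ : ∀ v : Berk (D.inter (basic f g q r)).Loc,
      (v (trans h h₁ (D.toLoc f * g')) : ℝ) ≤ q := fun v => by
    have hv := (hmem v).1 (0 : Fin 2)
    change (v ((D.inter (basic f g q r)).toLoc f) : ℝ) ≤
      q * v ((D.inter (basic f g q r)).toLoc g) at hv
    have e := congrArg (fun x => (v x : ℝ)) (hgg h₁)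
    simp only [map_mul, map_one, NNReal.coe_mul, NNReal.coe_one, trans_toLoc] at e ⊢
    calc _ ≤ (q : ℝ) * v ((D.inter (basic f g q r)).toLoc g) * v (trans h h₁ g') := by gcongr
      _ = q := by rw [mul_assoc, e, mul_one]
  have hv₂ : ∀ v : Berk (D.inter (basic g f q⁻¹ (q * r))).Loc,
      (v (f' * (D.inter (basic g f q⁻¹ (q * r))).toLoc g) : ℝ) ≤ (q : ℝ)⁻¹ := fun v => by
    have hv := (hmem v).1 (0 : Fin 2)
    change (v ((D.inter (basic g f q⁻¹ (q * r))).toLoc g) : ℝ) ≤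
      (q : ℝ)⁻¹ * v ((D.inter (basic g f q⁻¹ (q * r))).toLoc f) at hv
    have e := congrArg (fun x => (v x : ℝ)) hf'
    simp only [map_mul, map_one, NNReal.coe_mul, NNReal.coe_one] at e ⊢
    rw [mul_comm]
    calc _ ≤ (q : ℝ)⁻¹ * v ((D.inter (basic g f q⁻¹ (q * r))).toLoc f) * v f' := by gcongr
      _ = (q : ℝ)⁻¹ := by rw [mul_assoc, e, mul_one]
  have happrox := fun (ε : ℝ) (hε : 0 < ε) => exists_approx_glue h h₁ h₂ h₃ h₃₁ h₃₂ hq hQ₁ hQ₂ hQ₃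
    (IsMonomialPresentation.interExp_mem (p := fun n : ℤ => 0 ≤ 1 * n) (by simp)
      (by change ∀ k : Fin 2, _; decide))
    (IsMonomialPresentation.interExp_mem (p := fun n : ℤ => 0 ≤ -1 * n) (by simp)
      (by change ∀ k : Fin 2, _; decide))
    hR₁ hR₂ hc₂ hu hv₁ hv₂ t₁ t₂ (ht _ h₃₁ h₃₂) hε
  obtain ⟨K, hK0, hK⟩ := exists_norm_le_of_cover h D S
  have hcov : ∀ x ∈ D.subspace S, ∃ E ∈ ({D.inter (basic f g q r),
      D.inter (basic g f q⁻¹ (q * r))} : Set (RationalDatum A)),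
      E.subspace S ⊆ D.subspace S ∧ x ∈ E.subspace S := fun x hx => by
    rcases le_total (x.1.rep.val f) (x.1.rep.rv q * x.1.rep.val g) with hle | hle
    · exact ⟨_, Or.inl rfl, h₁, (mem_inter_iff _ _ _).mpr
        ⟨hx, (mem_basic_iff _ _ _ _ _).mpr ⟨hle, hg x hx⟩⟩⟩
    · refine ⟨_, Or.inr rfl, h₂, (mem_inter_iff _ _ _).mpr
        ⟨hx, (mem_basic_iff _ _ _ _ _).mpr ⟨?_, ?_⟩⟩⟩
      · rw [ReifiedSemivaluation.le_rv_mul_iff, inv_inv]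
        exact hle
      · rw [ReifiedSemivaluation.rv_mul]
        exact (mul_le_mul_right (hg x hx) _).trans hle
  -- The norm control on the cover makes F bounded below. As `D.Loc` is complete, the range of F is
  -- closed, so a pair approximated by it belongs to it.
  let F : D.Loc →+ (D.inter (basic f g q r)).Loc × (D.inter (basic g f q⁻¹ (q * r))).Loc :=
    (trans h h₁).toAddMonoidHom.prod (trans h h₂).toAddMonoidHom
  have hF : ∀ b, ‖b‖ ≤ K * ‖F b‖ := fun b => hK _ hcov b ‖F b‖ (norm_nonneg _) (by
    rintro E (rfl | rfl) hED
    · exact le_max_left _ _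
    · exact le_max_right _ _)
  have hFa : AntilipschitzWith K.toNNReal F := AddMonoidHomClass.antilipschitz_of_bound F
    (K := K.toNNReal) fun b => by
      rw [Real.coe_toNNReal _ hK0.le]
      exact hF b
  have hFu : UniformContinuous F := uniformContinuous_addMonoidHom_of_continuous
    ((trans_isBoundedHom h h₁).continuous.prodMk (trans_isBoundedHom h h₂).continuous)
  have hcl : (t₁, t₂) ∈ closure (Set.range F) := Metric.mem_closure_iff.mpr fun ε hε => by
    obtain ⟨b, hb₁, hb₂⟩ := happrox (ε / 2) (half_pos hε)
    refine ⟨F b, ⟨b, rfl⟩, ?_⟩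
    rw [dist_eq_norm]
    exact (max_le hb₁ hb₂).trans_lt (half_lt_self hε)
  rw [(hFa.isClosed_range hFu).closure_eq] at hcl
  obtain ⟨b, hb⟩ := hcl
  exact ⟨b, congrArg Prod.fst hb, congrArg Prod.snd hb⟩

end RationalDatum

end Laurent

/-! ### Ultraproducts of reified semivaluations -/

section Ultraproduct

/-- The nonzero part of an element of a group with zero. -/
def nonzeroPart {G : Type u} [CommGroup G] [LinearOrder G] (x : WithZero G) : G := if h : x ≠ 0 then WithZero.unzero h else 1

theorem coe_nonzeroPart {G : Type u} [CommGroup G] [LinearOrder G] {x : WithZero G} (h : x ≠ 0) : ((nonzeroPart x : G) : WithZero G) = x := by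
  rw [nonzeroPart, dif_pos h, WithZero.coe_unzero]

variable {A : Type u} [CommRing A] {ι G : Type u} [CommGroup G] [LinearOrder G]
  [IsOrderedMonoid G] (U : Ultrafilter ι) (v : ι → Valuation A (WithZero G))
  (ρ : ι → PosReal →* G)

/-- The germ of a family of nonzero elements. -/
def germOf (c : ι → WithZero G) : WithZero (Germ (U : Filter ι) G) :=
  (((fun i => nonzeroPart (c i) : ι → G) : Germ (U : Filter ι) G) :
    WithZero (Germ (U : Filter ι) G))

-- Both factors must be nonzero eventually: `nonzeroPart` sends 0 to the default 1, which is not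
-- multiplicative.
variable {U} in
theorem germOf_mul {c d : ι → WithZero G} (hc : ∀ᶠ i in U, c i ≠ 0) (hd : ∀ᶠ i in U, d i ≠ 0) :
    germOf U (fun i => c i * d i) = germOf U c * germOf U d := by
  rw [germOf, germOf, germOf, ← WithZero.coe_mul, WithZero.coe_inj, ← Germ.coe_mul, Germ.coe_eq]
  filter_upwards [hc, hd] with i h1 h2
  rw [Pi.mul_apply, ← WithZero.coe_inj, WithZero.coe_mul, coe_nonzeroPart h1, coe_nonzeroPart h2,
    coe_nonzeroPart (mul_ne_zero h1 h2)]

variable {U} in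
theorem germOf_le {c d : ι → WithZero G} (hc : ∀ᶠ i in U, c i ≠ 0) (hd : ∀ᶠ i in U, d i ≠ 0) :
    germOf U c ≤ germOf U d ↔ ∀ᶠ i in U, c i ≤ d i := by
  rw [germOf, germOf, WithZero.coe_le_coe, Germ.coe_le]
  refine eventually_congr ?_
  filter_upwards [hc, hd] with i h1 h2
  rw [← WithZero.coe_le_coe, coe_nonzeroPart h1, coe_nonzeroPart h2]

/-- The values of `a` are eventually below every positive real. -/
def Negligible (a : A) : Prop := ∀ r : PosReal, ∀ᶠ i in U, v i a ≤ (ρ i r : WithZero G)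

/-- For an ultrafilter, failing to be eventually ≤ means being eventually >. -/
theorem exists_lt_of_not_negligible {a : A} (h : ¬ Negligible U v ρ a) :
    ∃ r : PosReal, ∀ᶠ i in U, (ρ i r : WithZero G) < v i a := by
  rw [Negligible, not_forall] at h
  obtain ⟨r, hr⟩ := h
  refine ⟨r, ?_⟩
  rw [← Ultrafilter.eventually_not] at hr
  filter_upwards [hr] with i hi using not_le.mp hi

theorem not_negligible_iff (hρ : ∀ i, StrictMono (ρ i)) {a : A} : ¬ Negligible U v ρ a ↔
    ∃ r : PosReal, ∀ᶠ i in U, (ρ i r : WithZero G) ≤ v i a := by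
  refine ⟨fun h => ?_, ?_⟩
  · obtain ⟨r, hr⟩ := exists_lt_of_not_negligible U v ρ h
    exact ⟨r, hr.mono fun _ => le_of_lt⟩
  · rintro ⟨r, hr⟩ h
    obtain ⟨i, h1, h2⟩ := (hr.and (h ⟨r / 2, half_pos r.2⟩)).exists
    have := h1.trans h2
    rw [WithZero.coe_le_coe, (hρ i).le_iff_le] at this
    exact (half_lt_self r.2).not_ge this

open Classical in
/-- The value of `a` in the ultraproduct. -/
def ultraVal (a : A) : WithZero (Germ (U : Filter ι) G) :=
  if Negligible U v ρ a then 0 else germOf U fun i => v i a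

variable {U v ρ}

theorem ultraVal_eq_zero_iff {a : A} : ultraVal U v ρ a = 0 ↔ Negligible U v ρ a := by
  unfold ultraVal
  split_ifs with h
  · simp [h]
  · simp [h, germOf]

theorem ultraVal_of_not_negligible {a : A} (h : ¬ Negligible U v ρ a) :
    ultraVal U v ρ a = germOf U fun i => v i a := if_neg h

/-- The lower bound on c makes replacing negligible values by 0 harmless: such values drop below r,
hence below c. -/
theorem ultraVal_le_germOf {a : A} {c : ι → WithZero G} {r : PosReal}
    (hc : ∀ᶠ i in U, (ρ i r : WithZero G) ≤ c i) :
    ultraVal U v ρ a ≤ germOf U c ↔ ∀ᶠ i in U, v i a ≤ c i := by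
  by_cases h : Negligible U v ρ a
  · rw [ultraVal_eq_zero_iff.mpr h]
    refine iff_of_true zero_le ?_
    filter_upwards [hc, h r] with i h1 h2 using h2.trans h1
  · obtain ⟨s, hs⟩ := exists_lt_of_not_negligible U v ρ h
    rw [ultraVal_of_not_negligible h]
    exact germOf_le (hs.mono fun i hi => (zero_le.trans_lt hi).ne')
      (hc.mono fun i hi => (WithZero.zero_lt_coe _ |>.trans_le hi).ne')

theorem germOf_coe (q : PosReal) : germOf U (fun i => (ρ i q : WithZero G)) =
    (((fun i => ρ i q : ι → G) : Germ (U : Filter ι) G) : WithZero (Germ (U : Filter ι) G)) := by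
  rw [germOf, WithZero.coe_inj]
  refine congrArg _ (funext fun i => ?_)
  rw [← WithZero.coe_inj, coe_nonzeroPart WithZero.coe_ne_zero]

theorem ultraVal_mono {a b : A} (h : ∀ᶠ i in U, v i a ≤ v i b) :
    ultraVal U v ρ a ≤ ultraVal U v ρ b := by
  by_cases hb : Negligible U v ρ b
  · have ha : Negligible U v ρ a := fun r => by
      filter_upwards [h, hb r] with i h1 h2 using h1.trans h2
    rw [ultraVal_eq_zero_iff.mpr ha]
    exact zero_le
  · obtain ⟨s, hs⟩ := exists_lt_of_not_negligible U v ρ hb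
    rw [ultraVal_of_not_negligible hb]
    exact (ultraVal_le_germOf (hs.mono fun _ => le_of_lt)).mpr h

theorem ultraVal_le_mul_iff {a b : A} (q : PosReal) (hb : ¬ Negligible U v ρ b) :
    ultraVal U v ρ a ≤ (((fun i => ρ i q : ι → G) : Germ (U : Filter ι) G) :
      WithZero (Germ (U : Filter ι) G)) * ultraVal U v ρ b ↔
      ∀ᶠ i in U, v i a ≤ (ρ i q : WithZero G) * v i b := by
  obtain ⟨s, hs⟩ := exists_lt_of_not_negligible U v ρ hb
  rw [ultraVal_of_not_negligible hb, ← germOf_coe, ← germOf_mul]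
  · refine ultraVal_le_germOf (r := q * s) ?_
    filter_upwards [hs] with i hi
    rw [map_mul, WithZero.coe_mul]
    exact mul_le_mul_right hi.le _
  · exact Eventually.of_forall fun i => WithZero.coe_ne_zero
  · exact hs.mono fun i hi => (zero_le.trans_lt hi).ne'

variable (hρ : ∀ i, StrictMono (ρ i))

variable (U v ρ) in
/-- The ultraproduct of a family of bounded reified semivaluations. -/
def ultraproduct (hb : ∀ a, ∃ R : PosReal, ∀ i, v i a ≤ (ρ i R : WithZero G)) :
    ReifiedSemivaluation A where
  Γ := Germ (U : Filter ι) G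
  val :=
    { toFun := ultraVal U v ρ
      map_zero' := ultraVal_eq_zero_iff.mpr fun r => Eventually.of_forall fun i => by
        rw [map_zero]
        exact zero_le
      map_one' := by
        have h1 : ¬ Negligible U v ρ (1 : A) := (not_negligible_iff U v ρ hρ).mpr
          ⟨1, Eventually.of_forall fun i => by rw [map_one, map_one, WithZero.coe_one]⟩
        rw [ultraVal_of_not_negligible h1]
        have : (fun i => v i (1 : A)) = fun i => ((ρ i 1 : G) : WithZero G) := by
          funext i
          rw [map_one, map_one, WithZero.coe_one]
        rw [this, germOf_coe, ← WithZero.coe_one, WithZero.coe_inj]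
        simp only [map_one]
        rfl
      map_mul' := fun a b => by
        have key : ∀ a b, Negligible U v ρ a → Negligible U v ρ (a * b) := fun a b ha r => by
          obtain ⟨R, hR⟩ := hb b
          filter_upwards [ha (r * R⁻¹)] with i hi
          rw [map_mul]
          refine (mul_le_mul' hi (hR i)).trans_eq ?_
          rw [← WithZero.coe_mul, ← map_mul, inv_mul_cancel_right]
        by_cases ha : Negligible U v ρ a
        · rw [ultraVal_eq_zero_iff.mpr ha, ultraVal_eq_zero_iff.mpr (key a b ha), zero_mul]
        by_cases hb' : Negligible U v ρ b
        · rw [ultraVal_eq_zero_iff.mpr hb', mul_comm, ultraVal_eq_zero_iff.mpr (key b a hb'),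
            mul_zero]
        obtain ⟨r, hr⟩ := exists_lt_of_not_negligible U v ρ ha
        obtain ⟨s, hs⟩ := exists_lt_of_not_negligible U v ρ hb'
        have hab : ¬ Negligible U v ρ (a * b) := (not_negligible_iff U v ρ hρ).mpr ⟨r * s, by
          filter_upwards [hr, hs] with i h1 h2
          rw [map_mul, map_mul, WithZero.coe_mul]
          exact mul_le_mul' h1.le h2.le⟩
        rw [ultraVal_of_not_negligible ha, ultraVal_of_not_negligible hb',
          ultraVal_of_not_negligible hab, ← germOf_mul]
        · simp only [map_mul]
        · exact hr.mono fun i hi => (zero_le.trans_lt hi).ne'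
        · exact hs.mono fun i hi => (zero_le.trans_lt hi).ne'
      map_add_le_max' := fun a b => by
        -- The ultrafilter decides which of the two values is eventually the larger.
        have : (∀ᶠ i in U, v i a ≤ v i b) ∨ ∀ᶠ i in U, v i b ≤ v i a := by
          rw [← Ultrafilter.eventually_or]
          exact Eventually.of_forall fun i => le_total _ _
        rcases this with h | h
        · refine le_max_of_le_right (ultraVal_mono ?_)
          filter_upwards [h] with i hi
          exact ((v i).map_add a b).trans_eq (max_eq_right hi)
        · refine le_max_of_le_left (ultraVal_mono ?_)
          filter_upwards [h] with i hi
          exact ((v i).map_add a b).trans_eq (max_eq_left hi) }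
  reif :=
    { toFun := fun q => ((fun i => ρ i q : ι → G) : Germ (U : Filter ι) G)
      map_one' := by
        simp only [map_one]
        rfl
      map_mul' := fun q r => by
        simp only [map_mul]
        rfl }
  reif_strictMono := fun q r h => Germ.coe_lt.mpr (Eventually.of_forall fun i => hρ i h)

variable (hb : ∀ a, ∃ R : PosReal, ∀ i, v i a ≤ (ρ i R : WithZero G))

/-- Nonzero values are bounded below because negligible ones were set to 0, and above by hypothesis.
Both bounds are carried through the generated subgroup, since inversion exchanges them. -/
theorem ultraproduct_isCofinal : (ultraproduct U v ρ hρ hb).IsCofinal := by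
  set W := ultraproduct U v ρ hρ hb
  have key : ∀ γ ∈ W.valueGroup, ∃ r s : PosReal, W.reif r ≤ γ ∧ γ ≤ W.reif s := by
    intro γ hγ
    induction hγ using Subgroup.closure_induction with
    | mem γ hγ =>
      rcases hγ with ⟨q, rfl⟩ | ⟨a, ha⟩
      · exact ⟨q, q, le_rfl, le_rfl⟩
      · have hn : ¬ Negligible U v ρ a := fun h => by
          have h0 : W.val a = 0 := ultraVal_eq_zero_iff.mpr h
          rw [h0] at ha
          exact WithZero.zero_ne_coe ha
        obtain ⟨r, hr⟩ := exists_lt_of_not_negligible U v ρ hn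
        obtain ⟨R, hR⟩ := hb a
        have e : germOf U (fun i => v i a) = (γ : WithZero W.Γ) :=
          (ultraVal_of_not_negligible hn).symm.trans ha
        have h0 : ∀ᶠ i in U, v i a ≠ 0 := hr.mono fun i hi => (zero_le.trans_lt hi).ne'
        refine ⟨r, R, WithZero.coe_le_coe.mp ?_, WithZero.coe_le_coe.mp ?_⟩
        · rw [← e]
          refine (germOf_coe r).symm.trans_le ((germOf_le ?_ h0).mpr (hr.mono fun _ => le_of_lt))
          exact Eventually.of_forall fun i => WithZero.coe_ne_zero
        · rw [← e]
          refine ((germOf_le h0 ?_).mpr (Eventually.of_forall hR)).trans_eq (germOf_coe R)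
          exact Eventually.of_forall fun i => WithZero.coe_ne_zero
    | one => exact ⟨1, 1, (map_one _).le, (map_one _).ge⟩
    | mul x y _ _ hx hy =>
      obtain ⟨r, s, h1, h2⟩ := hx
      obtain ⟨r', s', h1', h2'⟩ := hy
      exact ⟨r * r', s * s', (map_mul _ _ _).trans_le (mul_le_mul' h1 h1'),
        (mul_le_mul' h2 h2').trans_eq (map_mul _ _ _).symm⟩
    | inv x _ hx =>
      obtain ⟨r, s, h1, h2⟩ := hx
      exact ⟨s⁻¹, r⁻¹, (map_inv _ _).trans_le (inv_le_inv' h2),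
        (inv_le_inv' h1).trans_eq (map_inv _ _).symm⟩
  intro γ hγ
  obtain ⟨r, -, hr, -⟩ := key γ hγ
  exact ⟨r, hr⟩

theorem ultraproduct_le_iff {a b : A} (q : PosReal) (hn : ¬ Negligible U v ρ b) :
    (ultraproduct U v ρ hρ hb).LE a b q ↔
      ∀ᶠ i in U, v i a ≤ (ρ i q : WithZero G) * v i b :=
  ultraVal_le_mul_iff q hn

theorem ultraproduct_val_eq_zero_iff {a : A} :
    (ultraproduct U v ρ hρ hb).val a = 0 ↔ Negligible U v ρ a :=
  ultraVal_eq_zero_iff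

end Ultraproduct

/-! ### Quasi-compactness -/

section QuasiCompact

variable {A : Type u} [NormedCommRing A] [IsUltrametricDist A] {S : Subring (Gr A)}

open RationalDatum

/-- Points of the reified adic spectrum have limits along ultrafilters, for the topology in which
rational subspaces are open and closed. -/
theorem exists_ultralimit {ι : Type u} (U : Ultrafilter ι) (x : ι → Spra S) :
    ∃ y : Spra S, ∀ D : RationalDatum A, y ∈ D.subspace S ↔ ∀ᶠ i in U, x i ∈ D.subspace S := by
  classical
  -- The value groups vary with i. A well-order on ι makes their lexicographic product a totally
  -- ordered group into which each embeds strictly increasingly, so one group G serves for all.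
  obtain ⟨_, _⟩ := exists_wellFoundedLT ι
  let w : ι → ReifiedSemivaluation A := fun i => (x i).1.rep
  let G := Lex (∀ i, (w i).Γ)
  let e : ∀ i, (w i).Γ →* G := fun i => (toLexMulEquiv (∀ i, (w i).Γ)).toMonoidHom.comp
    (MonoidHom.mulSingle (fun i => (w i).Γ) i)
  have he : ∀ i, StrictMono (e i) := fun i a b hab =>
    Pi.toLex_strictMono (Pi.mulSingle_strictMono _ hab)
  let v : ι → Valuation A (WithZero G) := fun i =>
    (w i).val.map (WithZero.map' (e i)) (WithZero.map'_mono (he i).monotone)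
  let ρ : ι → PosReal →* G := fun i => (e i).comp (w i).reif
  have hρ : ∀ i, StrictMono (ρ i) := fun i => (he i).comp (w i).reif_strictMono
  have hle : ∀ i (a b : WithZero (w i).Γ),
      WithZero.map' (e i) a ≤ WithZero.map' (e i) b ↔ a ≤ b := fun i a b =>
    (WithZero.map'_strictMono (he i)).le_iff_le
  have hrv : ∀ i q, ((ρ i q : G) : WithZero G) = WithZero.map' (e i) ((w i).rv q) := fun i q => rfl
  have hv : ∀ i a, v i a = WithZero.map' (e i) ((w i).val a) := fun i a => rfl
  have hb : ∀ a, ∃ R : PosReal, ∀ i, v i a ≤ (ρ i R : WithZero G) := fun a =>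
    ⟨posNorm a, fun i => by
      rw [hrv, hv, hle]
      exact Spra.val_le (x i) a⟩
  have hLE : ∀ i (a b : A) (q : PosReal), v i a ≤ (ρ i q : WithZero G) * v i b ↔
      (x i).1.rep.val a ≤ (x i).1.rep.rv q * (x i).1.rep.val b := fun i a b q => by
    rw [hrv, hv, hv, ← map_mul, hle]
  let y₀ : Sprv A := Quotient.mk _ (ultraproduct U v ρ hρ hb)
  have hy_le : ∀ {a b : A} (q : PosReal), ¬ Negligible U v ρ b → (y₀.LE a b q ↔
      ∀ᶠ i in U, (x i).1.rep.val a ≤ (x i).1.rep.rv q * (x i).1.rep.val b) := fun {a b} q hn =>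
    (ultraproduct_le_iff hρ hb q hn).trans (eventually_congr (Eventually.of_forall fun i =>
      hLE i a b q))
  have hone : ¬ Negligible U v ρ (1 : A) := (not_negligible_iff U v ρ hρ).mpr
    ⟨1, Eventually.of_forall fun i => by rw [map_one, map_one, WithZero.coe_one]⟩
  have hle_one : ∀ {a : A} {r : PosReal}, (∀ i, (x i).1.LE a 1 r) → y₀.LE a 1 r := fun hx =>
    (hy_le _ hone).mpr (Eventually.of_forall fun i => (Sprv.le_iff _).mp (hx i))
  have hy : y₀ ∈ Spra S :=
    ⟨⟨fun r a ha => hle_one fun i => (x i).2.1.1 r a ha, ultraproduct_isCofinal hρ hb⟩,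
      fun r a ha => hle_one fun i => (x i).2.2 r a ha⟩
  refine ⟨⟨y₀, hy⟩, fun D => ?_⟩
  change ((∀ i, y₀.LE _ _ _) ∧ ¬ (ultraproduct U v ρ hρ hb).val D.f₀ = 0) ↔ _
  rw [ultraproduct_val_eq_zero_iff]
  simp only [mem_subspace_iff]
  constructor
  · rintro ⟨h1, h2⟩
    obtain ⟨r, hr⟩ := exists_lt_of_not_negligible U v ρ h2
    refine (eventually_all.mpr fun i => (hy_le _ h2).mp (h1 i)).and ?_
    filter_upwards [hr] with i hi h0
    rw [hv, h0, map_zero] at hi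
    exact not_lt_zero hi
  · intro h
    -- The denominator must not become negligible in the limit. Some numerator is at least c qⱼ at
    -- each point and at most qⱼ v(f₀) on the subspace, so v(f₀) ≥ c uniformly.
    obtain ⟨c, hc⟩ := D.exists_forall_exists_le (S := S)
    have h2 : ¬ Negligible U v ρ D.f₀ := (not_negligible_iff U v ρ hρ).mpr ⟨c, by
      filter_upwards [h] with i hi
      obtain ⟨j, hj⟩ := hc (x i)
      rw [hrv, hv, hle]
      have := hj.trans (hi.1 j)
      rw [ReifiedSemivaluation.le_rv_mul_iff, ← ReifiedSemivaluation.rv_mul, mul_comm c,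
        inv_mul_cancel_left] at this
      exact this⟩
    exact ⟨fun j => (hy_le _ h2).mpr (h.mono fun i hi => hi.1 j), h2⟩

/-- Rational subspaces are quasi-compact. -/
theorem exists_finite_cover (D : RationalDatum A) (𝒰 : Set (RationalDatum A))
    (h : ∀ x ∈ D.subspace S, ∃ E ∈ 𝒰, x ∈ E.subspace S) :
    ∃ F : Finset (RationalDatum A), (F : Set (RationalDatum A)) ⊆ 𝒰 ∧
      ∀ x ∈ D.subspace S, ∃ E ∈ F, x ∈ E.subspace S := by
  classical
  by_contra! hF
  have : ∀ F : Finset 𝒰, ∃ x ∈ D.subspace S, ∀ E ∈ F, x ∉ E.1.subspace S := fun F => by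
    obtain ⟨x, hx, hxF⟩ := hF (F.map ⟨Subtype.val, Subtype.val_injective⟩) (by
      intro E hE
      simp only [Finset.coe_map, Set.mem_image] at hE
      obtain ⟨E', -, rfl⟩ := hE
      exact E'.2)
    exact ⟨x, hx, fun E hE => hxF _ (Finset.mem_map_of_mem _ hE)⟩
  choose x hxD hxF using this
  -- Each point x F avoids the members of F. The limit y lies in some E, so x F lies in E for F in a
  -- set of the ultrafilter; since that ultrafilter refines `atTop`, some such F contains E.
  obtain ⟨y, hy⟩ := exists_ultralimit (Ultrafilter.of (atTop : Filter (Finset 𝒰))) x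
  obtain ⟨E, hE, hyE⟩ := h y ((hy D).mpr (Eventually.of_forall hxD))
  have h1 : ∀ᶠ F in (atTop : Filter (Finset 𝒰)), (⟨E, hE⟩ : 𝒰) ∈ F := by
    filter_upwards [eventually_ge_atTop {(⟨E, hE⟩ : 𝒰)}] with F hF
    exact hF (Finset.mem_singleton_self _)
  obtain ⟨F, h2, h3⟩ := (((hy E).mp hyE).and (Ultrafilter.of_le _ h1)).exists
  exact hxF F _ h3 h2

end QuasiCompact

/-! ### Gluing over rational subspaces -/

namespace RationalDatum

variable {A : Type u} [NormedCommRing A] [IsUltrametricDist A] {S : Subring (Gr A)}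

/-- The parameters of a rational subspace together with the denominator. -/
def param (E : RationalDatum A) (o : Option (Fin E.n)) : A := o.elim E.f₀ E.f

/-- The weights of the parameters of a rational subspace, the denominator having weight one. -/
def paramWeight (E : RationalDatum A) (o : Option (Fin E.n)) : PosReal := o.elim 1 E.q

/-- The values of the parameters at a point, divided by their weights. -/
def paramVal (x : Spra S) (E : RationalDatum A) (o : Option (Fin E.n)) : WithZero x.1.rep.Γ :=
  x.1.rep.rv (E.paramWeight o)⁻¹ * x.1.rep.val (E.param o)

theorem paramVal_le_iff (x : Spra S) (E : RationalDatum A) :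
    x ∈ E.subspace S ↔ (∀ o, paramVal x E o ≤ paramVal x E none) ∧ paramVal x E none ≠ 0 := by
  have h0 : paramVal x E none = x.1.rep.val E.f₀ := by
    change x.1.rep.rv 1⁻¹ * x.1.rep.val E.f₀ = _
    rw [inv_one, ReifiedSemivaluation.rv_one, one_mul]
  rw [mem_subspace_iff, Option.forall, h0]
  refine and_congr_left fun _ => ⟨fun h => ⟨le_rfl, fun i => ?_⟩, fun h i => ?_⟩
  · exact (ReifiedSemivaluation.le_rv_mul_iff _ _).mp (h i)
  · exact (ReifiedSemivaluation.le_rv_mul_iff _ _).mpr (h.2 i)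

/-- Some numerator is bounded below by the unit ideal relation, and on the subspace of E the
denominator dominates every numerator. -/
theorem exists_forall_le_paramVal (E : RationalDatum A) : ∃ c : PosReal, ∀ x : Spra S,
    (∃ o, x.1.rep.rv c ≤ paramVal x E o) ∧
      (x ∈ E.subspace S → x.1.rep.rv c ≤ paramVal x E none) := by
  obtain ⟨c, hc⟩ := E.exists_forall_exists_le (S := S)
  have key : ∀ x : Spra S, ∃ i, x.1.rep.rv c ≤ paramVal x E (some i) := fun x => by
    obtain ⟨i, hi⟩ := hc x
    rw [mul_comm, ReifiedSemivaluation.rv_mul] at hi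
    refine ⟨i, ?_⟩
    have := mul_le_mul_right hi (x.1.rep.rv (E.q i)⁻¹)
    rwa [← mul_assoc, x.1.rep.rv_inv_mul, one_mul] at this
  refine ⟨c, fun x => ⟨(key x).imp' some fun _ => id, fun hx => ?_⟩⟩
  obtain ⟨i, hi⟩ := key x
  exact hi.trans (((paramVal_le_iff x E).mp hx).1 _)

section Product

variable (F : Finset (RationalDatum A))

/-- Product of one parameter from each of finitely many rational data. -/
def prodParam (s : ∀ E : F, Option (Fin E.1.n)) : A := ∏ E : F, E.1.param (s E)

/-- The weight of a product of parameters. -/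
def prodWeight (s : ∀ E : F, Option (Fin E.1.n)) : PosReal := ∏ E : F, E.1.paramWeight (s E)

theorem prod_paramVal (x : Spra S) (s : ∀ E : F, Option (Fin E.1.n)) :
    ∏ E : F, paramVal x E.1 (s E) =
      x.1.rep.rv (prodWeight F s)⁻¹ * x.1.rep.val (prodParam F s) := by
  rw [prodWeight, prodParam, map_prod, ← Finset.prod_inv_distrib, ReifiedSemivaluation.rv_prod, ← Finset.prod_mul_distrib]
  rfl

end Product

variable (h : IsReallyStablyUniform A) {𝒰 : Set (RationalDatum A)}

/-- The family `t` is induced, on the rational subspaces contained in that of `D`, by an element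
over `D`. -/
def Glues (t : ∀ E : 𝒰, E.1.Loc) (S : Subring (Gr A)) (D : RationalDatum A) : Prop :=
  ∃ b : D.Loc, ∀ (E : 𝒰) (hED : E.1.subspace S ⊆ D.subspace S), trans h hED b = t E

/-- The subspace of `D` is covered by the subspaces of members of `𝒰`. -/
def Covered (𝒰 : Set (RationalDatum A)) (S : Subring (Gr A)) (D : RationalDatum A) : Prop :=
  ∀ x ∈ D.subspace S, ∃ E ∈ 𝒰, x ∈ E.subspace S

/-- Members of the cover need not lie in D, but their intersections with D do, and these still
belong to the family. -/
theorem eq_of_covered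
    (h𝒰 : ∀ E ∈ 𝒰, ∀ E' : RationalDatum A, E'.subspace S ⊆ E.subspace S → E' ∈ 𝒰)
    {D : RationalDatum A} (hD : Covered 𝒰 S D) (b c : D.Loc)
    (hbc : ∀ E ∈ 𝒰, ∀ hED : E.subspace S ⊆ D.subspace S, trans h hED b = trans h hED c) :
    b = c :=
  eq_of_cover h D 𝒰 (fun x hx => by
    obtain ⟨E, hE, hxE⟩ := hD x hx
    exact ⟨D.inter E, h𝒰 E hE _ (inter_subset_right D E), inter_subset_left D E,
      (mem_inter_iff D E x).mpr ⟨hx, hxE⟩⟩) b c hbc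

theorem glues_of_laurent
    (h𝒰 : ∀ E ∈ 𝒰, ∀ E' : RationalDatum A, E'.subspace S ⊆ E.subspace S → E' ∈ 𝒰)
    (t : ∀ E : 𝒰, E.1.Loc)
    (ht : ∀ (E E' : 𝒰) (hE : E'.1.subspace S ⊆ E.1.subspace S), trans h hE (t E) = t E')
    {D : RationalDatum A} (hD : Covered 𝒰 S D) (f g : A) (q r : PosReal)
    (hg : ∀ x ∈ D.subspace S, x.1.rep.rv r ≤ x.1.rep.val g)
    (h₁ : Glues h t S (D.inter (basic f g q r)))
    (h₂ : Glues h t S (D.inter (basic g f q⁻¹ (q * r)))) : Glues h t S D := by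
  obtain ⟨b₁, hb₁⟩ := h₁
  obtain ⟨b₂, hb₂⟩ := h₂
  have hl₁ : (D.inter (basic f g q r)).subspace S ⊆ D.subspace S := inter_subset_left D _
  have hl₂ : (D.inter (basic g f q⁻¹ (q * r))).subspace S ⊆ D.subspace S := inter_subset_left D _
  obtain ⟨b, hb, hb'⟩ := exists_glue_laurent h D f g q r hg b₁ b₂ fun W h₁ h₂ => by
    refine eq_of_covered h h𝒰 (fun x hx => hD x (hl₁ (h₁ hx))) _ _ fun E hE hEW => ?_
    rw [trans_trans, trans_trans, hb₁ ⟨E, hE⟩, hb₂ ⟨E, hE⟩]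
  refine ⟨b, fun E hED => ?_⟩
  -- That b restricts to t on E is tested after cutting E itself by the two halves, where b₁ and b₂
  -- are known to induce t.
  have hE₁ : (E.1.inter (D.inter (basic f g q r))).subspace S ⊆ E.1.subspace S :=
    inter_subset_left _ _
  have hE₂ : (E.1.inter (D.inter (basic g f q⁻¹ (q * r)))).subspace S ⊆ E.1.subspace S :=
    inter_subset_left _ _
  refine eq_of_cover (S := S) h E.1 {E.1.inter (D.inter (basic f g q r)),
    E.1.inter (D.inter (basic g f q⁻¹ (q * r)))} (fun x hx => ?_) _ _ ?_
  · rcases le_total (x.1.rep.val f) (x.1.rep.rv q * x.1.rep.val g) with hle | hle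
    · exact ⟨_, Or.inl rfl, hE₁, (mem_inter_iff _ _ _).mpr ⟨hx, (mem_inter_iff _ _ _).mpr
        ⟨hED hx, (mem_basic_iff _ _ _ _ _).mpr ⟨hle, hg x (hED hx)⟩⟩⟩⟩
    · refine ⟨_, Or.inr rfl, hE₂, (mem_inter_iff _ _ _).mpr ⟨hx, (mem_inter_iff _ _ _).mpr
        ⟨hED hx, (mem_basic_iff _ _ _ _ _).mpr ⟨?_, ?_⟩⟩⟩⟩
      · rw [ReifiedSemivaluation.le_rv_mul_iff, inv_inv]
        exact hle
      · rw [ReifiedSemivaluation.rv_mul]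
        exact (mul_le_mul_right (hg x (hED hx)) _).trans hle
  · rintro _ (rfl | rfl) hE
    · have hr : (E.1.inter (D.inter (basic f g q r))).subspace S ⊆
        (D.inter (basic f g q r)).subspace S := inter_subset_right _ _
      rw [trans_trans, ht E ⟨_, h𝒰 _ E.2 _ hE⟩ hE, ← hb₁ _ hr, ← hb, trans_trans]
    · have hr : (E.1.inter (D.inter (basic g f q⁻¹ (q * r)))).subspace S ⊆
        (D.inter (basic g f q⁻¹ (q * r))).subspace S := inter_subset_right _ _
      rw [trans_trans, ht E ⟨_, h𝒰 _ E.2 _ hE⟩ hE, ← hb₂ _ hr, ← hb', trans_trans]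

/-- To glue on `D` it suffices to glue where finitely many comparisons are decided. -/
theorem glues_of_forall_list
    (h𝒰 : ∀ E ∈ 𝒰, ∀ E' : RationalDatum A, E'.subspace S ⊆ E.subspace S → E' ∈ 𝒰)
    (t : ∀ E : 𝒰, E.1.Loc)
    (ht : ∀ (E E' : 𝒰) (hE : E'.1.subspace S ⊆ E.1.subspace S), trans h hE (t E) = t E')
    (L : List (A × A × PosReal)) : ∀ D : RationalDatum A,
    Covered 𝒰 S D → (∀ p ∈ L, ∃ r, ∀ x ∈ D.subspace S, x.1.rep.rv r ≤ x.1.rep.val p.2.1) →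
    (∀ D' : RationalDatum A, D'.subspace S ⊆ D.subspace S → (∀ p ∈ L,
      (∀ x ∈ D'.subspace S, x.1.rep.val p.1 ≤ x.1.rep.rv p.2.2 * x.1.rep.val p.2.1) ∨
      (∀ x ∈ D'.subspace S, x.1.rep.val p.2.1 ≤ x.1.rep.rv p.2.2⁻¹ * x.1.rep.val p.1)) →
      Glues h t S D') → Glues h t S D := by
  induction L with
  | nil => exact fun D _ _ hD' => hD' D subset_rfl (by simp)
  | cons p L ih =>
    obtain ⟨f, g, q⟩ := p
    intro D hD hL hD'
    obtain ⟨r, hr⟩ := hL _ List.mem_cons_self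
    have step : ∀ E : RationalDatum A, ((∀ x ∈ E.subspace S,
        x.1.rep.val f ≤ x.1.rep.rv q * x.1.rep.val g) ∨ (∀ x ∈ E.subspace S,
        x.1.rep.val g ≤ x.1.rep.rv q⁻¹ * x.1.rep.val f)) → Glues h t S (D.inter E) := by
      intro E hE
      have hl : (D.inter E).subspace S ⊆ D.subspace S := inter_subset_left D E
      have hr : (D.inter E).subspace S ⊆ E.subspace S := inter_subset_right D E
      refine ih _ (fun x hx => hD x (hl hx)) (fun p hp => ?_) fun D'' hD'' hp => ?_
      · obtain ⟨r, hr⟩ := hL p (List.mem_cons_of_mem _ hp)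
        exact ⟨r, fun x hx => hr x (hl hx)⟩
      · refine hD' D'' (hD''.trans hl) fun p hpL => ?_
        rcases List.mem_cons.mp hpL with rfl | hpL
        · exact hE.imp (fun h x hx => h x (hr (hD'' hx))) fun h x hx => h x (hr (hD'' hx))
        · exact hp p hpL
    exact glues_of_laurent h h𝒰 t ht hD f g q r hr
      (step _ (Or.inl fun x hx => ((mem_basic_iff _ _ _ _ _).mp hx).1))
      (step _ (Or.inr fun x hx => ((mem_basic_iff _ _ _ _ _).mp hx).1))

/-- Compatible families over a cover by rational subspaces can be glued. -/
theorem glues_of_covered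
    (h𝒰 : ∀ E ∈ 𝒰, ∀ E' : RationalDatum A, E'.subspace S ⊆ E.subspace S → E' ∈ 𝒰)
    (t : ∀ E : 𝒰, E.1.Loc)
    (ht : ∀ (E E' : 𝒰) (hE : E'.1.subspace S ⊆ E.1.subspace S), trans h hE (t E) = t E')
    {D : RationalDatum A} (hD : Covered 𝒰 S D) : Glues h t S D := by
  classical
  have glues_of_mem : ∀ D' ∈ 𝒰, Glues h t S D' := fun D' hD' =>
    ⟨t ⟨D', hD'⟩, fun E hED => ht ⟨D', hD'⟩ E hED⟩
  obtain ⟨F, hF𝒰, hF⟩ := exists_finite_cover D 𝒰 hD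
  choose c hc using fun E : F => E.1.exists_forall_le_paramVal (S := S)
  -- The value `none` selects the denominator. If a product with at least one denominator dominates
  -- all others, that denominator dominates the parameters of its datum.
  let I : Type u := {s : ∀ E : F, Option (Fin E.1.n) // ∃ E, s E = none}
  let ν : ∀ x : Spra S, (∀ E : F, Option (Fin E.1.n)) → WithZero x.1.rep.Γ :=
    fun x s => ∏ E : F, paramVal x E.1 (s E)
  have hν : ∀ x s, ν x s = x.1.rep.rv (prodWeight F s)⁻¹ * x.1.rep.val (prodParam F s) :=
    fun x s => prod_paramVal F x s
  -- one of the products is bounded below at each point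
  have hbig : ∀ x ∈ D.subspace S, ∃ s : I, x.1.rep.rv (∏ E, c E) ≤ ν x s.1 := fun x hx => by
    obtain ⟨E₀, hE₀, hx₀⟩ := hF x hx
    choose o ho using fun E : F => (hc E x).1
    refine ⟨⟨Function.update o ⟨E₀, hE₀⟩ none, ⟨E₀, hE₀⟩, Function.update_self ..⟩, ?_⟩
    rw [ReifiedSemivaluation.rv_prod]
    refine Finset.prod_le_prod' fun E _ => ?_
    dsimp only
    rcases eq_or_ne E ⟨E₀, hE₀⟩ with rfl | hE
    · rw [Function.update_self]
      exact (hc _ x).2 hx₀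
    · rw [Function.update_of_ne hE]
      exact ho E
  -- Halving makes the lower bound strict, so at any point some product fails the alternative of
  -- being at most δ.
  let δ : PosReal := ⟨(∏ E, c E : PosReal) / 2, half_pos (∏ E, c E : PosReal).2⟩
  have hδ : δ < ∏ E, c E := half_lt_self (∏ E, c E : PosReal).2
  have hbig' : ∀ x ∈ D.subspace S, ∃ s : I, x.1.rep.rv δ < ν x s.1 := fun x hx => by
    obtain ⟨s, hs⟩ := hbig x hx
    refine ⟨s, lt_of_lt_of_le ?_ hs⟩
    exact WithZero.coe_lt_coe.mpr (x.1.rep.reif_strictMono hδ)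
  -- decide which products are bounded below by `δ`
  refine glues_of_forall_list h h𝒰 t ht ((Finset.univ : Finset I).toList.map fun s =>
    (prodParam F s.1, 1, prodWeight F s.1 * δ)) D hD ?_ fun D₁ hD₁ hL₁ => ?_
  · intro p hp
    obtain ⟨s, -, rfl⟩ := List.mem_map.mp hp
    exact ⟨1, fun x _ => by rw [map_one, ReifiedSemivaluation.rv_one]⟩
  have hdec₁ : ∀ s : I, (∀ x ∈ D₁.subspace S, ν x s.1 ≤ x.1.rep.rv δ) ∨
      (∀ x ∈ D₁.subspace S, x.1.rep.rv δ ≤ ν x s.1) := fun s => by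
    refine (hL₁ _ (List.mem_map.mpr ⟨s, by simp, rfl⟩)).imp (fun h x hx => ?_) fun h x hx => ?_
    · have := h x hx
      rw [map_one, mul_one, ReifiedSemivaluation.rv_mul, ReifiedSemivaluation.le_rv_mul_iff] at this
      rw [hν]
      exact this
    · have := h x hx
      rw [map_one, mul_inv, mul_comm (prodWeight F s.1)⁻¹, ReifiedSemivaluation.rv_mul, mul_assoc,
        ReifiedSemivaluation.le_rv_mul_iff, inv_inv, mul_one] at this
      rw [hν]
      exact this
  -- compare the products bounded below
  let B : Finset I := {s | ∀ x ∈ D₁.subspace S, x.1.rep.rv δ ≤ ν x s.1}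
  have hB : ∀ s, s ∈ B ↔ ∀ x ∈ D₁.subspace S, x.1.rep.rv δ ≤ ν x s.1 := fun s => by
    simp [B]
  refine glues_of_forall_list h h𝒰 t ht ((B ×ˢ B).toList.map fun s =>
    (prodParam F s.1.1, prodParam F s.2.1, prodWeight F s.1.1 * (prodWeight F s.2.1)⁻¹)) D₁
    (fun x hx => hD x (hD₁ hx)) ?_ fun D₂ hD₂ hL₂ => ?_
  · intro p hp
    obtain ⟨s, hs, rfl⟩ := List.mem_map.mp hp
    rw [Finset.mem_toList, Finset.mem_product] at hs
    refine ⟨prodWeight F s.2.1 * δ, fun x hx => ?_⟩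
    have := (hB _).mp hs.2 x hx
    rw [hν, ReifiedSemivaluation.le_rv_mul_iff, inv_inv, ← ReifiedSemivaluation.rv_mul] at this
    exact this
  have hiff : ∀ (x : Spra S) (s s' : ∀ E : F, Option (Fin E.1.n)), ν x s ≤ ν x s' ↔
      x.1.rep.val (prodParam F s) ≤
        x.1.rep.rv (prodWeight F s * (prodWeight F s')⁻¹) * x.1.rep.val (prodParam F s') :=
    fun x s s' => by
      rw [hν, hν, ReifiedSemivaluation.rv_mul, mul_assoc,
        x.1.rep.le_rv_mul_iff (prodWeight F s)]
  have hdec₂ : ∀ s s' : B, (∀ x ∈ D₂.subspace S, ν x s.1.1 ≤ ν x s'.1.1) ∨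
      (∀ x ∈ D₂.subspace S, ν x s'.1.1 ≤ ν x s.1.1) := fun s s' => by
    refine (hL₂ _ (List.mem_map.mpr ⟨(s.1, s'.1), by simp, rfl⟩)).imp (fun h x hx => ?_)
      fun h x hx => ?_
    · exact (hiff x _ _).mpr (h x hx)
    · refine (hiff x _ _).mpr ?_
      have := h x hx
      rwa [mul_inv, inv_inv, mul_comm (prodWeight F s.1.1)⁻¹] at this
  -- An empty subspace is contained in every member of the family. Either it is itself a member, or
  -- the family is empty and any element glues.
  rcases (D₂.subspace S).eq_empty_or_nonempty with h0 | ⟨x₀, hx₀⟩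
  · by_cases hD₂𝒰 : D₂ ∈ 𝒰
    · exact glues_of_mem D₂ hD₂𝒰
    · exact ⟨0, fun E _ => (hD₂𝒰 (h𝒰 E.1 E.2 D₂ (h0.trans_subset (Set.empty_subset _)))).elim⟩
  -- the largest product
  obtain ⟨s₀, hs₀⟩ : ∃ s₀ : B, ∀ s : B, ∀ x ∈ D₂.subspace S, ν x s.1.1 ≤ ν x s₀.1.1 := by
    obtain ⟨s, hs⟩ := hbig' x₀ (hD₁ (hD₂ hx₀))
    have hsB : s ∈ B := (hB s).mpr ((hdec₁ s).resolve_left fun h =>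
      (h x₀ (hD₂ hx₀)).not_gt hs)
    let R : B → B → Prop := fun s s' => ∀ x ∈ D₂.subspace S, ν x s.1.1 ≤ ν x s'.1.1
    have : IsTrans B R := ⟨fun a b c hab hbc x hx => (hab x hx).trans (hbc x hx)⟩
    have : Nonempty B := ⟨⟨s, hsB⟩⟩
    have hdir : Directed R (id : B → B) := fun a b => by
      rcases hdec₂ a b with hab | hab
      · exact ⟨b, hab, fun _ _ => le_rfl⟩
      · exact ⟨a, fun _ _ => le_rfl, hab⟩
    obtain ⟨z, hz⟩ := hdir.finset_le Finset.univ
    exact ⟨z, fun s => hz s (Finset.mem_univ s)⟩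
  -- Arbitrary tuples reduce to those in I: at a point of E, putting the denominator of E in that
  -- coordinate can only increase the product.
  have hmax : ∀ x ∈ D₂.subspace S, ∀ s, ν x s ≤ ν x s₀.1.1 := fun x hx s => by
    have hmax' : ∀ s : I, ν x s.1 ≤ ν x s₀.1.1 := fun s => by
      rcases hdec₁ s with hs | hs
      · exact (hs x (hD₂ hx)).trans ((hB _).mp s₀.2 x (hD₂ hx))
      · exact hs₀ ⟨s, (hB s).mpr hs⟩ x hx
    obtain ⟨E, hE, hxE⟩ := hF x (hD₁ (hD₂ hx))
    refine le_trans (Finset.prod_le_prod' fun E' _ => ?_)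
      (hmax' ⟨Function.update s ⟨E, hE⟩ none, ⟨E, hE⟩, Function.update_self ..⟩)
    dsimp only
    rcases eq_or_ne E' ⟨E, hE⟩ with rfl | hne
    · rw [Function.update_self]
      exact ((paramVal_le_iff x E).mp hxE).1 _
    · rw [Function.update_of_ne hne]
  -- The coordinate E does not depend on the point. Comparing s₀ with the tuples that differ from it
  -- only there, and cancelling the other nonzero factors, places the whole of D₂ inside E.
  obtain ⟨E, hE⟩ := s₀.1.2
  refine glues_of_mem D₂ (h𝒰 E.1 (hF𝒰 E.2) D₂ fun x hx => (paramVal_le_iff x E.1).mpr ?_)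
  have hne : ν x s₀.1.1 ≠ 0 :=
    ((x.1.rep.rv_pos δ).trans_le ((hB _).mp s₀.2 x (hD₂ hx))).ne'
  have hsplit : ∀ s, ν x s = paramVal x E.1 (s E) * ∏ E' ∈ Finset.univ.erase E, paramVal x E'.1 (s E') :=
    fun s => (Finset.mul_prod_erase _ _ (Finset.mem_univ E)).symm
  have h0 := hsplit s₀.1.1
  rw [hE] at h0
  refine ⟨fun o => ?_, fun h => hne (by rw [h0, h, zero_mul])⟩
  have hle := hmax x hx (Function.update s₀.1.1 E o)
  rw [hsplit, h0, Function.update_self, Finset.prod_congr rfl fun E' hE' => by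
    rw [Function.update_of_ne (Finset.ne_of_mem_erase hE')]] at hle
  refine le_of_mul_le_mul_right hle (zero_lt_iff.mpr fun h => hne (by rw [h0, h, mul_zero]))

end RationalDatum

/-! ### The sheaf property -/

section Sheaf

open RationalDatum

variable {A : Type u} [NormedCommRing A] [IsUltrametricDist A] {S : Subring (Gr A)}

/-- Compatible sections over the members of an open cover glue uniquely. -/
theorem existsUnique_section (h : IsReallyStablyUniform A) (W : Opens (TopCat.of (Spra S)))
    (𝒱 : Set (Opens (TopCat.of (Spra S)))) (h𝒱 : ∀ V ∈ 𝒱, V ≤ W)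
    (hW : ∀ x ∈ W, ∃ V ∈ 𝒱, x ∈ V) (s : ∀ V : 𝒱, sections S V.1)
    (hs : ∀ (V V' : 𝒱) (D : RationalDatum A) (hV : D.subspace S ⊆ (V.1 : Set (Spra S)))
      (hV' : D.subspace S ⊆ (V'.1 : Set (Spra S))), (s V).1 ⟨D, hV⟩ = (s V').1 ⟨D, hV'⟩) :
    ∃! σ : sections S W, ∀ V : 𝒱, restrict S (h𝒱 V.1 V.2) σ = s V := by
  -- Rational subspaces inside some member of the cover. The section prescribed on such a subspace
  -- is independent of the chosen member by `hs`.
  let 𝒰 : Set (RationalDatum A) := {D | ∃ V : 𝒱, D.subspace S ⊆ (V.1 : Set (Spra S))}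
  have h𝒰 : ∀ E ∈ 𝒰, ∀ E' : RationalDatum A, E'.subspace S ⊆ E.subspace S → E' ∈ 𝒰 := by
    rintro E ⟨V, hV⟩ E' hE'
    exact ⟨V, hE'.trans hV⟩
  choose V hV using fun E : 𝒰 => E.2
  let t : ∀ E : 𝒰, E.1.Loc := fun E => (s (V E)).1 ⟨E.1, hV E⟩
  have ht : ∀ (E E' : 𝒰) (hE : E'.1.subspace S ⊆ E.1.subspace S), trans h hE (t E) = t E' :=
    fun E E' hE => by
      refine ((s (V E)).2 ⟨E.1, hV E⟩ ⟨E'.1, hE.trans (hV E)⟩ hE (trans h hE)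
        (trans_isBoundedHom h hE) (trans_comp_toLoc h hE)).trans ?_
      exact hs _ _ _ _ _
  have hcov : ∀ D : RationalIn S W, Covered 𝒰 S D.1 := fun D x hx => by
    obtain ⟨V, hV, hxV⟩ := hW x (D.2 hx)
    obtain ⟨E, hxE, hEV⟩ := exists_mem_subspace_subset V x hxV
    exact ⟨E, ⟨⟨V, hV⟩, hEV⟩, hxE⟩
  choose b hb using fun D : RationalIn S W => glues_of_covered h h𝒰 t ht (hcov D)
  refine ⟨⟨b, fun D E hED φ hφ hφA => ?_⟩, fun V' => ?_, fun σ hσ => ?_⟩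
  · rw [eq_trans h hED φ hφ hφA]
    refine eq_of_covered h h𝒰 (hcov E) _ _ fun F hF hFE => ?_
    rw [trans_trans, hb D ⟨F, hF⟩, hb E ⟨F, hF⟩]
  · refine Subtype.ext (funext fun D => ?_)
    have hD : D.1 ∈ 𝒰 := ⟨V', D.2⟩
    change b ⟨D.1, D.2.trans (h𝒱 _ V'.2)⟩ = _
    -- Here D is itself in the family, so the gluing property applies to the identity inclusion.
    rw [← trans_refl (S := S) h (b _), hb _ ⟨D.1, hD⟩]
    exact hs _ _ _ _ _
  · refine Subtype.ext (funext fun D => ?_)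
    refine eq_of_covered h h𝒰 (hcov D) _ _ fun F hF hFD => ?_
    change _ = trans h hFD (b D)
    rw [hb D ⟨F, hF⟩]
    have h1 := σ.2 D ⟨F, hFD.trans D.2⟩ hFD (trans h hFD) (trans_isBoundedHom h hFD)
      (trans_comp_toLoc h hFD)
    have h2 := congrFun (congrArg Subtype.val (hσ (V ⟨F, hF⟩))) ⟨F, hV ⟨F, hF⟩⟩
    exact h1.trans h2

/-- A family of ring homomorphisms that lifts uniquely elementwise lifts uniquely. -/
theorem existsUnique_ringHom {ι : Type*} {E R : Type*} [CommRing E] [CommRing R] {R' : ι → Type*}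
    [∀ i, CommRing (R' i)] (r : ∀ i, R →+* R' i) (y : ∀ i, E →+* R' i)
    (h : ∀ e, ∃! σ, ∀ i, r i σ = y i e) : ∃! τ : E →+* R, ∀ i, (r i).comp τ = y i := by
  choose σ hσ hσu using h
  refine ⟨⟨⟨⟨σ, ?_⟩, fun a b => ?_⟩, ?_, fun a b => ?_⟩, fun i => RingHom.ext fun e => hσ e i, fun τ hτ =>
    RingHom.ext fun e => hσu e (τ e) fun i => RingHom.congr_fun (hτ i) e⟩
  · exact (hσu 1 1 fun i => by rw [map_one, map_one]).symm
  · exact (hσu (a * b) (σ a * σ b) fun i => by rw [map_mul, map_mul, hσ, hσ]).symm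
  · exact (hσu 0 0 fun i => by rw [map_zero, map_zero]).symm
  · exact (hσu (a + b) (σ a + σ b) fun i => by rw [map_add, map_add, hσ, hσ]).symm

/-- The structure presheaf of a really stably uniform ring is a sheaf. -/
theorem isSheaf_structurePresheaf (h : IsReallyStablyUniform A) : (structurePresheaf S).IsSheaf := by
  -- The sheaf condition is tested on homomorphisms from an arbitrary ring E. Gluing is done for
  -- each element of E, and uniqueness makes the result a ring homomorphism.
  intro E W R hR x hx
  let 𝒱 : Set (Opens (TopCat.of (Spra S))) := {V | ∃ f : V ⟶ W, R f}
  have h𝒱 : ∀ V ∈ 𝒱, V ≤ W := fun V ⟨f, _⟩ => f.le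
  have hR' : ∀ V : 𝒱, R (homOfLE (h𝒱 V.1 V.2)) := fun V => by
    obtain ⟨f, hf⟩ := V.2
    exact hf
  let y : ∀ V : 𝒱, E →+* sections S V.1 := fun V => (x (homOfLE (h𝒱 V.1 V.2)) (hR' V)).hom
  have hglue : ∀ e : E, ∃! σ : sections S W, ∀ V : 𝒱, restrict S (h𝒱 V.1 V.2) σ = y V e := by
    intro e
    refine existsUnique_section h W 𝒱 h𝒱 (fun p hp => ?_) (fun V => y V e) fun V V' D hD hD' => ?_
    · obtain ⟨V, f, hf, hpV⟩ := hR p hp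
      exact ⟨V, ⟨f, hf⟩, hpV⟩
    · have hle : V.1 ⊓ V'.1 ≤ V.1 := inf_le_left
      have hle' : V.1 ⊓ V'.1 ≤ V'.1 := inf_le_right
      have := hx (homOfLE hle) (homOfLE hle') (hR' V) (hR' V') (Subsingleton.elim _ _)
      have h1 := congrArg (fun z : E ⟶ CommRingCat.of (sections S (V.1 ⊓ V'.1)) => z.hom e) this
      exact congrFun (congrArg Subtype.val h1) ⟨D, fun p hp => ⟨hD hp, hD' hp⟩⟩
  obtain ⟨τ, hτ, hτu⟩ := existsUnique_ringHom (fun V : 𝒱 => restrict S (h𝒱 V.1 V.2)) y hglue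
  refine ⟨CommRingCat.ofHom τ, fun V f hf => ?_, fun τ' hτ' => ?_⟩
  · exact CommRingCat.hom_ext (hτ ⟨V, f, hf⟩)
  · refine CommRingCat.hom_ext (hτu τ'.hom fun V => ?_)
    exact congrArg (fun z : E ⟶ CommRingCat.of (sections S V.1) => z.hom) (hτ' _ (hR' V))

end Sheaf

end

end Readic

theorem theoremT {A : Type u} [NormedCommRing A] [IsUltrametricDist A] [CompleteSpace A]
    (AGr : Subring (Readic.Gr A)) (hAGr : Readic.IsIntegralStructure AGr)
    (h : Readic.IsReallyStablyUniform A) : Readic.IsSheafy AGr := by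
  exact Readic.isSheaf_structurePresheaf h
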